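/- **Definitions.** Let $\mathcal S$ be a finite set of finite sets, $s=|\mathcal S|$, $n=\sum_{S\in\mathcal S}|S|$, $\mathcal U=\bigcup_{S\in\mathcal S}S$ and $u=|\mathcal U|$. A *symdiff graph* on $\mathcal S$ is a weighted directed graph on the nodes $\mathcal S\cup\{\emptyset,\mathcal U\}$ in which exactly one edge leaves each $S\in\mathcal S$, to a node called $p(S)$, with weight $|S\triangle p(S)|$, and in which there is a path (possibly of length $0$) from every $S\in\mathcal S$ to $\emptyset$ or to $\mathcal U$. Its *weight* is the sum of its edge weights. The *symdiff compressibility* $\Delta(\mathcal S)$ is the minimum weight of a symdiff graph on $\mathcal S$. The model is the word RAM with $\omega$-bit words, where $\omega\ge c\log_2(n+s+2)$ for a suitable constant $c$, with unit-cost arithmetic, bitwise, shift, comparison and memory access instructions. The elements of the sets are words, and $O(f)$ means at most $C\,(f+1)$ for an absolute constant $C$. **Theorem.** 1. *(Space)* If the elements of $\mathcal U$ are renamed, preserving their order, to the integers $1,\dots,u$, then $\mathcal S$ can be represented by a sequence of $O(\Delta(\mathcal S))$ words, from which a fixed word RAM program recovers all the sets of $\mathcal S$, in any prescribed order. 2.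 *(Construction)* A fixed word RAM program, given the sets of $\mathcal S$ (in any order, each by its elements in any order), builds a minimum-weight symdiff graph on $\mathcal S$, that is, $p(S)$ and the edge weight $|S\triangle p(S)|$ for every $S\in\mathcal S$, in time $$O\Big(n\log u+\sum_{S,S'\in\mathcal S}\min(\ell,|S\triangle S'|)\Big),$$ where $\ell$ is the maximum edge weight in a minimum-weight symdiff graph on $\mathcal S$ (the bound holds with the $\ell$ of every minimum-weight symdiff graph). 3. Moreover, with an absolute constant $C$ and the same $\ell$, $$n\log u+\sum_{S,S'\in\mathcal S}\min(\ell,|S\triangle S'|)\;\le\; C\,\big(n\log u+\min(s^2\ell,\,sn)\big).$$ -/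

import Mathlib

/-! ### Symdiff graphs -/

namespace Symdiff

variable {α : Type*} [DecidableEq α]

/-- The set `𝒰` of all elements that occur in the sets of `𝒮`. -/
def ground (𝒮 : Finset (Finset α)) : Finset α := 𝒮.biUnion id

/-- The sum of the sizes of the sets of `𝒮`. -/
def totalSize (𝒮 : Finset (Finset α)) : ℕ := ∑ S ∈ 𝒮, S.card

/-- A symdiff graph on `𝒮`, given by the map `p` that sends each `S ∈ 𝒮` to the target of the only
edge that leaves `S` (the values of `p` outside `𝒮` are irrelevant). The nodes are the sets of
`𝒮 ∪ {∅, 𝒰}`, and from every `S ∈ 𝒮` there is a path (possibly of length zero) to `∅` or to `𝒰`. -/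
structure IsSymdiffGraph (𝒮 : Finset (Finset α)) (p : Finset α → Finset α) : Prop where
  target_mem : ∀ S ∈ 𝒮, p S ∈ 𝒮 ∪ {∅, ground 𝒮}
  reaches_root : ∀ S ∈ 𝒮, ∃ k : ℕ, p^[k] S = ∅ ∨ p^[k] S = ground 𝒮

/-- The weight of the edge that leaves `S`. -/
def edgeWeight (p : Finset α → Finset α) (S : Finset α) : ℕ := (symmDiff S (p S)).card

/-- The weight of a symdiff graph: the sum of the weights of its edges. -/
def weight (𝒮 : Finset (Finset α)) (p : Finset α → Finset α) : ℕ := ∑ S ∈ 𝒮, edgeWeight p S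

/-- The largest weight of an edge of a symdiff graph (zero if it has no edges). -/
def maxWeight (𝒮 : Finset (Finset α)) (p : Finset α → Finset α) : ℕ := 𝒮.sup (edgeWeight p)

/-- The symdiff compressibility `Δ(𝒮)`: the minimum weight of a symdiff graph on `𝒮`. -/
noncomputable def compressibility (𝒮 : Finset (Finset α)) : ℕ :=
  sInf {m | ∃ p, IsSymdiffGraph 𝒮 p ∧ weight 𝒮 p = m}

/-- `p` is a symdiff graph on `𝒮` of minimum weight. -/
def IsMinSymdiffGraph (𝒮 : Finset (Finset α)) (p : Finset α → Finset α) : Prop :=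
  IsSymdiffGraph 𝒮 p ∧ weight 𝒮 p = compressibility 𝒮

/-- The sum of `min (ℓ, |S △ S'|)` over all ordered pairs of sets in `𝒮`. -/
def cappedSum (𝒮 : Finset (Finset α)) (ℓ : ℕ) : ℕ :=
  ∑ S ∈ 𝒮, ∑ S' ∈ 𝒮, min ℓ (symmDiff S S').card

/-- The order-preserving renaming of the elements of `U` by the integers `1, …, |U|`. -/
def rankIn (U : Finset ℕ) (x : ℕ) : ℕ := (U.filter (· ≤ x)).card

end Symdiff

/-! ### The word RAM

Machine words are bit vectors of length `w`. A state has registers, each holding a word, and a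
memory with one word at each of the `2 ^ w` addresses. Programs are fixed finite texts that do not
depend on `w`; every elementary instruction and every evaluation of a test takes one time unit. -/

namespace WordRAM

structure State (w : ℕ) where
  reg : ℕ → BitVec w
  mem : BitVec w → BitVec w

inductive BinOp
  | add | sub | mul | div | mod | and | or | xor | shl | shr

/-- Unsigned arithmetic modulo `2 ^ w`, bitwise operations and logical shifts. -/
def BinOp.eval {w : ℕ} : BinOp → BitVec w → BitVec w → BitVec w
  | .add, a, b => a + b
  | .sub, a, b => a - b
  | .mul, a, b => a * b
  | .div, a, b => a / b
  | .mod, a, b => a % b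
  | .and, a, b => a &&& b
  | .or, a, b => a ||| b
  | .xor, a, b => a ^^^ b
  | .shl, a, b => a <<< b
  | .shr, a, b => a >>> b

/-- Comparisons of the contents of two registers, as unsigned integers. -/
inductive Test
  | eq (a b : ℕ)
  | lt (a b : ℕ)

def Test.Holds {w : ℕ} (σ : State w) : Test → Prop
  | .eq a b => σ.reg a = σ.reg b
  | .lt a b => (σ.reg a).toNat < (σ.reg b).toNat

inductive Program
  | skip
  /-- `R[d] := k` -/
  | const (d k : ℕ)
  /-- `R[d] := R[a] o R[b]` -/
  | op (o : BinOp) (d a b : ℕ)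
  /-- `R[d] := M[R[a]]` -/
  | load (d a : ℕ)
  /-- `M[R[a]] := R[b]` -/
  | store (a b : ℕ)
  | seq (P Q : Program)
  | ite (c : Test) (P Q : Program)
  | while (c : Test) (P : Program)

/-- `Exec P σ τ t`: started in the state `σ`, the program `P` halts in the state `τ` after `t` time
units. -/
inductive Exec {w : ℕ} : Program → State w → State w → ℕ → Prop
  | skip (σ : State w) : Exec .skip σ σ 1
  | const (σ : State w) (d k : ℕ) :
      Exec (.const d k) σ { σ with reg := Function.update σ.reg d (BitVec.ofNat w k) } 1
  | op (σ : State w) (o : BinOp) (d a b : ℕ) :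
      Exec (.op o d a b) σ
        { σ with reg := Function.update σ.reg d (o.eval (σ.reg a) (σ.reg b)) } 1
  | load (σ : State w) (d a : ℕ) :
      Exec (.load d a) σ { σ with reg := Function.update σ.reg d (σ.mem (σ.reg a)) } 1
  | store (σ : State w) (a b : ℕ) :
      Exec (.store a b) σ { σ with mem := Function.update σ.mem (σ.reg a) (σ.reg b) } 1
  | seq {P Q : Program} {σ τ υ : State w} {t t' : ℕ} :
      Exec P σ τ t → Exec Q τ υ t' → Exec (.seq P Q) σ υ (t + t')
  | ite_true {c : Test} {P Q : Program} {σ τ : State w} {t : ℕ} :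
      c.Holds σ → Exec P σ τ t → Exec (.ite c P Q) σ τ (t + 1)
  | ite_false {c : Test} {P Q : Program} {σ τ : State w} {t : ℕ} :
      ¬ c.Holds σ → Exec Q σ τ t → Exec (.ite c P Q) σ τ (t + 1)
  | while_true {c : Test} {P : Program} {σ τ υ : State w} {t t' : ℕ} :
      c.Holds σ → Exec P σ τ t → Exec (.while c P) τ υ t' → Exec (.while c P) σ υ (t + t' + 1)
  | while_false {c : Test} {P : Program} {σ : State w} :
      ¬ c.Holds σ → Exec (.while c P) σ σ 1

/-- The input is stored from address `0` on; all other words and all registers are zero. -/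
def initState (w : ℕ) (input : List ℕ) : State w where
  reg := fun _ => 0
  mem := fun a => BitVec.ofNat w (input.getD a.toNat 0)

/-- On words of `w` bits and the given input, `P` halts after `t` time units; the output is then in
the memory, from the address in register `0` on. -/
def Program.Computes (P : Program) (w : ℕ) (input output : List ℕ) (t : ℕ) : Prop :=
  ∃ σ : State w, Exec P (initState w input) σ t ∧
    (σ.reg 0).toNat + output.length ≤ 2 ^ w ∧
    ∀ (i : ℕ) (h : i < output.length),
      (σ.mem (σ.reg 0 + BitVec.ofNat w i)).toNat = output[i]

end WordRAM

/-! ### Sets of sets and symdiff graphs as sequences of words -/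

namespace Symdiff

/-- The family `S₁, …, Sₛ`, each set being given by a list of its elements, as the sequence of words
`s, |S₁|, elements of S₁, …, |Sₛ|, elements of Sₛ`. -/
def encodeFamily (F : List (List ℕ)) : List ℕ :=
  F.length :: F.flatMap (fun l => l.length :: l)

/-- `F` lists the sets of the family `L`, in order, each by its elements in an arbitrary order and
without repetitions. -/
def Lists (F : List (List ℕ)) (L : List (Finset ℕ)) : Prop :=
  (∀ l ∈ F, l.Nodup) ∧ F.map List.toFinset = L

/-- The integer `j` denotes the node `A` of the symdiff graphs on the sets `L = [S₀, …, Sₛ₋₁]`: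
`j < s` denotes `Sⱼ`, `s` denotes `∅`, and `s + 1` denotes `𝒰`. -/
def DenotesNode (L : List (Finset ℕ)) (j : ℕ) (A : Finset ℕ) : Prop :=
  L[j]? = some A ∨ (j = L.length ∧ A = ∅) ∨ (j = L.length + 1 ∧ A = ground L.toFinset)

/-- The sequence of words `ws` describes the graph `p` on the sets of `L`: it lists, for each set `S`
of `L` in order, an integer that denotes the target `p S` and the weight of the edge. -/
def EncodesGraph (L : List (Finset ℕ)) (p : Finset ℕ → Finset ℕ) (ws : List ℕ) : Prop :=
  ∃ J : List ℕ, List.Forall₂ (fun S j => DenotesNode L j (p S)) L J ∧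
    ws = (List.zipWith (fun S j => [j, edgeWeight p S]) L J).flatten

/-- The standing assumption of the word RAM that the word length `w` is at least a constant multiple
of the logarithm of the input size: `w ≥ c · log₂ (n + s + 2)`. -/
def WordLengthOK (c w : ℕ) (𝒮 : Finset (Finset ℕ)) : Prop :=
  (totalSize 𝒮 + 𝒮.card + 2) ^ c ≤ 2 ^ w

end Symdiff

/-!
Let `w(S)` be the weight of the edge of `S`, and call `∅` and `𝒰` the roots.

**Prim orders.** Prim's algorithm starts with both roots and repeatedly attaches a set at least
distance from the nodes reached. Its graph has minimum weight: fix `k` and join nodes at distance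
at most `k`. If the edge by which `v` is attached is longer than `k`, then the nodes reached before
`v` form a union of components, and in an arbitrary symdiff graph the path from `v` to a root has
to leave the component of `v` by an edge longer than `k`. These components are different for
different `v`, so every symdiff graph has at least as many edges longer than `k`
(`IsPrimOrder.card_heavy_le`); summing over `k` compares the weights (`IsPrimOrder.weight_le`). For
the same reason the edges of a Prim order are at most as long as the longest edge of any symdiff
graph.

**Space.** Sorted so that targets precede sources, the edges of a minimum-weight graph become a
list of records, each of which toggles one element of an earlier set. There are at most `Δ(𝒮)`
records, and one pointer for each of the `s ≤ Δ(𝒮) + 2` sets; a program decides `x ∈ S` by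
following the records from `S` to a root and counting the toggles of `x` modulo two
(`space_bound`).

**Construction.** The elements are renamed by `1, …, u` by direct addressing into a half of the
memory, which is blank. Prim's algorithm then keeps, for each node reached, the row of its
distances to all sets. The row of a newly attached `S` is a copy of the row of its target, updated
in `s` steps for each of the `w(S)` elements of the symmetric difference (`newRow_spec`), so the
total time is `O(n + s² + s · Δ(𝒮))` (`prim_spec`). The point is that this is within the bound: a
set not yet reached is at least as far from each reached node as the edge by which the next node is
attached, and hence `s · Δ(𝒮) ≤ ∑ min(ℓ, |S △ S'|) + n` (`IsPrimOrder.card_mul_weight_le`);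
moreover `s ≤ Δ(𝒮) + 2`, `s ≤ n + 1`, and `n ≤ 2 n log u + 1`.

**Programs.** Statements about word RAM programs are derived in a small imperative language whose
states hold natural numbers, square arrays and a clock. Its predicate `wp` says that the compiled
program simulates the statement within the time on the clock; the rules `wp_asg`, `wp_sto`,
`wp_cond`, `wp_loop` and `wp_forTo` ask for bounds that exclude overflow and keep the addresses of
different cells apart.
-/

namespace Symdiff

variable {α : Type*} [DecidableEq α]

/-! ### Optimality and total length of Prim orders -/

/-- The two nodes at which the paths of a symdiff graph may end. -/
def roots (𝒮 : Finset (Finset α)) : Finset (Finset α) := {∅, ground 𝒮}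

lemma mem_roots {𝒮 : Finset (Finset α)} {A : Finset α} :
    A ∈ roots 𝒮 ↔ A = ∅ ∨ A = ground 𝒮 := by simp [roots]

lemma subset_ground {𝒮 : Finset (Finset α)} {S : Finset α} (hS : S ∈ 𝒮) : S ⊆ ground 𝒮 :=
  Finset.subset_biUnion_of_mem id hS

/-- A path of a symdiff graph that starts outside a set `X` of nodes containing both roots
enters `X` along some edge. -/
lemma IsSymdiffGraph.exists_crossing {𝒮 : Finset (Finset α)} {q : Finset α → Finset α}
    (hq : IsSymdiffGraph 𝒮 q) {X : Set (Finset α)} (hX : ∀ r ∈ roots 𝒮, r ∈ X)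
    {v : Finset α} (hv : v ∈ 𝒮) (hvX : v ∉ X) : ∃ a ∈ 𝒮, a ∉ X ∧ q a ∈ X := by
  obtain ⟨k, hk⟩ := hq.reaches_root v hv
  rw [← mem_roots] at hk
  induction k generalizing v with
  | zero => exact absurd (hX _ hk) hvX
  | succ k ih =>
    by_cases hqv : q v ∈ X
    · exact ⟨v, hv, hvX, hqv⟩
    · have hm : q v ∈ 𝒮 := by
        rcases Finset.mem_union.1 (hq.target_mem v hv) with h | h
        · exact h
        · exact absurd (hX _ h) hqv
      exact ih hm hqv hk

/-- An edge of weight zero is a loop, and the path from a node with a loop never leaves it. -/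
lemma IsSymdiffGraph.mem_roots_of_edgeWeight_eq_zero {𝒮 : Finset (Finset α)}
    {q : Finset α → Finset α} (hq : IsSymdiffGraph 𝒮 q) {S : Finset α} (hS : S ∈ 𝒮)
    (h0 : edgeWeight q S = 0) : S ∈ roots 𝒮 := by
  have hfix : q S = S := by
    rw [edgeWeight, Finset.card_eq_zero] at h0
    exact (symmDiff_eq_bot.1 h0).symm
  obtain ⟨k, hk⟩ := hq.reaches_root S hS
  rwa [Function.iterate_fixed hfix, ← mem_roots] at hk

/-- Only the roots may have edges of weight zero. -/
lemma IsSymdiffGraph.card_le {𝒮 : Finset (Finset α)} {q : Finset α → Finset α}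
    (hq : IsSymdiffGraph 𝒮 q) : 𝒮.card ≤ weight 𝒮 q + 2 := by
  have h1 : (𝒮 \ roots 𝒮).card ≤ weight 𝒮 q := by
    rw [Finset.card_eq_sum_ones]
    refine (Finset.sum_le_sum (g := edgeWeight q) fun S hS => ?_).trans
      (Finset.sum_le_sum_of_subset Finset.sdiff_subset)
    rw [Finset.mem_sdiff] at hS
    exact Nat.one_le_iff_ne_zero.2 fun h => hS.2 (hq.mem_roots_of_edgeWeight_eq_zero hS.1 h)
  have h2 : (roots 𝒮).card ≤ 2 := Finset.card_le_two
  have h3 := Finset.le_card_sdiff (roots 𝒮) 𝒮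
  omega

lemma isSymdiffGraph_const_empty (𝒮 : Finset (Finset α)) : IsSymdiffGraph 𝒮 fun _ => ∅ where
  target_mem _ _ := by simp
  reaches_root _ _ := ⟨1, Or.inl rfl⟩

lemma compressibility_le {𝒮 : Finset (Finset α)} {p : Finset α → Finset α}
    (hp : IsSymdiffGraph 𝒮 p) : compressibility 𝒮 ≤ weight 𝒮 p :=
  Nat.sInf_le ⟨p, hp, rfl⟩

lemma exists_isMinSymdiffGraph (𝒮 : Finset (Finset α)) : ∃ p, IsMinSymdiffGraph 𝒮 p := by
  have : {m | ∃ p, IsSymdiffGraph 𝒮 p ∧ weight 𝒮 p = m}.Nonempty :=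
    ⟨_, _, isSymdiffGraph_const_empty 𝒮, rfl⟩
  obtain ⟨p, hp, hw⟩ := Nat.sInf_mem this
  exact ⟨p, hp, hw⟩

lemma isMinSymdiffGraph_of_forall_le {𝒮 : Finset (Finset α)} {p : Finset α → Finset α}
    (hp : IsSymdiffGraph 𝒮 p) (h : ∀ q, IsSymdiffGraph 𝒮 q → weight 𝒮 p ≤ weight 𝒮 q) :
    IsMinSymdiffGraph 𝒮 p := by
  obtain ⟨q, hq, hw⟩ := exists_isMinSymdiffGraph 𝒮
  exact ⟨hp, le_antisymm (hw ▸ h q hq) (compressibility_le hp)⟩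

lemma compressibility_le_totalSize (𝒮 : Finset (Finset α)) :
    compressibility 𝒮 ≤ totalSize 𝒮 := by
  refine (compressibility_le (isSymdiffGraph_const_empty 𝒮)).trans
    (Finset.sum_le_sum fun S _ => ?_)
  simp [edgeWeight, symmDiff]

/-- `IsPrimOrder 𝒮 p T` says that the list `T`, read from its end, is the order in which Prim's
algorithm, started at the two roots, adds the sets of `T`, where `p v` is the node to which `v`
is attached. The last clause is the greedy choice: the edge from `v` is no longer than any edge
between a node reached before `v` and a node not yet reached. -/
def IsPrimOrder (𝒮 : Finset (Finset α)) (p : Finset α → Finset α) : List (Finset α) → Prop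
  | [] => True
  | v :: T => IsPrimOrder 𝒮 p T ∧ v ∈ 𝒮 ∧ v ∉ T ∧ (p v ∈ T ∨ p v ∈ roots 𝒮) ∧
      ∀ y ∈ 𝒮, y ∉ T → ∀ t, t ∈ T ∨ t ∈ roots 𝒮 → edgeWeight p v ≤ (symmDiff t y).card

namespace IsPrimOrder

variable {𝒮 : Finset (Finset α)} {p q : Finset α → Finset α} {T : List (Finset α)}

lemma mem_of_mem (hT : IsPrimOrder 𝒮 p T) {v : Finset α} (hv : v ∈ T) : v ∈ 𝒮 := by
  induction T with
  | nil => simp at hv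
  | cons a T ih =>
    rcases List.mem_cons.1 hv with rfl | h
    · exact hT.2.1
    · exact ih hT.1 h

lemma nodup (hT : IsPrimOrder 𝒮 p T) : T.Nodup := by
  induction T with
  | nil => simp
  | cons a T ih => exact List.nodup_cons.2 ⟨hT.2.2.1, ih hT.1⟩

lemma target_mem (hT : IsPrimOrder 𝒮 p T) {v : Finset α} (hv : v ∈ T) :
    p v ∈ T ∨ p v ∈ roots 𝒮 := by
  induction T with
  | nil => simp at hv
  | cons a T ih =>
    rcases List.mem_cons.1 hv with rfl | h
    · exact hT.2.2.2.1.imp_left (List.mem_cons_of_mem _)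
    · exact (ih hT.1 h).imp_left (List.mem_cons_of_mem _)

lemma reaches_root (hT : IsPrimOrder 𝒮 p T) {v : Finset α} (hv : v ∈ T) :
    ∃ k : ℕ, p^[k] v = ∅ ∨ p^[k] v = ground 𝒮 := by
  induction T generalizing v with
  | nil => simp at hv
  | cons a T ih =>
    rcases List.mem_cons.1 hv with rfl | h
    · rcases hT.2.2.2.1 with h | h
      · obtain ⟨k, hk⟩ := ih hT.1 h
        exact ⟨k + 1, hk⟩
      · exact ⟨1, mem_roots.1 h⟩
    · exact ih hT.1 h

lemma isSymdiffGraph (hT : IsPrimOrder 𝒮 p T) (hall : ∀ v ∈ 𝒮, v ∈ T) :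
    IsSymdiffGraph 𝒮 p where
  target_mem v hv := Finset.mem_union.2 ((hT.target_mem (hall v hv)).imp_left hT.mem_of_mem)
  reaches_root v hv := hT.reaches_root (hall v hv)

/-- The edges of a Prim order are no longer than the longest edge of any symdiff graph. -/
lemma edgeWeight_le_maxWeight (hT : IsPrimOrder 𝒮 p T) (hq : IsSymdiffGraph 𝒮 q)
    {v : Finset α} (hv : v ∈ T) : edgeWeight p v ≤ maxWeight 𝒮 q := by
  induction T with
  | nil => simp at hv
  | cons a T ih =>
    rcases List.mem_cons.1 hv with rfl | h
    · obtain ⟨-, hv, hvT, -, hmin⟩ := hT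
      by_cases hvr : v ∈ roots 𝒮
      · have := hmin v hv hvT v (Or.inr hvr)
        simp only [symmDiff_self] at this
        exact this.trans (by simp)
      · obtain ⟨b, hb, hbX, hqb⟩ := hq.exists_crossing (X := {t | t ∈ T ∨ t ∈ roots 𝒮})
          (fun r hr => Or.inr hr) hv (by simp [hvT, hvr])
        simp only [Set.mem_ofPred_eq, not_or] at hbX hqb
        have h1 := hmin b hb hbX.1 _ hqb
        rw [symmDiff_comm] at h1
        exact h1.trans (Finset.le_sup (f := edgeWeight q) hb)
    · exact ih hT.1 h

end IsPrimOrder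

/-- Two nodes are `k`-close if they are nodes at distance at most `k`. -/
def Close (𝒮 : Finset (Finset α)) (k : ℕ) (a b : Finset α) : Prop :=
  (a ∈ 𝒮 ∨ a ∈ roots 𝒮) ∧ (b ∈ 𝒮 ∨ b ∈ roots 𝒮) ∧ (symmDiff a b).card ≤ k

lemma Close.symm {𝒮 : Finset (Finset α)} {k : ℕ} {a b : Finset α} (h : Close 𝒮 k a b) :
    Close 𝒮 k b a := ⟨h.2.1, h.1, by rw [symmDiff_comm]; exact h.2.2⟩

/-- A family of nodes that is a union of components of the graph of `k`-close nodes and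
contains the roots: the path of a symdiff graph from an outer node has an edge longer than `k`
that leaves the component of that node. -/
lemma IsSymdiffGraph.exists_heavy {𝒮 : Finset (Finset α)} {q : Finset α → Finset α}
    (hq : IsSymdiffGraph 𝒮 q) {k : ℕ} {X : Set (Finset α)} (hX : ∀ r ∈ roots 𝒮, r ∈ X)
    (hcl : ∀ a b, Close 𝒮 k a b → a ∈ X → b ∈ X) {v : Finset α} (hv : v ∈ 𝒮) (hvX : v ∉ X) :
    ∃ z ∈ 𝒮, k < edgeWeight q z ∧ Relation.ReflTransGen (Close 𝒮 k) v z := by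
  obtain ⟨n, hn⟩ := hq.reaches_root v hv
  rw [← mem_roots] at hn
  induction n generalizing v with
  | zero => exact absurd (hX _ hn) hvX
  | succ n ih =>
    by_cases hw : k < edgeWeight q v
    · exact ⟨v, hv, hw, Relation.ReflTransGen.refl⟩
    · have hm := Finset.mem_union.1 (hq.target_mem v hv)
      have hc : Close 𝒮 k v (q v) := ⟨Or.inl hv, hm, not_lt.1 hw⟩
      have hqX : q v ∉ X := fun h => hvX (hcl _ _ hc.symm h)
      have hqS : q v ∈ 𝒮 := hm.resolve_right fun h => hqX (hX _ h)
      obtain ⟨z, hz, hzw, hvz⟩ := ih hqS hqX hn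
      exact ⟨z, hz, hzw, Relation.ReflTransGen.head hc hvz⟩

lemma reflTransGen_mem {β : Type*} {r : β → β → Prop} {X : Set β}
    (hcl : ∀ a b, r a b → a ∈ X → b ∈ X) {a b : β} (h : Relation.ReflTransGen r a b)
    (ha : a ∈ X) : b ∈ X := by
  induction h with
  | refl => exact ha
  | tail _ hbc ih => exact hcl _ _ hbc ih

namespace IsPrimOrder

variable {𝒮 : Finset (Finset α)} {p q : Finset α → Finset α} {T : List (Finset α)}

/-- If the edge of `v` is longer than `k`, the nodes reached before `v` form a union of components
of the graph of `k`-close nodes. -/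
lemma closed_of_lt {v : Finset α} (hT : IsPrimOrder 𝒮 p (v :: T)) {k : ℕ}
    (hk : k < edgeWeight p v) (a b : Finset α) (hab : Close 𝒮 k a b)
    (ha : a ∈ T ∨ a ∈ roots 𝒮) : b ∈ T ∨ b ∈ roots 𝒮 := by
  by_contra hb
  push Not at hb
  have hbS : b ∈ 𝒮 := hab.2.1.resolve_right hb.2
  have := hT.2.2.2.2 b hbS hb.1 a ha
  have := hab.2.2
  omega

lemma not_mem_of_lt {v : Finset α} (hT : IsPrimOrder 𝒮 p (v :: T)) {k : ℕ}
    (hk : k < edgeWeight p v) : ¬ (v ∈ T ∨ v ∈ roots 𝒮) := by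
  rintro (h | h)
  · exact hT.2.2.1 h
  · have := hT.2.2.2.2 v hT.2.1 hT.2.2.1 v (Or.inr h)
    simp at this
    omega

/-- The key to optimality: the heavy edges of a Prim order are matched injectively with heavy edges
of an arbitrary symdiff graph, since they lead to different components of the graph of `k`-close
nodes. -/
lemma exists_matching (hT : IsPrimOrder 𝒮 p T) (hq : IsSymdiffGraph 𝒮 q) (k : ℕ) :
    ∃ φ : Finset α → Finset α, ∀ v ∈ T, k < edgeWeight p v →
      φ v ∈ 𝒮 ∧ k < edgeWeight q (φ v) ∧ Relation.ReflTransGen (Close 𝒮 k) v (φ v) := by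
  have : ∀ v, ∃ z, v ∈ T → k < edgeWeight p v →
      z ∈ 𝒮 ∧ k < edgeWeight q z ∧ Relation.ReflTransGen (Close 𝒮 k) v z := by
    intro v
    by_cases hv : v ∈ T
    swap
    · exact ⟨v, fun h => absurd h hv⟩
    by_cases hk : k < edgeWeight p v
    swap
    · exact ⟨v, fun _ h => absurd h hk⟩
    obtain ⟨z, h⟩ : ∃ z, z ∈ 𝒮 ∧ k < edgeWeight q z ∧
        Relation.ReflTransGen (Close 𝒮 k) v z := by
      induction T with
      | nil => simp at hv
      | cons a T ih =>
        rcases List.mem_cons.1 hv with rfl | h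
        · exact hq.exists_heavy (X := {t | t ∈ T ∨ t ∈ roots 𝒮}) (fun r hr => Or.inr hr)
            (hT.closed_of_lt hk) hT.2.1 (hT.not_mem_of_lt hk)
        · exact ih hT.1 h
    exact ⟨z, fun _ _ => h⟩
  choose φ hφ using this
  exact ⟨φ, hφ⟩

/-- The path from `v` to its match stays outside the union of components reached before `v`, while
the paths from earlier sets stay inside. -/
lemma not_reflTransGen {v : Finset α} (hT : IsPrimOrder 𝒮 p (v :: T)) {k : ℕ}
    (hk : k < edgeWeight p v) {a z : Finset α} (ha : a ∈ T)
    (haz : Relation.ReflTransGen (Close 𝒮 k) a z)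
    (hvz : Relation.ReflTransGen (Close 𝒮 k) v z) : False := by
  have h1 := reflTransGen_mem (X := {t | t ∈ T ∨ t ∈ roots 𝒮}) (hT.closed_of_lt hk) haz
    (Or.inl ha)
  have h2 := reflTransGen_mem (X := {t | t ∈ T ∨ t ∈ roots 𝒮}ᶜ)
    (fun a b hab ha hb => ha (hT.closed_of_lt hk b a hab.symm hb)) hvz (hT.not_mem_of_lt hk)
  exact h2 h1

/-- For each `k`, a Prim order has at most as many edges longer than `k` as any symdiff graph. -/
lemma card_heavy_le (hT : IsPrimOrder 𝒮 p T) (hq : IsSymdiffGraph 𝒮 q) (k : ℕ) :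
    (T.toFinset.filter (k < edgeWeight p ·)).card ≤ (𝒮.filter (k < edgeWeight q ·)).card := by
  obtain ⟨φ, hφ⟩ := hT.exists_matching hq k
  refine Finset.card_le_card_of_injOn φ (fun v hv => ?_) ?_
  · simp only [Finset.coe_filter, List.mem_toFinset, Set.mem_ofPred_eq] at hv ⊢
    exact ⟨(hφ v hv.1 hv.2).1, (hφ v hv.1 hv.2).2.1⟩
  · have key : ∀ v ∈ T, k < edgeWeight p v → ∀ v' ∈ T, k < edgeWeight p v' →
        φ v = φ v' → v = v' := by
      induction T with
      | nil => simp
      | cons a T ih =>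
        intro v hv hk v' hv' hk' he
        have hz := hφ v hv hk
        have hz' := hφ v' hv' hk'
        rw [he] at hz
        rcases List.mem_cons.1 hv with rfl | h <;> rcases List.mem_cons.1 hv' with rfl | h'
        · rfl
        · exact (hT.not_reflTransGen hk h' hz'.2.2 hz.2.2).elim
        · exact (hT.not_reflTransGen hk' h hz.2.2 hz'.2.2).elim
        · exact ih hT.1 (fun u hu => hφ u (List.mem_cons_of_mem _ hu)) v h hk v' h' hk' he
    intro v hv v' hv' he
    simp only [Finset.coe_filter, List.mem_toFinset, Set.mem_ofPred_eq] at hv hv'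
    exact key v hv.1 hv.2 v' hv'.1 hv'.2 he

end IsPrimOrder

/-- The layer-cake formula, which reduces the comparison of total weights to that of the numbers of
edges longer than `k`. -/
lemma sum_eq_sum_card_lt {β : Type*} (A : Finset β) (f : β → ℕ) {N : ℕ}
    (hN : ∀ a ∈ A, f a ≤ N) :
    ∑ a ∈ A, f a = ∑ k ∈ Finset.range N, (A.filter (k < f ·)).card := by
  simp_rw [Finset.card_filter]
  rw [Finset.sum_comm]
  refine Finset.sum_congr rfl fun a ha => ?_
  rw [← Finset.card_filter]
  have : (Finset.range N).filter (· < f a) = Finset.range (f a) := by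
    ext k
    have := hN a ha
    simp only [Finset.mem_filter, Finset.mem_range]
    omega
  rw [this, Finset.card_range]

namespace IsPrimOrder

variable {𝒮 : Finset (Finset α)} {p q : Finset α → Finset α} {T : List (Finset α)}

lemma weight_le (hT : IsPrimOrder 𝒮 p T) (hall : ∀ v ∈ 𝒮, v ∈ T) (hq : IsSymdiffGraph 𝒮 q) :
    weight 𝒮 p ≤ weight 𝒮 q := by
  have hTS : T.toFinset = 𝒮 := by
    ext v
    exact ⟨fun h => hT.mem_of_mem (List.mem_toFinset.1 h), fun h => List.mem_toFinset.2 (hall v h)⟩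
  set N := max (maxWeight 𝒮 p) (maxWeight 𝒮 q)
  rw [weight, weight, sum_eq_sum_card_lt 𝒮 (edgeWeight p) (N := N)
      fun a ha => (Finset.le_sup (f := edgeWeight p) ha).trans (le_max_left _ _),
    sum_eq_sum_card_lt 𝒮 (edgeWeight q) (N := N)
      fun a ha => (Finset.le_sup (f := edgeWeight q) ha).trans (le_max_right _ _)]
  refine Finset.sum_le_sum fun k _ => ?_
  have := hT.card_heavy_le hq k
  rwa [hTS] at this

lemma isMinSymdiffGraph (hT : IsPrimOrder 𝒮 p T) (hall : ∀ v ∈ 𝒮, v ∈ T) :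
    IsMinSymdiffGraph 𝒮 p :=
  isMinSymdiffGraph_of_forall_le (hT.isSymdiffGraph hall) fun _ hq => hT.weight_le hall hq

/-- A set `y` not yet reached is at least as far from each node of the order as the edge by which
the next node is attached. Summed up, its distances bound the weight of the order; the distance
to the root `∅` accounts for the first node. -/
lemma sum_weight_add_le (hT : IsPrimOrder 𝒮 p T) {ℓ : ℕ} (hℓ : ∀ v ∈ T, edgeWeight p v ≤ ℓ)
    {y : Finset α} (hy : y ∈ 𝒮) (hyT : y ∉ T) {z : ℕ}
    (hz : ∀ t ∈ T, z ≤ min ℓ (symmDiff t y).card) (hzy : z ≤ y.card) :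
    (T.map (edgeWeight p)).sum + z ≤ (T.map fun t => min ℓ (symmDiff t y).card).sum + y.card := by
  induction T generalizing z with
  | nil => simpa using hzy
  | cons a T ih =>
    obtain ⟨hT, ha, haT, hpa, hmin⟩ := hT
    have hyT' : y ∉ T := fun h => hyT (List.mem_cons_of_mem _ h)
    have h1 := hz a List.mem_cons_self
    have h2 := ih hT (fun v hv => hℓ v (List.mem_cons_of_mem _ hv)) hyT' (z := edgeWeight p a)
      (fun t ht => le_min (hℓ a List.mem_cons_self) (hmin y hy hyT' t (Or.inl ht)))
      (by
        have := hmin y hy hyT' ∅ (Or.inr (by simp [roots]))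
        rwa [← Finset.bot_eq_empty, bot_symmDiff] at this)
    simp only [List.map_cons, List.sum_cons]
    omega

/-- A new first node `a` adds `|T| · w(a) + w(a) + ∑ w` on the left. Its capped distances to the
nodes of `T` occur twice on the right: one copy pays for `|T| · w(a)`, the other, together with
`|a|`, for the remaining terms by `sum_weight_add_le`. -/
lemma length_mul_sum_le (hT : IsPrimOrder 𝒮 p T) {ℓ : ℕ} (hℓ : ∀ v ∈ T, edgeWeight p v ≤ ℓ) :
    T.length * (T.map (edgeWeight p)).sum ≤
      (T.map fun t => (T.map fun t' => min ℓ (symmDiff t t').card).sum).sum +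
        (T.map Finset.card).sum := by
  induction T with
  | nil => simp
  | cons a T ih =>
    have ih' := ih hT.1 fun v hv => hℓ v (List.mem_cons_of_mem _ hv)
    obtain ⟨hT, ha, haT, hpa, hmin⟩ := hT
    have hz : ∀ t ∈ T, edgeWeight p a ≤ min ℓ (symmDiff t a).card := fun t ht =>
      le_min (hℓ a List.mem_cons_self) (hmin a ha haT t (Or.inl ht))
    have h1 := hT.sum_weight_add_le (fun v hv => hℓ v (List.mem_cons_of_mem _ hv)) ha haT hz
      (by
        have := hmin a ha haT ∅ (Or.inr (by simp [roots]))
        rwa [← Finset.bot_eq_empty, bot_symmDiff] at this)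
    have h2 : T.length * edgeWeight p a ≤ (T.map fun t => min ℓ (symmDiff t a).card).sum := by
      have := List.card_nsmul_le_sum (T.map fun t => min ℓ (symmDiff t a).card) (edgeWeight p a)
        (by simpa using fun t ht => hz t ht)
      simpa using this
    simp only [List.map_cons, List.sum_cons, List.length_cons, symmDiff_self,
      List.sum_map_add]
    have h3 : (T.map fun t => min ℓ (symmDiff a t).card) =
        T.map fun t => min ℓ (symmDiff t a).card := by
      simp_rw [symmDiff_comm a]
    rw [h3]
    have h4 : (T.length + 1) * (edgeWeight p a + (T.map (edgeWeight p)).sum) =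
      T.length * (T.map (edgeWeight p)).sum + T.length * edgeWeight p a +
        ((T.map (edgeWeight p)).sum + edgeWeight p a) := by ring
    rw [h4]
    omega

/-- The time of Prim's algorithm with distance rows is proportional to `s · Δ(𝒮)`, which the
distances between the sets pay for. -/
lemma card_mul_weight_le (hT : IsPrimOrder 𝒮 p T) (hall : ∀ v ∈ 𝒮, v ∈ T)
    (hq : IsSymdiffGraph 𝒮 q) :
    𝒮.card * weight 𝒮 p ≤ cappedSum 𝒮 (maxWeight 𝒮 q) + totalSize 𝒮 := by
  have hTS : T.toFinset = 𝒮 := by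
    ext v
    exact ⟨fun h => hT.mem_of_mem (List.mem_toFinset.1 h), fun h => List.mem_toFinset.2 (hall v h)⟩
  have hnd := hT.nodup
  have h := hT.length_mul_sum_le fun v hv => hT.edgeWeight_le_maxWeight hq hv
  simp only [← List.sum_toFinset _ hnd, hTS] at h
  rwa [← List.toFinset_card_of_nodup hnd, hTS] at h

end IsPrimOrder

/-! ### Bounds in terms of the total size -/

lemma card_symmDiff_le (S T : Finset α) : (symmDiff S T).card ≤ S.card + T.card :=
  (Finset.card_le_card symmDiff_le_sup).trans (Finset.card_union_le _ _)

lemma cappedSum_le (𝒮 : Finset (Finset α)) (ℓ : ℕ) :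
    cappedSum 𝒮 ℓ ≤ 2 * min (𝒮.card ^ 2 * ℓ) (𝒮.card * totalSize 𝒮) := by
  have h1 : cappedSum 𝒮 ℓ ≤ 𝒮.card ^ 2 * ℓ := by
    refine (Finset.sum_le_sum fun S _ => Finset.sum_le_sum
      (g := fun _ => ℓ) fun S' _ => min_le_left _ _).trans (le_of_eq ?_)
    simp [pow_two, mul_assoc]
  have h2 : cappedSum 𝒮 ℓ ≤ 2 * (𝒮.card * totalSize 𝒮) := by
    refine (Finset.sum_le_sum fun S _ => Finset.sum_le_sum (g := fun S' => S.card + S'.card)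
      fun S' _ => (min_le_right _ _).trans (card_symmDiff_le S S')).trans (le_of_eq ?_)
    simp only [Finset.sum_add_distrib, Finset.sum_const, smul_eq_mul, totalSize,
      ← Finset.mul_sum]
    ring
  omega

lemma card_le_totalSize_add_one (𝒮 : Finset (Finset α)) : 𝒮.card ≤ totalSize 𝒮 + 1 := by
  have h1 : (𝒮.erase ∅).card ≤ totalSize 𝒮 := by
    rw [Finset.card_eq_sum_ones]
    refine (Finset.sum_le_sum (g := Finset.card) fun S hS => ?_).trans
      (Finset.sum_le_sum_of_subset (Finset.erase_subset _ _))
    exact Finset.card_pos.2 (Finset.nonempty_iff_ne_empty.2 (Finset.ne_of_mem_erase hS))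
  have := Finset.pred_card_le_card_erase (s := 𝒮) (a := ∅)
  omega

lemma card_ground_le (𝒮 : Finset (Finset α)) : (ground 𝒮).card ≤ totalSize 𝒮 :=
  Finset.card_biUnion_le

/-- `n` is bounded by `n log u` up to a constant, unless `u ≤ 1`, when `n ≤ 1`. -/
lemma totalSize_le_log (𝒮 : Finset (Finset α)) :
    (totalSize 𝒮 : ℝ) ≤ 2 * (totalSize 𝒮 * Real.log (ground 𝒮).card) + 1 := by
  by_cases hu : 2 ≤ (ground 𝒮).card
  · have h1 : Real.log 2 ≤ Real.log (ground 𝒮).card :=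
      Real.log_le_log (by norm_num) (by exact_mod_cast hu)
    have h2 := Real.log_two_gt_d9
    have h3 : (0 : ℝ) ≤ totalSize 𝒮 := by positivity
    nlinarith
  · have hn : totalSize 𝒮 ≤ 1 := by
      have hsub : 𝒮 ⊆ (ground 𝒮).powerset := fun S hS =>
        Finset.mem_powerset.2 (subset_ground hS)
      have h1 : totalSize 𝒮 ≤ ∑ S ∈ (ground 𝒮).powerset, S.card :=
        Finset.sum_le_sum_of_subset hsub
      have h2 : (ground 𝒮).card = 0 ∨ (ground 𝒮).card = 1 := by omega
      rcases h2 with h2 | h2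
      · rw [Finset.card_eq_zero] at h2
        rw [h2] at h1
        simp at h1
        omega
      · obtain ⟨a, ha⟩ := Finset.card_eq_one.1 h2
        rw [ha, Finset.sum_powerset_apply_card (fun k => k)] at h1
        simpa [Finset.sum_range_succ] using h1
    have h3 : (0 : ℝ) ≤ totalSize 𝒮 * Real.log (ground 𝒮).card :=
      mul_nonneg (by positivity) (Real.log_natCast_nonneg _)
    have h4 : (totalSize 𝒮 : ℝ) ≤ 1 := by exact_mod_cast hn
    linarith

end Symdiff

namespace WordRAM

/-! ### A small imperative language on top of the word RAM -/

/-- How the memory of a machine with words of `w` bits is divided up: a *raw* region of the first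
`L` words, eight interleaved square arrays of side `K` behind it, and a *high* array that starts at
the last address and grows downwards through the upper half of the memory. -/
structure Layout where
  w : ℕ
  L : ℕ
  K : ℕ
  w_pos : 1 ≤ w
  fits : L + 8 * (K * K) ≤ 2 ^ (w - 1)

/-- The state of the machine as seen by a program: natural numbers in registers and in the parts of
the memory. Part `k < 8` is an array, part `8` is the raw region and part `9` the high array; the
last two use the second index `0` only. The clock counts the time units spent. -/
structure St where
  reg : ℕ → ℕ
  mem : ℕ → ℕ → ℕ → ℕ
  clk : ℕ

namespace St

/-- Register `x` becomes `v`; this costs no time by itself. -/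
def setReg (A : St) (x v : ℕ) : St := { A with reg := Function.update A.reg x v }

/-- The cell `(a, b)` of part `k` of the memory becomes `v`. -/
def setMem (A : St) (k a b v : ℕ) : St :=
  ⟨A.reg, Function.update A.mem k
    (Function.update (A.mem k) a (Function.update (A.mem k a) b v)), A.clk⟩

/-- The clock advances by `n`. -/
def tick (A : St) (n : ℕ) : St := { A with clk := A.clk + n }

variable (A : St) (x v k a b n : ℕ)

@[simp] lemma setReg_reg : (A.setReg x v).reg = Function.update A.reg x v := rfl
@[simp] lemma setReg_mem : (A.setReg x v).mem = A.mem := rfl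
@[simp] lemma setReg_clk : (A.setReg x v).clk = A.clk := rfl
@[simp] lemma setMem_reg : (A.setMem k a b v).reg = A.reg := rfl
@[simp] lemma setMem_mem : (A.setMem k a b v).mem = Function.update A.mem k
      (Function.update (A.mem k) a (Function.update (A.mem k a) b v)) := rfl
@[simp] lemma setMem_clk : (A.setMem k a b v).clk = A.clk := rfl
@[simp] lemma tick_reg : (A.tick n).reg = A.reg := rfl
@[simp] lemma tick_mem : (A.tick n).mem = A.mem := rfl
@[simp] lemma tick_clk : (A.tick n).clk = A.clk + n := rfl

end St

namespace Layout

variable (c : Layout)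

/-- The cells of the parts of the memory. -/
def Valid (k a b : ℕ) : Prop :=
  (k < 8 ∧ a < c.K ∧ b < c.K) ∨ (k = 8 ∧ a < c.L ∧ b = 0) ∨ (k = 9 ∧ a < 2 ^ (c.w - 1) ∧ b = 0)

/-- The address of a cell. -/
def addr (k a b : ℕ) : ℕ :=
  if k < 8 then c.L + ((a * c.K + b) * 8 + k) else if k = 8 then a else 2 ^ c.w - 1 - a

lemma two_pow : 2 ^ c.w = 2 * 2 ^ (c.w - 1) := by
  rw [← pow_succ', Nat.sub_add_cancel c.w_pos]

lemma mul_add_lt {a b : ℕ} (ha : a < c.K) (hb : b < c.K) : a * c.K + b < c.K * c.K := by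
  have := Nat.mul_le_mul_right c.K (Nat.succ_le_of_lt ha)
  rw [Nat.succ_mul] at this
  omega

lemma addr_lt {k a b : ℕ} (h : c.Valid k a b) : c.addr k a b < 2 ^ c.w := by
  have h1 := c.fits
  have h2 := c.two_pow
  rcases h with ⟨hk, ha, hb⟩ | ⟨rfl, ha, rfl⟩ | ⟨rfl, ha, rfl⟩
  · have := c.mul_add_lt ha hb
    simp only [addr, hk, if_true]
    omega
  · simp only [addr]
    norm_num
    omega
  · simp only [addr]
    norm_num
    omega

lemma addr_inj {k a b k' a' b' : ℕ} (h : c.Valid k a b) (h' : c.Valid k' a' b')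
    (he : c.addr k a b = c.addr k' a' b') : k = k' ∧ a = a' ∧ b = b' := by
  have h1 := c.fits
  have h2 := c.two_pow
  rcases h with ⟨hk, ha, hb⟩ | ⟨rfl, ha, rfl⟩ | ⟨rfl, ha, rfl⟩ <;>
  rcases h' with ⟨hk', ha', hb'⟩ | ⟨rfl, ha', rfl⟩ | ⟨rfl, ha', rfl⟩
  · simp only [addr, hk, hk', if_true] at he
    have h3 : a * c.K + b = a' * c.K + b' := by omega
    have h4 : a = a' := by
      have e1 : (a * c.K + b) / c.K = a := by
        rw [mul_comm, Nat.mul_add_div (by omega), Nat.div_eq_of_lt hb, add_zero]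
      have e2 : (a' * c.K + b') / c.K = a' := by
        rw [mul_comm, Nat.mul_add_div (by omega), Nat.div_eq_of_lt hb', add_zero]
      rw [← e1, h3, e2]
    subst h4
    omega
  all_goals
    simp only [addr, *] at he
    norm_num at he
    try have := c.mul_add_lt ha hb
    try have := c.mul_add_lt ha' hb'
    omega

end Layout

/-- The machine state `σ` represents `A`. The registers from `30` on belong to the compiler: three
hold the parameters of the layout, those from `40` on are temporary. -/
structure Rel (c : Layout) (σ : State c.w) (A : St) : Prop where
  reg : ∀ r < 30, (σ.reg r).toNat = A.reg r
  reg_L : σ.reg 30 = BitVec.ofNat c.w c.L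
  reg_K : σ.reg 31 = BitVec.ofNat c.w c.K
  reg_last : σ.reg 32 = BitVec.ofNat c.w (2 ^ c.w - 1)
  mem : ∀ k a b, c.Valid k a b → (σ.mem (BitVec.ofNat c.w (c.addr k a b))).toNat = A.mem k a b

lemma Rel.of_eq {c : Layout} {σ τ : State c.w} {A : St} (h : Rel c σ A)
    (hr : ∀ r < 40, τ.reg r = σ.reg r) (hm : τ.mem = σ.mem) : Rel c τ A where
  reg r hr' := by rw [hr r (by omega), h.reg r hr']
  reg_L := by rw [hr 30 (by omega), h.reg_L]
  reg_K := by rw [hr 31 (by omega), h.reg_K]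
  reg_last := by rw [hr 32 (by omega), h.reg_last]
  mem k a b hv := by rw [hm, h.mem k a b hv]

lemma eq_ofNat {w n : ℕ} {x : BitVec w} (h : x.toNat = n) : x = BitVec.ofNat w n := by
  subst h; simp

/-- The operations on natural numbers. -/
def BinOp.nat : BinOp → ℕ → ℕ → ℕ
  | .add, a, b => a + b
  | .sub, a, b => a - b
  | .mul, a, b => a * b
  | .div, a, b => a / b
  | .mod, a, b => a % b
  | _, _, _ => 0

/-- The machine operation on words of `w` bits agrees with the one on natural numbers. -/
def BinOp.Safe (w : ℕ) : BinOp → ℕ → ℕ → Prop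
  | .add, a, b => a + b < 2 ^ w
  | .sub, a, b => b ≤ a
  | .mul, a, b => a * b < 2 ^ w
  | .div, _, _ => True
  | .mod, _, _ => True
  | _, _, _ => False

lemma BinOp.toNat_eval {w : ℕ} (o : BinOp) (a b : BitVec w) (h : o.Safe w a.toNat b.toNat) :
    (o.eval a b).toNat = o.nat a.toNat b.toNat := by
  cases o <;> simp only [BinOp.Safe, BinOp.eval, BinOp.nat] at h ⊢
  · rw [BitVec.toNat_add, Nat.mod_eq_of_lt h]
  · rw [BitVec.toNat_sub_of_le (BitVec.le_def.2 h)]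
  · rw [BitVec.toNat_mul, Nat.mod_eq_of_lt h]
  · simp
  · simp

/-- Expressions; `ld k a b` reads the cell `(a, b)` of part `k` of the memory. -/
inductive Ex
  | var (r : ℕ)
  | lit (k : ℕ)
  | bin (o : BinOp) (a b : Ex)
  | ld (k : ℕ) (a b : Ex)

namespace Ex

/-- The value of an expression in a state. -/
def ev (A : St) : Ex → ℕ
  | var r => A.reg r
  | lit k => k
  | bin o a b => o.nat (a.ev A) (b.ev A)
  | ld k a b => A.mem k (a.ev A) (b.ev A)

/-- The evaluation stays within the memory parts and without overflow. -/
def Safe (c : Layout) (A : St) : Ex → Prop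
  | var r => r < 30
  | lit k => k < 2 ^ c.w
  | bin o a b => a.Safe c A ∧ b.Safe c A ∧ o.Safe c.w (a.ev A) (b.ev A)
  | ld k a b => a.Safe c A ∧ b.Safe c A ∧ c.Valid k (a.ev A) (b.ev A)

/-- From the indices of a cell in the registers `d` and `d + 1` to its address in register `d`. -/
def addrOps (k d : ℕ) : Program :=
  if k < 8 then
    .seq (.op .mul d d 31) <| .seq (.op .add d d (d + 1)) <| .seq (.const (d + 1) 8) <|
    .seq (.op .mul d d (d + 1)) <| .seq (.const (d + 1) k) <| .seq (.op .add d d (d + 1)) <|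
    .op .add d d 30
  else if k = 8 then .skip else .op .sub d 32 d

/-- Evaluation into register `d`, with the registers above `d` as temporary storage. -/
def comp : Ex → ℕ → Program
  | var r, d => .op .or d r r
  | lit k, d => .const d k
  | bin o a b, d => .seq (a.comp d) (.seq (b.comp (d + 1)) (.op o d d (d + 1)))
  | ld k a b, d => .seq (a.comp d) (.seq (b.comp (d + 1)) (.seq (addrOps k d) (.load d d)))

/-- The time in which an expression is evaluated. -/
def cost : Ex → ℕ
  | var _ => 1
  | lit _ => 1
  | bin _ a b => a.cost + b.cost + 1
  | ld _ a b => a.cost + b.cost + 8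

end Ex

/-- `P` puts the number `v` into register `d` within `T` time units, and changes neither a lower
register nor the memory. -/
def Evals {w : ℕ} (P : Program) (d : ℕ) (σ : State w) (v T : ℕ) : Prop :=
  ∃ (τ : State w) (t : ℕ), Exec P σ τ t ∧ t ≤ T ∧ (τ.reg d).toNat = v ∧
    (∀ r < d, τ.reg r = σ.reg r) ∧ τ.mem = σ.mem

lemma addrOps_spec {c : Layout} {σ : State c.w} {A : St} (h : Rel c σ A) {k a b d : ℕ}
    (hd : 40 ≤ d) (hv : c.Valid k a b) (ha : (σ.reg d).toNat = a)
    (hb : (σ.reg (d + 1)).toNat = b) : Evals (Ex.addrOps k d) d σ (c.addr k a b) 7 := by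
  have ha' := eq_ofNat ha
  have hb' := eq_ofNat hb
  have hlt := c.addr_lt hv
  by_cases hk : k < 8
  · simp only [Ex.addrOps, hk, if_true]
    refine ⟨_, _, Exec.seq (Exec.op _ _ _ _ _) (Exec.seq (Exec.op _ _ _ _ _)
      (Exec.seq (Exec.const _ _ _) (Exec.seq (Exec.op _ _ _ _ _) (Exec.seq (Exec.const _ _ _)
      (Exec.seq (Exec.op _ _ _ _ _) (Exec.op _ _ _ _ _)))))), by norm_num, ?_, ?_, rfl⟩
    · have e1 : (30 : ℕ) ≠ d := by omega
      have e2 : (31 : ℕ) ≠ d := by omega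
      have e3 : (30 : ℕ) ≠ d + 1 := by omega
      have : ∀ x : BitVec c.w, x = BitVec.ofNat c.w (c.addr k a b) → x.toNat = c.addr k a b := by
        rintro x rfl
        rw [BitVec.toNat_ofNat, Nat.mod_eq_of_lt hlt]
      apply this
      simp [Function.update, e1, e3, BinOp.eval, h.reg_L, h.reg_K, ha', hb', Layout.addr,
        hk, BitVec.ofNat_add, BitVec.ofNat_mul]
      ring
    · intro r hr
      have e1 : r ≠ d := by omega
      have e2 : r ≠ d + 1 := by omega
      simp [Function.update, e1, e2]
  · rcases hv with hv | ⟨rfl, hv⟩ | ⟨rfl, hv, -⟩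
    · omega
    · exact ⟨_, _, Exec.skip _, by norm_num, by simpa [Layout.addr] using ha, fun _ _ => rfl, rfl⟩
    · refine ⟨_, _, Exec.op _ _ _ _ _, by norm_num, ?_, ?_, rfl⟩
      · simp only [Function.update_self, Layout.addr]
        have h2 : (σ.reg 32).toNat = 2 ^ c.w - 1 := by
          rw [h.reg_last, BitVec.toNat_ofNat, Nat.mod_eq_of_lt]
          have := Nat.two_pow_pos c.w
          omega
        rw [BinOp.toNat_eval, h2, ha]
        · simp [BinOp.nat]
        · simp only [BinOp.Safe, h2, ha]
          have := c.two_pow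
          omega
      · intro r hr
        have e1 : r ≠ d := by omega
        simp [Function.update, e1]

lemma Ex.comp_spec {c : Layout} {A : St} (e : Ex) {σ : State c.w} (h : Rel c σ A) {d : ℕ}
    (hd : 40 ≤ d) (hs : e.Safe c A) : Evals (e.comp d) d σ (e.ev A) e.cost := by
  induction e generalizing σ d with
  | var r =>
    have hr : r < 30 := hs
    refine ⟨_, _, Exec.op _ _ _ _ _, le_rfl, ?_, ?_, rfl⟩
    · simp [BinOp.eval, h.reg r hr, Ex.ev]
    · intro r' hr'
      have e1 : r' ≠ d := by omega
      simp [Function.update, e1]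
  | lit k =>
    refine ⟨_, _, Exec.const _ _ _, le_rfl, ?_, ?_, rfl⟩
    · simp [Ex.ev, Nat.mod_eq_of_lt (show k < 2 ^ c.w from hs)]
    · intro r' hr'
      have e1 : r' ≠ d := by omega
      simp [Function.update, e1]
  | bin o a b iha ihb =>
    obtain ⟨ha, hb, ho⟩ := hs
    obtain ⟨τ, t, h1, ht, hv, hr, hm⟩ := iha h hd ha
    have hτ := h.of_eq (fun r hr' => hr r (by omega)) hm
    obtain ⟨τ', t', h1', ht', hv', hr', hm'⟩ := ihb hτ (d := d + 1) (by omega) hb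
    refine ⟨_, _, Exec.seq h1 (Exec.seq h1' (Exec.op _ _ _ _ _)), ?_, ?_, ?_, ?_⟩
    · simp only [Ex.cost]; omega
    · have e1 : (τ'.reg d).toNat = a.ev A := by rw [hr' d (by omega), hv]
      simp only [Function.update_self]
      rw [BinOp.toNat_eval, e1, hv', Ex.ev]
      rwa [e1, hv']
    · intro r hr''
      have e1 : r ≠ d := by omega
      simp [Function.update, e1, hr' r (by omega), hr r hr'']
    · simp [hm', hm]
  | ld k a b iha ihb =>
    obtain ⟨ha, hb, ho⟩ := hs
    obtain ⟨τ, t, h1, ht, hv, hr, hm⟩ := iha h hd ha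
    have hτ := h.of_eq (fun r hr' => hr r (by omega)) hm
    obtain ⟨τ', t', h1', ht', hv', hr', hm'⟩ := ihb hτ (d := d + 1) (by omega) hb
    have hτ' := hτ.of_eq (fun r hr'' => hr' r (by omega)) hm'
    obtain ⟨υ, s, h2, hs, hvu, hru, hmu⟩ := addrOps_spec hτ' hd ho
      (by rw [hr' d (by omega), hv]) hv'
    refine ⟨_, _, Exec.seq h1 (Exec.seq h1' (Exec.seq h2 (Exec.load _ _ _))), ?_, ?_, ?_, ?_⟩
    · simp only [Ex.cost]; omega
    · simp only [Function.update_self]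
      rw [eq_ofNat hvu, hmu, hτ'.mem _ _ _ ho, Ex.ev]
    · intro r hr''
      have e1 : r ≠ d := by omega
      simp [Function.update, e1, hru r hr'', hr' r (by omega), hr r hr'']
    · simp [hmu, hm', hm]

/-! ### Statements and their verification rules -/

/-- Weakest preconditions: from every machine state that represents `A`, the program halts in a
state that represents some state with the property `Q`, whose clock accounts for the time spent. -/
def wp (c : Layout) (P : Program) (A : St) (Q : St → Prop) : Prop :=
  ∀ σ, Rel c σ A → ∃ τ t A', Exec P σ τ t ∧ A.clk + t ≤ A'.clk ∧ Rel c τ A' ∧ Q A'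

/-- `R[x] := e` -/
def asg (x : ℕ) (e : Ex) : Program := .seq (e.comp 40) (.op .or x 40 40)

/-- The cell `(a, b)` of part `k` of the memory becomes `e`. -/
def sto (k : ℕ) (a b e : Ex) : Program :=
  .seq (a.comp 40) (.seq (b.comp 41) (.seq (Ex.addrOps k 40) (.seq (e.comp 41) (.store 40 41))))

/-- Comparisons of expressions. -/
inductive Cnd
  | lt (a b : Ex)
  | eq (a b : Ex)

namespace Cnd

/-- Evaluates both sides into the registers `40` and `41`. -/
def comp : Cnd → Program
  | lt a b => .seq (a.comp 40) (b.comp 41)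
  | eq a b => .seq (a.comp 40) (b.comp 41)

/-- The machine test that decides the condition after `comp`. -/
def test : Cnd → Test
  | lt _ _ => .lt 40 41
  | eq _ _ => .eq 40 41

/-- The comparison is true in the state `A`. -/
def Holds (A : St) : Cnd → Prop
  | lt a b => a.ev A < b.ev A
  | eq a b => a.ev A = b.ev A

/-- Both sides can be evaluated. -/
def Safe (c : Layout) (A : St) : Cnd → Prop
  | lt a b => a.Safe c A ∧ b.Safe c A
  | eq a b => a.Safe c A ∧ b.Safe c A

/-- The time in which both sides are evaluated. -/
def cost : Cnd → ℕ
  | lt a b => a.cost + b.cost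
  | eq a b => a.cost + b.cost

end Cnd

/-- `if b then P else P'` -/
def cond (b : Cnd) (P P' : Program) : Program := .seq b.comp (.ite b.test P P')

/-- The registers of the condition are evaluated before the loop and at the end of each round. -/
def loop (b : Cnd) (P : Program) : Program := .seq b.comp (.while b.test (.seq P b.comp))

/-- `R[i]` runs from `0` to `R[n] - 1`. -/
def forTo (i n : ℕ) (P : Program) : Program :=
  .seq (asg i (.lit 0))
    (loop (.lt (.var i) (.var n)) (.seq P (asg i (.bin .add (.var i) (.lit 1)))))

variable {c : Layout} {A : St} {Q : St → Prop}

lemma wp_mono {P : Program} {Q' : St → Prop} (h : wp c P A Q) (hQ : ∀ B, Q B → Q' B) :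
    wp c P A Q' := fun σ hσ => by
  obtain ⟨τ, t, A', h1, h2, h3, h4⟩ := h σ hσ
  exact ⟨τ, t, A', h1, h2, h3, hQ _ h4⟩

lemma wp_seq {P P' : Program} (h : wp c P A fun B => wp c P' B Q) : wp c (.seq P P') A Q :=
  fun σ hσ => by
    obtain ⟨τ, t, B, h1, h2, h3, h4⟩ := h σ hσ
    obtain ⟨υ, t', B', h1', h2', h3', h4'⟩ := h4 τ h3
    exact ⟨υ, _, B', Exec.seq h1 h1', by omega, h3', h4'⟩

lemma wp_skip (h : Q (A.tick 1)) : wp c .skip A Q := fun σ hσ =>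
  ⟨σ, 1, A.tick 1, Exec.skip σ, le_rfl, ⟨hσ.1, hσ.2, hσ.3, hσ.4, hσ.5⟩, h⟩

/-- Registers of a represented state hold words. -/
lemma wp_of_reg_lt {P : Program} (h : (∀ r < 30, A.reg r < 2 ^ c.w) → wp c P A Q) :
    wp c P A Q := fun σ hσ =>
  h (fun r hr => by rw [← hσ.reg r hr]; exact BitVec.isLt _) σ hσ

lemma wp_asg {x : ℕ} {e : Ex} (hs : e.Safe c A) (hx : x < 30)
    (h : Q ((A.setReg x (e.ev A)).tick (e.cost + 1))) : wp c (asg x e) A Q := fun σ hσ => by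
  obtain ⟨τ, t, h1, ht, hv, hr, hm⟩ := e.comp_spec hσ le_rfl hs
  refine ⟨_, _, _, Exec.seq h1 (Exec.op _ _ _ _ _), ?_, ?_, h⟩
  · simp only [St.tick_clk, St.setReg_clk]; omega
  · have hr' := hσ.of_eq hr hm
    constructor
    · intro r hr''
      by_cases hrx : r = x
      · subst hrx; simp [BinOp.eval, hv]
      · simp [hrx, hr'.reg r hr'']
    · have e1 : 30 ≠ x := by omega
      simp [Function.update, e1, hr'.reg_L]
    · have e1 : 31 ≠ x := by omega
      simp [Function.update, e1, hr'.reg_K]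
    · have e1 : 32 ≠ x := by omega
      simp [Function.update, e1, hr'.reg_last]
    · exact hr'.mem

lemma wp_sto {k : ℕ} {a b e : Ex} (ha : a.Safe c A) (hb : b.Safe c A) (he : e.Safe c A)
    (hv : c.Valid k (a.ev A) (b.ev A))
    (h : Q ((A.setMem k (a.ev A) (b.ev A) (e.ev A)).tick (a.cost + b.cost + e.cost + 8))) :
    wp c (sto k a b e) A Q := fun σ hσ => by
  obtain ⟨τ, t, h1, ht, hva, hr, hm⟩ := a.comp_spec hσ le_rfl ha
  have hτ := hσ.of_eq hr hm
  obtain ⟨τ', t', h1', ht', hvb, hr', hm'⟩ := b.comp_spec hτ (d := 41) (by omega) hb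
  have hτ' := hτ.of_eq (fun r hr'' => hr' r (by omega)) hm'
  obtain ⟨υ, s, h2, hs, hvu, hru, hmu⟩ := addrOps_spec hτ' le_rfl hv
    (by rw [hr' 40 (by omega), hva]) hvb
  have hυ := hτ'.of_eq hru hmu
  obtain ⟨υ', s', h2', hs', hve, hru', hmu'⟩ := e.comp_spec hυ (d := 41) (by omega) he
  have hυ' := hυ.of_eq (fun r hr'' => hru' r (by omega)) hmu'
  refine ⟨_, _, _, Exec.seq h1 (Exec.seq h1' (Exec.seq h2 (Exec.seq h2' (Exec.store _ _ _)))),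
    ?_, ?_, h⟩
  · simp only [St.tick_clk, St.setMem_clk]; omega
  · refine ⟨hυ'.reg, hυ'.reg_L, hυ'.reg_K, hυ'.reg_last, fun k' a' b' hv' => ?_⟩
    have e40 : υ'.reg 40 = BitVec.ofNat c.w (c.addr k (a.ev A) (b.ev A)) := by
      rw [hru' 40 (by omega)]; exact eq_ofNat hvu
    by_cases heq : k' = k ∧ a' = a.ev A ∧ b' = b.ev A
    · obtain ⟨rfl, rfl, rfl⟩ := heq
      simp [e40, hve]
    · have hne : BitVec.ofNat c.w (c.addr k' a' b') ≠ υ'.reg 40 := by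
        rw [e40]
        intro hh
        have := congrArg BitVec.toNat hh
        rw [BitVec.toNat_ofNat, BitVec.toNat_ofNat, Nat.mod_eq_of_lt (c.addr_lt hv'),
          Nat.mod_eq_of_lt (c.addr_lt hv)] at this
        exact heq (c.addr_inj hv' hv this)
      have hold := hυ'.mem k' a' b' hv'
      simp only [Function.update_of_ne hne, hold, St.tick_mem, St.setMem_mem]
      by_cases e1 : k' = k
      · subst e1
        by_cases e2 : a' = a.ev A
        · subst e2
          have e3 : b' ≠ b.ev A := fun h3 => heq ⟨rfl, rfl, h3⟩
          simp [e3]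
        · simp [e2]
      · simp [e1]

lemma Cnd.comp_spec (b : Cnd) {σ : State c.w} (hσ : Rel c σ A) (hs : b.Safe c A) :
    ∃ τ t, Exec b.comp σ τ t ∧ t ≤ b.cost ∧ Rel c τ A ∧ (b.test.Holds τ ↔ b.Holds A) := by
  have key : ∀ a a' : Ex, a.Safe c A → a'.Safe c A → ∃ τ t,
      Exec (.seq (a.comp 40) (a'.comp 41)) σ τ t ∧ t ≤ a.cost + a'.cost ∧ Rel c τ A ∧
      (τ.reg 40).toNat = a.ev A ∧ (τ.reg 41).toNat = a'.ev A := by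
    intro a a' ha ha'
    obtain ⟨τ, t, h1, ht, hva, hr, hm⟩ := a.comp_spec hσ le_rfl ha
    have hτ := hσ.of_eq hr hm
    obtain ⟨τ', t', h1', ht', hvb, hr', hm'⟩ := a'.comp_spec hτ (d := 41) (by omega) ha'
    exact ⟨τ', _, Exec.seq h1 h1', by omega, hτ.of_eq (fun r hr'' => hr' r (by omega)) hm',
      by rw [hr' 40 (by omega), hva], hvb⟩
  cases b with
  | lt a a' =>
    obtain ⟨τ, t, h1, h2, h3, h4, h5⟩ := key a a' hs.1 hs.2
    exact ⟨τ, t, h1, h2, h3, by simp [Cnd.test, Test.Holds, Cnd.Holds, h4, h5]⟩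
  | eq a a' =>
    obtain ⟨τ, t, h1, h2, h3, h4, h5⟩ := key a a' hs.1 hs.2
    exact ⟨τ, t, h1, h2, h3, by
      simp [Cnd.test, Test.Holds, Cnd.Holds, ← h4, ← h5, BitVec.toNat_inj]⟩

lemma Rel.tick {σ : State c.w} (h : Rel c σ A) (n : ℕ) : Rel c σ (A.tick n) :=
  ⟨h.1, h.2, h.3, h.4, h.5⟩

lemma wp_cond {b : Cnd} {P P' : Program} (hs : b.Safe c A)
    (h1 : b.Holds A → wp c P (A.tick (b.cost + 1)) Q)
    (h2 : ¬ b.Holds A → wp c P' (A.tick (b.cost + 1)) Q) : wp c (cond b P P') A Q :=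
  fun σ hσ => by
    obtain ⟨τ, t, he, ht, hτ, hb⟩ := b.comp_spec hσ hs
    by_cases hh : b.Holds A
    · obtain ⟨υ, t', B, g1, g2, g3, g4⟩ := h1 hh τ (hτ.tick _)
      refine ⟨υ, _, B, Exec.seq he (Exec.ite_true (hb.2 hh) g1), ?_, g3, g4⟩
      simp only [St.tick_clk] at g2; omega
    · obtain ⟨υ, t', B, g1, g2, g3, g4⟩ := h2 hh τ (hτ.tick _)
      refine ⟨υ, _, B, Exec.seq he (Exec.ite_false (fun h => hh (hb.1 h)) g1), ?_, g3, g4⟩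
      simp only [St.tick_clk] at g2; omega

/-- Loops, with an invariant that carries a decreasing natural number. -/
lemma wp_loop {b : Cnd} {P : Program} (Inv : ℕ → St → Prop)
    (hs : ∀ n B, Inv n B → b.Safe c B)
    (hstep : ∀ n B, Inv n B → b.Holds B → wp c P (B.tick (b.cost + 1)) fun B' => ∃ m < n, Inv m B')
    (hexit : ∀ n B, Inv n B → ¬ b.Holds B → Q (B.tick (b.cost + 1)))
    {n : ℕ} (h0 : Inv n A) : wp c (loop b P) A Q := by
  have key : ∀ n B, Inv n B → ∀ σ, Rel c σ B → (b.test.Holds σ ↔ b.Holds B) →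
      ∃ τ t A', Exec (.while b.test (.seq P b.comp)) σ τ t ∧ B.clk + b.cost + t ≤ A'.clk ∧
        Rel c τ A' ∧ Q A' := by
    intro n
    induction n using Nat.strong_induction_on with
    | _ n ih =>
      intro B hB σ hσ hb
      by_cases hh : b.Holds B
      · obtain ⟨τ, t, B', g1, g2, g3, m, hm, hB'⟩ := hstep n B hB hh σ (hσ.tick _)
        obtain ⟨τ', t', g1', g2', g3', g4'⟩ := b.comp_spec g3 (hs m B' hB')
        obtain ⟨υ, s, A', f1, f2, f3, f4⟩ := ih m hm B' hB' τ' g3' g4'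
        refine ⟨υ, _, A', Exec.while_true (hb.2 hh) (Exec.seq g1 g1') f1, ?_, f3, f4⟩
        simp only [St.tick_clk] at g2; omega
      · refine ⟨σ, _, _, Exec.while_false fun h => hh (hb.1 h), ?_, hσ.tick _, hexit n B hB hh⟩
        simp only [St.tick_clk]; omega
  intro σ hσ
  obtain ⟨τ, t, g1, g2, g3, g4⟩ := b.comp_spec hσ (hs n A h0)
  obtain ⟨υ, s, A', f1, f2, f3, f4⟩ := key n A h0 τ g3 g4
  exact ⟨υ, _, A', Exec.seq g1 f1, by omega, f3, f4⟩

lemma wp_forTo {i n : ℕ} {P : Program} (N : ℕ) (Inv : ℕ → St → Prop) (hin : n ≠ i) (hi : i < 30)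
    (hn : n < 30) (hN : A.reg n = N) (h0 : Inv 0 ((A.setReg i 0).tick 2))
    (hstep : ∀ k < N, ∀ B, Inv k B → B.reg i = k → B.reg n = N → wp c P (B.tick 3) fun B' =>
      B'.reg i = k ∧ B'.reg n = N ∧ Inv (k + 1) ((B'.setReg i (k + 1)).tick 4))
    (hexit : ∀ B, Inv N B → B.reg i = N → B.reg n = N → Q (B.tick 3)) :
    wp c (forTo i n P) A Q := by
  refine wp_of_reg_lt fun hlt => ?_
  have hNw : N < 2 ^ c.w := hN ▸ hlt n hn
  have hw : 1 < 2 ^ c.w := Nat.one_lt_two_pow (by have := c.w_pos; omega)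
  refine wp_seq (wp_asg (by simp [Ex.Safe]) hi ?_)
  refine wp_loop (fun m B => ∃ k ≤ N, m = N - k ∧ Inv k B ∧ B.reg i = k ∧ B.reg n = N)
    (n := N) ?_ ?_ ?_ ?_
  · rintro m B -
    exact ⟨hi, hn⟩
  · rintro m B ⟨k, hk, rfl, hB, hik, hnN⟩ hh
    have hkN : k < N := by simpa [Cnd.Holds, Ex.ev, hik, hnN] using hh
    refine wp_seq (wp_mono (hstep k hkN B hB hik hnN) ?_)
    rintro B' ⟨h1, h2, h3⟩
    refine wp_asg ⟨hi, hw, ?_⟩ hi ⟨N - (k + 1), by omega, k + 1, by omega, rfl, ?_, ?_, ?_⟩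
    · simp only [BinOp.Safe, Ex.ev, h1]; omega
    · simpa [Ex.ev, BinOp.nat, h1, Ex.cost] using h3
    · simp [Ex.ev, BinOp.nat, h1]
    · simp [hin, h2]
  · rintro m B ⟨k, hk, rfl, hB, hik, hnN⟩ hh
    have hkN : k = N := by
      have : ¬ k < N := by simpa [Cnd.Holds, Ex.ev, hik, hnN] using hh
      omega
    subst hkN
    exact hexit B hB hik hnN
  · exact ⟨0, by omega, by omega, by simpa [Ex.ev, Ex.cost] using h0, by simp [Ex.ev],
      by simp [hin, hN]⟩

end WordRAM

/-! ### Running a program on its input -/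

namespace WordRAM

namespace Layout

variable (c : Layout)

lemma one_lt_two_pow : 1 < 2 ^ c.w := Nat.one_lt_two_pow (by have := c.w_pos; omega)

@[simp] lemma w_ne_zero : c.w ≠ 0 := by have := c.w_pos; omega

@[simp] lemma valid_raw {a : ℕ} : c.Valid 8 a 0 ↔ a < c.L := by simp [Valid]

@[simp] lemma valid_high {a : ℕ} : c.Valid 9 a 0 ↔ a < 2 ^ (c.w - 1) := by simp [Valid]

lemma valid_array {k a b : ℕ} (hk : k < 8) : c.Valid k a b ↔ a < c.K ∧ b < c.K := by
  simp only [Valid, hk, true_and]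
  omega

end Layout

attribute [simp] Ex.ev Ex.cost Ex.Safe BinOp.nat BinOp.Safe Cnd.Holds Cnd.Safe Cnd.cost

/-- Before the size of the input is known, the lower half of the memory is one raw region. -/
abbrev rawLayout (w : ℕ) (hw : 1 ≤ w) : Layout where
  w := w
  L := 2 ^ (w - 1) - 1
  K := 0
  w_pos := hw
  fits := by simp

/-- The state represented by the initial machine state, after the three time units of `startup`. -/
def initSt (input : List ℕ) : St where
  reg := fun _ => 0
  mem := fun k a b => if k = 8 ∧ b = 0 then input.getD a 0 else 0
  clk := 4

/-- Puts the parameters of `rawLayout` into the registers reserved for them. -/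
def startup : Program :=
  .seq (.const 33 1) <| .seq (.op .sub 32 32 33) (.op .shr 30 32 33)

lemma startup_spec {w : ℕ} (hw : 1 ≤ w) {input : List ℕ} (hin : ∀ x ∈ input, x < 2 ^ w)
    (hlen : input.length < 2 ^ (w - 1)) :
    ∃ τ, Exec startup (initState w input) τ 3 ∧ Rel (rawLayout w hw) τ (initSt input) := by
  have h2 := (rawLayout w hw).two_pow
  dsimp only at h2
  have hpos : 1 < 2 ^ w := Nat.one_lt_two_pow (by omega)
  refine ⟨_, Exec.seq (Exec.const _ _ _) (Exec.seq (Exec.op _ _ _ _ _) (Exec.op _ _ _ _ _)), ?_⟩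
  have hone : (0 : BitVec w) - BitVec.ofNat w 1 = BitVec.ofNat w (2 ^ w - 1) := by
    apply BitVec.eq_of_toNat_eq
    rw [BitVec.toNat_sub]
    simp [Nat.mod_eq_of_lt hpos]
  constructor
  · intro r hr
    have e1 : r ≠ 30 := by omega
    have e2 : r ≠ 32 := by omega
    have e3 : r ≠ 33 := by omega
    simp only [Function.update, e1, e2, e3, initState, initSt, ↓reduceDIte]
    exact BitVec.toNat_zero
  · have : BitVec.ofNat w (2 ^ w - 1) >>> BitVec.ofNat w 1 = BitVec.ofNat w (2 ^ (w - 1) - 1) := by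
      apply BitVec.eq_of_toNat_eq
      rw [BitVec.ushiftRight_eq', BitVec.toNat_ushiftRight]
      simp only [BitVec.toNat_ofNat, Nat.mod_eq_of_lt hpos]
      rw [Nat.mod_eq_of_lt (by omega), Nat.mod_eq_of_lt (by omega), Nat.shiftRight_eq_div_pow]
      omega
    simp only [BinOp.eval, initState, Function.update, rawLayout]
    simp only [show (32 : ℕ) ≠ 33 by norm_num, show (33 : ℕ) ≠ 32 by norm_num, ↓reduceDIte]
    rw [hone]
    exact this
  · simp [initState, rawLayout, Function.update]
  · simp only [BinOp.eval, initState, Function.update, rawLayout]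
    simp only [show (32 : ℕ) ≠ 33 by norm_num, show (32 : ℕ) ≠ 30 by norm_num, ↓reduceDIte]
    exact hone
  · rintro k a b hv
    have hlt := (rawLayout w hw).addr_lt hv
    change (BitVec.ofNat w (input.getD (BitVec.ofNat w ((rawLayout w hw).addr k a b)).toNat
      0)).toNat = if k = 8 ∧ b = 0 then input.getD a 0 else 0
    rw [BitVec.toNat_ofNat, BitVec.toNat_ofNat,
      Nat.mod_eq_of_lt (a := (rawLayout w hw).addr k a b) hlt]
    have hmod : ∀ i, input.getD i 0 % 2 ^ w = input.getD i 0 := by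
      intro i
      apply Nat.mod_eq_of_lt
      by_cases hi : i < input.length
      · rw [List.getD_eq_getElem _ _ hi]; exact hin _ (List.getElem_mem hi)
      · rw [List.getD_eq_default _ _ (by omega)]; omega
    rcases hv with ⟨hk, ha, hb⟩ | ⟨rfl, ha, rfl⟩ | ⟨rfl, ha, rfl⟩
    · simp at ha
    · simpa [Layout.addr] using hmod a
    · dsimp only at ha
      have : input.length ≤ 2 ^ w - 1 - a := by omega
      simp [Layout.addr, List.getElem?_eq_none this]

/-- The layout becomes the one whose parameters are in the registers `a` and `b`. -/
def relayout (a b : ℕ) : Program := .seq (.op .or 30 a a) (.op .or 31 b b)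

/-- The state after a change of layout: the memory behind the raw region is still blank. -/
def St.blank (A : St) : St where
  reg := A.reg
  mem := fun k a b => if k < 8 then 0 else A.mem k a b
  clk := A.clk + 2

lemma relayout_spec {w : ℕ} (hw : 1 ≤ w) {c : Layout} (hc : c.w = w)
    (hfit : c.L + 8 * (c.K * c.K) < 2 ^ (w - 1)) {σ : State w} {A : St}
    (h : Rel (rawLayout w hw) σ A) {a b : ℕ} (ha : a < 30) (hb : b < 30) (hA : A.reg a = c.L)
    (hB : A.reg b = c.K) (hz : ∀ i, c.L ≤ i → A.mem 8 i 0 = 0) :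
    ∃ τ : State c.w, Exec (relayout a b) (hc ▸ σ) τ 2 ∧ Rel c τ A.blank := by
  subst hc
  refine ⟨_, Exec.seq (Exec.op _ _ _ _ _) (Exec.op _ _ _ _ _), ?_⟩
  have e1 : a ≠ 30 := by omega
  have e2 : b ≠ 30 := by omega
  constructor
  · intro r hr
    have e1 : r ≠ 30 := by omega
    have e2 : r ≠ 31 := by omega
    simpa only [Function.update, e1, e2, ↓reduceDIte, St.blank] using h.reg r hr
  · have : σ.reg a = BitVec.ofNat c.w c.L := eq_ofNat ((h.reg a ha).trans hA)
    simp [BinOp.eval, this]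
  · have : σ.reg b = BitVec.ofNat c.w c.K := eq_ofNat ((h.reg b hb).trans hB)
    simp [Function.update, e2, BinOp.eval, this]
  · exact h.reg_last
  · intro k i j hv
    rcases hv with ⟨hk, hi, hj⟩ | ⟨rfl, hi, rfl⟩ | ⟨rfl, hi, rfl⟩
    · have hlt := c.mul_add_lt hi hj
      have := h.mem 8 (c.L + ((i * c.K + j) * 8 + k)) 0
        (Or.inr (Or.inl ⟨rfl, by dsimp only; omega, rfl⟩))
      rw [hz _ (by omega)] at this
      simpa [Layout.addr, hk, St.blank] using this
    · have := h.mem 8 i 0 (Or.inr (Or.inl ⟨rfl, by dsimp only; omega, rfl⟩))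
      simpa [Layout.addr, St.blank] using this
    · have := h.mem 9 i 0 (Or.inr (Or.inr ⟨rfl, hi, rfl⟩))
      simpa [Layout.addr, St.blank] using this

/-- The raw region of `B` contains the list `out`, from the index in register `0` on. -/
def Delivers (c : Layout) (B : St) (out : List ℕ) : Prop :=
  ∀ (i : ℕ) (h : i < out.length), B.reg 0 + i < c.L ∧ B.mem 8 (B.reg 0 + i) 0 = out[i]

lemma Delivers.output {c : Layout} {B : St} {out : List ℕ} (h : Delivers c B out) {τ : State c.w}
    (hτ : Rel c τ B) : (τ.reg 0).toNat + out.length ≤ 2 ^ c.w ∧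
      ∀ (i : ℕ) (h : i < out.length),
        (τ.mem (τ.reg 0 + BitVec.ofNat c.w i)).toNat = out[i] := by
  have h0 := hτ.reg 0 (by norm_num)
  have hfit := c.fits
  have h2 := c.two_pow
  constructor
  · rcases Nat.eq_zero_or_pos out.length with hl | hl
    · rw [hl]; exact (BitVec.isLt _).le
    · have := (h (out.length - 1) (by omega)).1
      omega
  · intro i hi
    obtain ⟨h3, h4⟩ := h i hi
    have := hτ.mem 8 _ 0 (Or.inr (Or.inl ⟨rfl, h3, rfl⟩))
    rw [eq_ofNat h0, ← BitVec.ofNat_add, ← h4, ← this]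
    simp [Layout.addr]

lemma computes_of_wp {w : ℕ} (hw : 1 ≤ w) {input out : List ℕ} (hin : ∀ x ∈ input, x < 2 ^ w)
    (hlen : input.length < 2 ^ (w - 1)) {P : Program}
    (h : wp (rawLayout w hw) P (initSt input) fun B => Delivers (rawLayout w hw) B out) :
    ∃ t, (Program.seq startup P).Computes w input out t := by
  obtain ⟨τ, h1, h2⟩ := startup_spec hw hin hlen
  obtain ⟨υ, t, B, h3, -, h5, h6⟩ := h τ h2
  exact ⟨_, υ, Exec.seq h1 h3, h6.output h5⟩

/-- Programs in two stages: a first one that finds the parameters of a layout, and a second one that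
uses this layout. The output `out` and the time satisfy `G`. -/
lemma computes_of_wp_relayout {w : ℕ} (hw : 1 ≤ w) {input : List ℕ}
    (hin : ∀ x ∈ input, x < 2 ^ w) (hlen : input.length < 2 ^ (w - 1)) {P P' : Program} {a b : ℕ}
    (ha : a < 30) (hb : b < 30) {c : Layout} (hc : c.w = w)
    (hfit : c.L + 8 * (c.K * c.K) < 2 ^ (w - 1)) {G : List ℕ → ℕ → Prop}
    (h : wp (rawLayout w hw) P (initSt input) fun B =>
      B.reg a = c.L ∧ B.reg b = c.K ∧ (∀ i, c.L ≤ i → B.mem 8 i 0 = 0) ∧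
      wp c P' B.blank fun B' => ∃ out, Delivers c B' out ∧ G out B'.clk) :
    ∃ out t N, t ≤ N ∧ G out N ∧
      (Program.seq startup (.seq P (.seq (relayout a b) P'))).Computes w input out t := by
  subst hc
  obtain ⟨τ, h1, h2⟩ := startup_spec hw hin hlen
  obtain ⟨υ, t, B, h3, h4, h5, h6, h7, h8, h9⟩ := h τ h2
  obtain ⟨υ', g1, g2⟩ := relayout_spec hw rfl hfit h5 ha hb h6 h7 h8
  obtain ⟨σ, t', B', f1, f2, f3, out, f4, f5⟩ := h9 υ' g2
  refine ⟨out, _, B'.clk, ?_, f5, σ, Exec.seq h1 (Exec.seq h3 (Exec.seq g1 f1)), f4.output f3⟩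
  simp only [initSt, St.blank] at h4 f2
  omega

end WordRAM

/-! ### Compressed representation -/

namespace Symdiff

lemma image_symmDiff_of_injOn {α β : Type*} [DecidableEq α] [DecidableEq β] {f : α → β}
    {U S T : Finset α} (hf : Set.InjOn f U) (hS : S ⊆ U) (hT : T ⊆ U) :
    (symmDiff S T).image f = symmDiff (S.image f) (T.image f) := by
  ext b
  simp only [Finset.mem_image, Finset.mem_symmDiff]
  constructor
  · rintro ⟨a, h | h, rfl⟩
    · exact Or.inl ⟨⟨a, h.1, rfl⟩, fun ⟨a', h', he⟩ => h.2 (hf (hT h') (hS h.1) he ▸ h')⟩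
    · exact Or.inr ⟨⟨a, h.1, rfl⟩, fun ⟨a', h', he⟩ => h.2 (hf (hS h') (hT h.1) he ▸ h')⟩
  · rintro (⟨⟨a, h, rfl⟩, h'⟩ | ⟨⟨a, h, rfl⟩, h'⟩)
    · exact ⟨a, Or.inl ⟨h, fun ha => h' ⟨a, ha, rfl⟩⟩, rfl⟩
    · exact ⟨a, Or.inr ⟨h, fun ha => h' ⟨a, ha, rfl⟩⟩, rfl⟩

/-- The sets denoted by pointers. The pointers `0` and `1` denote `∅` and the set `V` of all
elements; the pointer `k + 2` refers to the record `(x, q)` number `k`, which denotes the set of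
the pointer `q` with the element `x` toggled. Pointers in records are smaller than the pointer to
the record. -/
inductive Points (V : Finset ℕ) (rec : List (ℕ × ℕ)) : ℕ → Finset ℕ → Prop
  | empty : Points V rec 0 ∅
  | full : Points V rec 1 V
  | toggle {k x q : ℕ} {A : Finset ℕ} : rec[k]? = some (x, q) → q < k + 2 →
      Points V rec q A → Points V rec (k + 2) (symmDiff A {x})

variable {V : Finset ℕ}

lemma Points.append {rec : List (ℕ × ℕ)} (rec' : List (ℕ × ℕ)) {q : ℕ} {A : Finset ℕ}
    (h : Points V rec q A) : Points V (rec ++ rec') q A := by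
  induction h with
  | empty => exact .empty
  | full => exact .full
  | @toggle k x q A hk hq _ ih =>
    refine .toggle ?_ hq ih
    rw [List.getElem?_append_left (List.getElem?_eq_some_iff.1 hk).1, hk]

lemma Points.lt {rec : List (ℕ × ℕ)} {q : ℕ} {A : Finset ℕ}
    (h : Points V rec q A) : q < rec.length + 2 := by
  cases h with
  | empty => omega
  | full => omega
  | toggle hk _ _ =>
    have := (List.getElem?_eq_some_iff.1 hk).1
    omega

/-- The records of a list refer to elements of `V` and to pointers in range. -/
def RecordsOK (V : Finset ℕ) (rec : List (ℕ × ℕ)) : Prop :=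
  ∀ r ∈ rec, r.1 ∈ V ∧ r.2 < rec.length + 2

/-- One record for each element of `D` leads from a pointer to `A` to a pointer to `A △ D`. -/
lemma exists_points_symmDiff {rec : List (ℕ × ℕ)} (hrec : RecordsOK V rec) {q : ℕ}
    {A : Finset ℕ} (h : Points V rec q A) {D : Finset ℕ} (hD : D ⊆ V) :
    ∃ rec' q', RecordsOK V (rec ++ rec') ∧ rec'.length = D.card ∧
      Points V (rec ++ rec') q' (symmDiff A D) := by
  induction D using Finset.induction_on with
  | empty =>
    refine ⟨[], q, by simpa using hrec, rfl, ?_⟩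
    rw [← Finset.bot_eq_empty, symmDiff_bot]
    simpa using h
  | @insert x D hx ih =>
    obtain ⟨rec', q', h1, h2, h3⟩ := ih fun y hy => hD (Finset.mem_insert_of_mem hy)
    refine ⟨rec' ++ [(x, q')], (rec ++ rec').length + 2, ?_, ?_, ?_⟩
    · intro r hr
      rw [← List.append_assoc, List.mem_append] at hr
      simp only [List.length_append, List.length_singleton]
      rcases hr with hr | hr
      · have := h1 r hr
        simp only [List.length_append] at this
        exact ⟨this.1, by omega⟩
      · obtain rfl := List.mem_singleton.1 hr
        have := h3.lt
        simp only [List.length_append] at this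
        exact ⟨hD (Finset.mem_insert_self _ _), by dsimp only; omega⟩
    · simp [Finset.card_insert_of_notMem hx, h2]
    · have e : symmDiff A (insert x D) = symmDiff (symmDiff A D) {x} := by
        rw [symmDiff_assoc]
        congr 1
        ext y
        simp only [Finset.mem_insert, Finset.mem_symmDiff, Finset.mem_singleton]
        by_cases hy : y = x
        · subst hy; simp [hx]
        · simp [hy]
      rw [e, ← List.append_assoc]
      exact .toggle (by rw [List.getElem?_concat_length]) h3.lt (h3.append _)

/-- The edges of a symdiff graph, taken in an order in which each target precedes its sources,
become lists of records, one for each toggled element. -/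
lemma IsSymdiffGraph.exists_records {𝒮 : Finset (Finset ℕ)} {p : Finset ℕ → Finset ℕ}
    (hp : IsSymdiffGraph 𝒮 p) {f : ℕ → ℕ} (hf : Set.InjOn f (ground 𝒮))
    (hV : (ground 𝒮).image f = V) :
    ∃ (rec : List (ℕ × ℕ)) (ptr : Finset ℕ → ℕ), RecordsOK V rec ∧ rec.length ≤ weight 𝒮 p ∧
      ∀ S ∈ 𝒮, Points V rec (ptr S) (S.image f) := by
  have key : ∀ n ≤ 𝒮.card, ∃ A ⊆ 𝒮, A.card = n ∧
      ∃ (rec : List (ℕ × ℕ)) (ptr : Finset ℕ → ℕ), RecordsOK V rec ∧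
        rec.length ≤ weight A p ∧ ∀ S ∈ A, Points V rec (ptr S) (S.image f) := by
    intro n
    induction n with
    | zero =>
      exact fun _ => ⟨∅, by simp, rfl, [], fun _ => 0, by simp [RecordsOK], by simp, by simp⟩
    | succ n ih =>
      intro hn
      obtain ⟨A, hA, hAn, rec, ptr, h1, h2, h3⟩ := ih (by omega)
      -- the pointers that are available: those of `A` and of the two roots
      have hptr : ∀ B, B ∈ A ∨ B ∈ roots 𝒮 → ∃ q, Points V rec q (B.image f) := by
        rintro B (hB | hB)
        · exact ⟨_, h3 B hB⟩
        · rcases mem_roots.1 hB with rfl | rfl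
          · exact ⟨0, by simpa using Points.empty⟩
          · exact ⟨1, by rw [hV]; exact .full⟩
      -- it suffices to add one more set
      suffices h : ∃ v ∈ 𝒮, v ∉ A ∧ ∃ rec' q, RecordsOK V (rec ++ rec') ∧
          rec'.length ≤ edgeWeight p v ∧ Points V (rec ++ rec') q (v.image f) by
        obtain ⟨v, hv, hvA, rec', q, g1, g2, g3⟩ := h
        refine ⟨insert v A, Finset.insert_subset hv hA, by
          rw [Finset.card_insert_of_notMem hvA, hAn],
          rec ++ rec', Function.update ptr v q, g1, ?_, ?_⟩
        · rw [weight, Finset.sum_insert hvA, List.length_append]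
          rw [weight] at h2
          omega
        · intro S hS
          by_cases hSv : S = v
          · subst hSv; simpa using g3
          · rw [Function.update_of_ne hSv]
            exact (h3 S ((Finset.mem_insert.1 hS).resolve_left hSv)).append _
      obtain ⟨v, hv, hvA⟩ : ∃ v ∈ 𝒮, v ∉ A := by
        by_contra! h
        have := Finset.card_le_card (show 𝒮 ⊆ A from h)
        omega
      by_cases hvr : v ∈ roots 𝒮
      · obtain ⟨q, hq⟩ := hptr v (Or.inr hvr)
        exact ⟨v, hv, hvA, [], q, by simpa using h1, by simp, by simpa using hq⟩
      · obtain ⟨a, ha, haX, hpa⟩ := hp.exists_crossing (X := {t | t ∈ A ∨ t ∈ roots 𝒮})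
          (fun r hr => Or.inr hr) hv (by simp [hvA, hvr])
        simp only [Set.mem_ofPred_eq, not_or] at haX hpa
        obtain ⟨q, hq⟩ := hptr _ hpa
        have hsub : p a ⊆ ground 𝒮 := by
          rcases hpa with h | h
          · exact subset_ground (hA h)
          · rcases mem_roots.1 h with h | h <;> simp [h]
        have hD : (symmDiff a (p a)).image f ⊆ V := by
          rw [← hV]
          refine Finset.image_subset_image fun x hx => ?_
          rcases Finset.mem_symmDiff.1 hx with hx | hx
          · exact subset_ground ha hx.1
          · exact hsub hx.1
        obtain ⟨rec', q', g1, g2, g3⟩ := exists_points_symmDiff h1 hq hD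
        refine ⟨a, ha, haX.1, rec', q', g1, g2 ▸ Finset.card_image_le, ?_⟩
        rw [image_symmDiff_of_injOn hf (subset_ground ha) hsub, symmDiff_comm (a.image f),
          symmDiff_symmDiff_cancel_left] at g3
        exact g3
  obtain ⟨A, hA, hAn, rec, ptr, h1, h2, h3⟩ := key _ le_rfl
  obtain rfl := Finset.eq_of_subset_of_card_le hA hAn.ge
  exact ⟨rec, ptr, h1, h2, h3⟩

/-! ### The renaming by ranks -/

lemma rankIn_lt_rankIn {U : Finset ℕ} {x y : ℕ} (hy : y ∈ U) (h : x < y) :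
    rankIn U x < rankIn U y := by
  refine Finset.card_lt_card ⟨fun z hz => ?_, fun hs => ?_⟩
  · simp only [Finset.mem_filter] at hz ⊢
    exact ⟨hz.1, by omega⟩
  · have := hs (Finset.mem_filter.2 ⟨hy, le_rfl⟩)
    simp only [Finset.mem_filter] at this
    omega

lemma injOn_rankIn (U : Finset ℕ) : Set.InjOn (rankIn U) U := by
  intro x hx y hy h
  rcases lt_trichotomy x y with hlt | rfl | hlt
  · exact absurd h (rankIn_lt_rankIn hy hlt).ne
  · rfl
  · exact absurd h (rankIn_lt_rankIn hx hlt).ne'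

lemma image_rankIn (U : Finset ℕ) : U.image (rankIn U) = Finset.Icc 1 U.card := by
  refine Finset.eq_of_subset_of_card_le (fun r hr => ?_) ?_
  · obtain ⟨x, hx, rfl⟩ := Finset.mem_image.1 hr
    rw [Finset.mem_Icc]
    exact ⟨Finset.card_pos.2 ⟨x, Finset.mem_filter.2 ⟨hx, le_rfl⟩⟩,
      Finset.card_le_card (Finset.filter_subset _ _)⟩
  · rw [Finset.card_image_of_injOn (injOn_rankIn U)]
    simp

end Symdiff

/-! ### Decoding the compressed representation -/

namespace WordRAM

open Symdiff

/-- The raw region, as a function of the index, contains the list `l` from the index `o` on. -/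
def Has (m : ℕ → ℕ) (o : ℕ) (l : List ℕ) : Prop :=
  ∀ (j : ℕ) (h : j < l.length), m (o + j) = l[j]

lemma Has.update {m : ℕ → ℕ} {o : ℕ} {l : List ℕ} (h : Has m o l) {i v : ℕ}
    (hi : ∀ j < l.length, o + j ≠ i) : Has (Function.update m i v) o l := fun j hj => by
  rw [Function.update_of_ne (hi j hj)]; exact h j hj

lemma has_append {m : ℕ → ℕ} {o : ℕ} {l l' : List ℕ} :
    Has m o (l ++ l') ↔ Has m o l ∧ Has m (o + l.length) l' := by
  constructor
  · refine fun h => ⟨fun j hj => ?_, fun j hj => ?_⟩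
    · have := h j (by rw [List.length_append]; omega)
      rwa [List.getElem_append_left hj] at this
    · have := h (l.length + j) (by rw [List.length_append]; omega)
      rw [List.getElem_append_right (by omega)] at this
      simpa [add_assoc] using this
  · rintro ⟨h, h'⟩ j hj
    rw [List.length_append] at hj
    by_cases hl : j < l.length
    · rw [List.getElem_append_left hl]; exact h j hl
    · rw [List.getElem_append_right (by omega), ← h' (j - l.length) (by omega)]
      congr 1; omega

@[simp] lemma has_nil {m : ℕ → ℕ} {o : ℕ} : Has m o [] := fun j hj => by simp at hj

lemma has_cons {m : ℕ → ℕ} {o v : ℕ} {l : List ℕ} :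
    Has m o (v :: l) ↔ m o = v ∧ Has m (o + 1) l := by
  rw [← List.singleton_append, has_append]
  simp only [List.length_singleton]
  refine and_congr ⟨fun h => by simpa using h 0 (by simp), fun h j hj => ?_⟩ Iff.rfl
  simp only [List.length_singleton, Nat.lt_one_iff] at hj
  subst hj
  simpa using h

/-- The compressed representation in memory: the number `s` of sets, the number `u` of elements, the
length of the representation, an unused word, a pointer for each set, and the records. Owing to the
unused word, the record of the pointer `q` is at the index `s + 2 * q`. -/
def compressed (s u : ℕ) (heads : List ℕ) (rec : List (ℕ × ℕ)) : List ℕ :=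
  [s, u, 4 + heads.length + 2 * rec.length, 0] ++ heads ++ rec.flatMap fun r => [r.1, r.2]

lemma length_flatMap_pair (rec : List (ℕ × ℕ)) :
    (rec.flatMap fun r => [r.1, r.2]).length = 2 * rec.length := by
  induction rec with
  | nil => rfl
  | cons r rec ih => simp only [List.flatMap_cons, List.length_append, ih, List.length_cons,
      List.length_nil]; omega

lemma length_compressed (s u : ℕ) (heads : List ℕ) (rec : List (ℕ × ℕ)) :
    (compressed s u heads rec).length = 4 + heads.length + 2 * rec.length := by
  simp only [compressed, List.length_append, length_flatMap_pair, List.length_cons,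
    List.length_nil]

lemma Has.record {m : ℕ → ℕ} {o : ℕ} {rec : List (ℕ × ℕ)}
    (h : Has m o (rec.flatMap fun r => [r.1, r.2])) {k x q : ℕ} (hk : rec[k]? = some (x, q)) :
    m (o + 2 * k) = x ∧ m (o + 2 * k + 1) = q := by
  induction rec generalizing o k with
  | nil => simp at hk
  | cons r rec ih =>
    rw [List.flatMap_cons, has_append, has_cons, has_cons] at h
    cases k with
    | zero =>
      simp only [List.getElem?_cons_zero, Option.some.injEq] at hk
      subst hk
      exact ⟨h.1.1, h.1.2.1⟩
    | succ k =>
      rw [List.getElem?_cons_succ] at hk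
      have := ih h.2 hk
      simp only [List.length_cons, List.length_nil] at this
      rw [show o + 2 * (k + 1) = o + (0 + 1 + 1) + 2 * k by ring]
      exact this

/-- Follows the records from the pointer in register `8` to a root. Register `9` counts modulo two
how often the element in register `10` is toggled. -/
def chase : Program :=
  loop (.lt (.lit 1) (.var 8)) <| .seq
    (cond (.eq (.ld 8 (.bin .add (.var 1) (.bin .mul (.lit 2) (.var 8))) (.lit 0)) (.var 10))
      (asg 9 (.bin .mod (.bin .add (.var 9) (.lit 1)) (.lit 2))) .skip)
    (asg 8 (.ld 8 (.bin .add (.bin .add (.var 1) (.bin .mul (.lit 2) (.var 8))) (.lit 1)) (.lit 0)))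

/-- Writes the set of each pointer, in order, behind the representation. For each element `x` the
records are followed to a root; `x` belongs to the set if the root is `𝒰` (pointer `1`) and `x` is
toggled an even number of times, or the root is `∅` (pointer `0`) and that number is odd. -/
def decoder : Program :=
  .seq (asg 1 (.ld 8 (.lit 0) (.lit 0))) <| .seq (asg 2 (.ld 8 (.lit 1) (.lit 0))) <|
  .seq (asg 0 (.ld 8 (.lit 2) (.lit 0))) <| .seq (sto 8 (.var 0) (.lit 0) (.var 1)) <|
  .seq (asg 3 (.bin .add (.var 0) (.lit 1))) <|
  forTo 4 1 <|
    .seq (asg 5 (.var 3)) <| .seq (asg 3 (.bin .add (.var 3) (.lit 1))) <| .seq (asg 6 (.lit 0)) <|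
    .seq
      (forTo 7 2 <|
        .seq (asg 10 (.bin .add (.var 7) (.lit 1))) <|
        .seq (asg 8 (.ld 8 (.bin .add (.var 4) (.lit 4)) (.lit 0))) <| .seq (asg 9 (.lit 0)) <|
        .seq chase <|
        cond (.eq (.var 8) (.var 9)) .skip <|
          .seq (sto 8 (.var 3) (.lit 0) (.var 10)) <|
          .seq (asg 3 (.bin .add (.var 3) (.lit 1))) (asg 6 (.bin .add (.var 6) (.lit 1))))
      (sto 8 (.var 5) (.lit 0) (.var 6))

variable {c : Layout} {A : St}

/-- The pointer of the current set decreases, and `x ∈ S` is expressed through this set and the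
parity of the toggles made so far. -/
lemma chase_spec {V S : Finset ℕ} {rec : List (ℕ × ℕ)} {s x : ℕ}
    (hrec : Has (fun a => A.mem 8 a 0) (s + 4) (rec.flatMap fun r => [r.1, r.2]))
    (hL : s + 4 + 2 * rec.length < c.L) (hp : Points V rec (A.reg 8) S) (h1 : A.reg 1 = s)
    (h9 : A.reg 9 = 0) (h10 : A.reg 10 = x) (hx : x ∈ V) :
    wp c chase A fun B => (x ∈ S ↔ B.reg 8 ≠ B.reg 9) ∧
      (∀ r, r ≠ 8 → r ≠ 9 → B.reg r = A.reg r) ∧ B.mem = A.mem := by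
  have hfit := c.fits
  have htwo := c.two_pow
  have hone := c.one_lt_two_pow
  refine wp_loop (n := A.reg 8) (fun n B => n = B.reg 8 ∧ ∃ S', Points V rec (B.reg 8) S' ∧
    B.reg 9 ≤ 1 ∧ (x ∈ S ↔ ¬ (x ∈ S' ↔ B.reg 9 = 1)) ∧
    (∀ r, r ≠ 8 → r ≠ 9 → B.reg r = A.reg r) ∧ B.mem = A.mem) ?_ ?_ ?_ ?_
  · rintro n B -
    simp
  · rintro n B ⟨rfl, S', hp', h9', hS', hr, hm⟩ hh
    simp only [Cnd.Holds, Ex.ev] at hh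
    generalize hq : B.reg 8 = q at hp' hh
    cases hp' with
    | empty => omega
    | full => omega
    | @toggle k y q' S' hk hq' hp' =>
      have hklt := (List.getElem?_eq_some_iff.1 hk).1
      obtain ⟨m1, m2⟩ := hrec.record hk
      have e1 : B.reg 1 = s := by rw [hr 1 (by omega) (by omega), h1]
      have e10 : B.reg 10 = x := by rw [hr 10 (by omega) (by omega), h10]
      have ad : s + 2 * (k + 2) = s + 4 + 2 * k := by ring
      rw [← hm] at m1 m2
      have fin : ∀ B₁ : St, (∀ r, r ≠ 9 → B₁.reg r = B.reg r) → B₁.mem = B.mem → B₁.reg 9 ≤ 1 →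
          (x ∈ S ↔ ¬ (x ∈ S' ↔ B₁.reg 9 = 1)) →
          wp c (asg 8 (.ld 8 (.bin .add (.bin .add (.var 1) (.bin .mul (.lit 2) (.var 8))) (.lit 1))
            (.lit 0))) B₁ fun B' => ∃ m < k + 2, m = B'.reg 8 ∧ ∃ S',
              Points V rec (B'.reg 8) S' ∧ B'.reg 9 ≤ 1 ∧ (x ∈ S ↔ ¬ (x ∈ S' ↔ B'.reg 9 = 1)) ∧
              (∀ r, r ≠ 8 → r ≠ 9 → B'.reg r = A.reg r) ∧ B'.mem = A.mem := by
        intro B₁ hB₁ hm₁ hb hbS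
        have q1 : B₁.reg 8 = k + 2 := by rw [hB₁ 8 (by norm_num), hq]
        have q2 : B₁.reg 1 = s := by rw [hB₁ 1 (by norm_num), e1]
        refine wp_asg ?_ (by norm_num) ⟨q', hq', ?_, S', ?_, ?_, ?_, ?_, ?_⟩
        · simp [q1, q2]; omega
        · simp [q1, q2, ad, m2, hm₁]
        · simpa [q1, q2, ad, m2, hm₁] using hp'
        · simpa using hb
        · simpa using hbS
        · intro r hr8 hr9
          simp [hr8, hB₁ r hr9, hr r hr8 hr9]
        · simp [hm, hm₁]
      have hb2 : B.reg 9 = 0 ∨ B.reg 9 = 1 := by omega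
      refine wp_seq (wp_cond ?_ ?_ ?_)
      · simp [hq, e1]; omega
      · intro hxy
        simp only [Cnd.Holds, Ex.ev, BinOp.nat, St.tick_reg, St.tick_mem, hq, e1, e10, ad,
          m1] at hxy
        subst hxy
        refine wp_asg ?_ (by norm_num) (fin _ ?_ ?_ ?_ ?_)
        · simp; omega
        · intro r hr9; simp [hr9]
        · simp
        · rcases hb2 with h | h <;> simp [h]
        · rw [hS']
          simp only [Finset.mem_symmDiff, Finset.mem_singleton]
          rcases hb2 with h | h <;> simp [h]
      · intro hxy
        simp only [Cnd.Holds, Ex.ev, BinOp.nat, St.tick_reg, St.tick_mem, hq, e1, e10, ad,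
          m1] at hxy
        refine wp_skip (fin _ (fun r _ => by simp) (by simp) (by simpa using h9') ?_)
        rw [hS']
        have : x ≠ y := fun h => hxy h.symm
        simp [Finset.mem_symmDiff, this]
  · rintro n B ⟨rfl, S', hp', h9', hS', hr, hm⟩ hh
    simp only [Cnd.Holds, Ex.ev] at hh
    refine ⟨?_, by simpa using hr, by simpa using hm⟩
    rw [hS']
    simp only [St.tick_reg]
    generalize B.reg 8 = q at hp' hh
    cases hp' with
    | empty => simp; omega
    | full => simp [hx]; omega
    | toggle => omega
  · exact ⟨rfl, S, hp, by omega, by simp [h9], fun _ _ _ => rfl, rfl⟩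

end WordRAM

namespace WordRAM

open Symdiff

/-- The raw region of the memory. -/
def St.raw (A : St) (a : ℕ) : ℕ := A.mem 8 a 0

@[simp] lemma St.raw_setReg (A : St) (x v : ℕ) : (A.setReg x v).raw = A.raw := rfl

@[simp] lemma St.raw_tick (A : St) (n : ℕ) : (A.tick n).raw = A.raw := rfl

@[simp] lemma St.raw_setMem (A : St) (a v : ℕ) :
    (A.setMem 8 a 0 v).raw = Function.update A.raw a v := by
  ext i
  by_cases h : i = a
  · subst h; simp [St.raw]
  · simp [St.raw, h]

/-- The elements of a set of integers from `1` on, up to `k`, in increasing order. -/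
def listUpTo (S : Finset ℕ) (k : ℕ) : List ℕ := ((List.range k).map (· + 1)).filter (· ∈ S)

lemma listUpTo_succ (S : Finset ℕ) (k : ℕ) :
    listUpTo S (k + 1) = listUpTo S k ++ if k + 1 ∈ S then [k + 1] else [] := by
  simp only [listUpTo, List.range_succ, List.map_append, List.filter_append, List.map_cons,
    List.map_nil]
  by_cases h : k + 1 ∈ S <;> simp [h]

lemma length_listUpTo_le (S : Finset ℕ) (k : ℕ) : (listUpTo S k).length ≤ k :=
  (List.length_filter_le _ _).trans (by simp)

lemma nodup_listUpTo (S : Finset ℕ) (k : ℕ) : (listUpTo S k).Nodup :=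
  (List.Nodup.map (fun _ _ h => Nat.succ_injective h) List.nodup_range).filter _

lemma toFinset_listUpTo {S : Finset ℕ} {u : ℕ} (hS : S ⊆ Finset.Icc 1 u) :
    (listUpTo S u).toFinset = S := by
  ext x
  simp only [listUpTo, List.mem_toFinset, List.mem_filter, List.mem_map, List.mem_range,
    decide_eq_true_eq, and_iff_right_iff_imp]
  intro hx
  have := Finset.mem_Icc.1 (hS hx)
  exact ⟨x - 1, by omega, by omega⟩

/-- The output of the decoder after `i` sets. -/
def written (s u : ℕ) (S : ℕ → Finset ℕ) (i : ℕ) : List ℕ :=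
  s :: (List.range i).flatMap fun j => (listUpTo (S j) u).length :: listUpTo (S j) u

lemma written_succ (s u : ℕ) (S : ℕ → Finset ℕ) (i : ℕ) :
    written s u S (i + 1) =
      written s u S i ++ ((listUpTo (S i) u).length :: listUpTo (S i) u) := by
  simp [written, List.range_succ]

lemma length_written_le (s u : ℕ) (S : ℕ → Finset ℕ) (i : ℕ) :
    (written s u S i).length ≤ 1 + i * (u + 1) := by
  induction i with
  | zero => simp [written]
  | succ i ih =>
    rw [written_succ, List.length_append, List.length_cons, Nat.succ_mul]
    have := length_listUpTo_le (S i) u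
    omega

variable {c : Layout} {A : St}

/-- The inner loop of the decoder writes the elements of the set number `i`. -/
lemma decoder_row_spec {s u o a i : ℕ} {heads : List ℕ} {rec : List (ℕ × ℕ)} {S : Finset ℕ}
    {pre : List ℕ}
    (hi : i < heads.length) (hs : heads.length = s) (hS : Points (Finset.Icc 1 u) rec heads[i] S)
    (ho : 4 + heads.length + 2 * rec.length ≤ o) (hL : a + u + 2 ≤ c.L) (ha : a = o + pre.length)
    (hA : A.reg 0 = o ∧ A.reg 1 = s ∧ A.reg 2 = u ∧ A.reg 3 = a + 1 ∧ A.reg 4 = i ∧ A.reg 5 = a ∧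
      A.reg 6 = 0 ∧ Has A.raw 0 (compressed s u heads rec) ∧ Has A.raw o pre) :
    wp c
      (forTo 7 2 <|
        .seq (asg 10 (.bin .add (.var 7) (.lit 1))) <|
        .seq (asg 8 (.ld 8 (.bin .add (.var 4) (.lit 4)) (.lit 0))) <| .seq (asg 9 (.lit 0)) <|
        .seq chase <|
        cond (.eq (.var 8) (.var 9)) .skip <|
          .seq (sto 8 (.var 3) (.lit 0) (.var 10)) <|
          .seq (asg 3 (.bin .add (.var 3) (.lit 1))) (asg 6 (.bin .add (.var 6) (.lit 1)))) A
      fun B => B.reg 0 = o ∧ B.reg 1 = s ∧ B.reg 2 = u ∧ B.reg 4 = i ∧ B.reg 5 = a ∧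
        B.reg 3 = a + 1 + (listUpTo S u).length ∧ B.reg 6 = (listUpTo S u).length ∧
        Has B.raw 0 (compressed s u heads rec) ∧ Has B.raw o pre ∧
        Has B.raw (a + 1) (listUpTo S u) := by
  have hfit := c.fits
  have htwo := c.two_pow
  obtain ⟨hA0, hA1, hA2, hA3, hA4, hA5, hA6, hA7, hA8⟩ := hA
  have hlen := length_compressed s u heads rec
  refine wp_forTo u (fun k B => B.reg 0 = o ∧ B.reg 1 = s ∧ B.reg 4 = i ∧ B.reg 5 = a ∧
    B.reg 3 = a + 1 + (listUpTo S k).length ∧ B.reg 6 = (listUpTo S k).length ∧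
    Has B.raw 0 (compressed s u heads rec) ∧ Has B.raw o pre ∧
    Has B.raw (a + 1) (listUpTo S k)) (by norm_num) (by norm_num) (by norm_num) hA2 ?_ ?_ ?_
  · simp [hA0, hA1, hA3, hA4, hA5, hA6, hA7, hA8, listUpTo]
  · rintro k hk B ⟨h0, h1, h4, h5, h3, h6, hR, hpre, hpart⟩ h7 h2
    have hkl := length_listUpTo_le S k
    -- the pointer and the records in memory
    have hparts := hR
    rw [compressed, has_append, has_append] at hparts
    obtain ⟨⟨-, hheads⟩, hrecs⟩ := hparts
    have hhead : B.mem 8 (i + 4) 0 = heads[i] := by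
      have := hheads i hi
      rw [add_comm i 4]
      simpa [St.raw] using this
    have hrecs' : Has (fun a => B.mem 8 a 0) (s + 4) (rec.flatMap fun r => [r.1, r.2]) := by
      have : 0 + ([s, u, 4 + heads.length + 2 * rec.length, 0] ++ heads).length = s + 4 := by
        simp [hs, add_comm, add_left_comm]
      rwa [this] at hrecs
    refine wp_seq (wp_asg ?_ (by norm_num) ?_)
    · simp [h7]; omega
    refine wp_seq (wp_asg ?_ (by norm_num) ?_)
    · simp [h4]; omega
    refine wp_seq (wp_asg (by simp) (by norm_num) ?_)
    refine wp_seq (wp_mono (chase_spec (V := Finset.Icc 1 u) (S := S) (rec := rec) (s := s)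
      (x := k + 1) ?_ ?_ ?_ ?_ ?_ ?_ ?_) ?_)
    · simpa using hrecs'
    · omega
    · simpa [h4, hhead] using hS
    · simp [h1]
    · simp
    · simp [h7]
    · rw [Finset.mem_Icc]; omega
    · rintro B' ⟨hx, hr, hm⟩
      have hraw : B'.raw = B.raw := by
        ext j; simp [St.raw, hm]
      have r0 : B'.reg 0 = o := by rw [hr 0 (by norm_num) (by norm_num)]; simp [h0]
      have r1 : B'.reg 1 = s := by rw [hr 1 (by norm_num) (by norm_num)]; simp [h1]
      have r2 : B'.reg 2 = u := by rw [hr 2 (by norm_num) (by norm_num)]; simp [h2]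
      have r3 : B'.reg 3 = a + 1 + (listUpTo S k).length := by
        rw [hr 3 (by norm_num) (by norm_num)]; simp [h3]
      have r4 : B'.reg 4 = i := by rw [hr 4 (by norm_num) (by norm_num)]; simp [h4]
      have r5 : B'.reg 5 = a := by rw [hr 5 (by norm_num) (by norm_num)]; simp [h5]
      have r6 : B'.reg 6 = (listUpTo S k).length := by
        rw [hr 6 (by norm_num) (by norm_num)]; simp [h6]
      have r7 : B'.reg 7 = k := by rw [hr 7 (by norm_num) (by norm_num)]; simp [h7]
      have r10 : B'.reg 10 = k + 1 := by rw [hr 10 (by norm_num) (by norm_num)]; simp [h7]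
      rw [listUpTo_succ]
      refine wp_cond (by simp) ?_ ?_
      · intro he
        have hxS : k + 1 ∉ S := by
          rw [hx]; simpa using he
        refine wp_skip ?_
        simp [hxS, r0, r1, r2, r3, r4, r5, r6, r7, hraw, hR, hpre, hpart]
      · intro he
        have hxS : k + 1 ∈ S := by
          rw [hx]; simpa using he
        refine wp_seq (wp_sto (by simp) (by simp) (by simp) ?_ ?_)
        · simp [r3]; omega
        refine wp_seq (wp_asg ?_ (by norm_num) ?_)
        · simp [r3]; omega
        refine wp_asg ?_ (by norm_num) ?_
        · simp [r6]; omega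
        simp only [hxS, if_true]
        simp [r0, r1, r2, r3, r4, r5, r6, r7, r10, hraw, has_append, has_cons]
        refine ⟨by ring, hR.update ?_, hpre.update ?_, hpart.update ?_⟩
        · intro j hj; omega
        · intro j hj; omega
        · intro j hj; omega
  · rintro B ⟨h0, h1, h4, h5, h3, h6, hR, hpre, hpart⟩ h7 h2
    exact ⟨h0, h1, h2, h4, h5, h3, h6, hR, hpre, hpart⟩

lemma decoder_spec {s u : ℕ} {heads : List ℕ} {rec : List (ℕ × ℕ)} {S : ℕ → Finset ℕ}
    (hs : heads.length = s)
    (hS : ∀ i (h : i < heads.length), Points (Finset.Icc 1 u) rec heads[i] (S i))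
    (hL : 4 + heads.length + 2 * rec.length + 2 + s * (u + 1) ≤ c.L)
    (hA : Has A.raw 0 (compressed s u heads rec)) :
    wp c decoder A fun B => Delivers c B (written s u S s) := by
  have hfit := c.fits
  have htwo := c.two_pow
  have hone := c.one_lt_two_pow
  have hlen := length_compressed s u heads rec
  set o := 4 + heads.length + 2 * rec.length with ho
  have hA' := hA
  rw [compressed, ← ho, List.append_assoc, has_append, has_cons, has_cons, has_cons] at hA'
  obtain ⟨⟨m0, m1, m2, -⟩, -⟩ := hA'
  simp only [St.raw] at m0 m1 m2
  refine wp_seq (wp_asg ?_ (by norm_num) ?_)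
  · simp; omega
  refine wp_seq (wp_asg ?_ (by norm_num) ?_)
  · simp; omega
  refine wp_seq (wp_asg ?_ (by norm_num) ?_)
  · simp; omega
  refine wp_seq (wp_sto (by simp) (by simp) (by simp) ?_ ?_)
  · simp [m2]; omega
  refine wp_seq (wp_asg ?_ (by norm_num) ?_)
  · simp [m2]; omega
  refine wp_forTo s (fun i B => B.reg 0 = o ∧ B.reg 1 = s ∧ B.reg 2 = u ∧
    B.reg 3 = o + (written s u S i).length ∧ Has B.raw 0 (compressed s u heads rec) ∧
    Has B.raw o (written s u S i)) (by norm_num) (by norm_num) (by norm_num) ?_ ?_ ?_ ?_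
  · simp [m0]
  · simp [m0, m1, m2, written, has_cons]
    exact hA.update fun j hj => by omega
  · rintro i hi B ⟨h0, h1, h2, h3, hR, hw⟩ h4 -
    have hwl := length_written_le s u S i
    have hmul : (i + 1) * (u + 1) ≤ s * (u + 1) := Nat.mul_le_mul_right _ hi
    rw [Nat.succ_mul] at hmul
    refine wp_seq (wp_asg (by simp) (by norm_num) ?_)
    refine wp_seq (wp_asg ?_ (by norm_num) ?_)
    · simp [h3]; omega
    refine wp_seq (wp_asg (by simp) (by norm_num) ?_)
    refine wp_seq (wp_mono (decoder_row_spec (S := S i) (i := i) (pre := written s u S i)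
      (a := o + (written s u S i).length) (by omega) hs (hS i _) ho.ge (by omega) rfl ?_) ?_)
    · simp [h0, h1, h2, h3, h4, hR, hw]
    · rintro B' ⟨r0, r1, r2, r4, r5, r3, r6, hR', hpre, hrow⟩
      refine wp_sto (by simp) (by simp) (by simp) ?_ ?_
      · simp [r5]; omega
      · simp [r0, r1, r2, r3, r4, r5, r6, written_succ, has_append, has_cons]
        refine ⟨by ring, hR'.update ?_, hpre.update ?_, hrow.update ?_⟩
        · intro j hj; omega
        · intro j hj; omega
        · intro j hj; omega
  · rintro B ⟨h0, h1, h2, h3, hR, hw⟩ - -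
    have hwl := length_written_le s u S s
    intro j hj
    simp only [St.tick_reg, h0]
    exact ⟨by omega, hw j hj⟩

end WordRAM

namespace Symdiff

open WordRAM

/-- Half of the memory holds all that the programs need. Since `n + s + 2 ≥ 2`, six of the eight
factors yield the constant `64`. -/
lemma WordLengthOK.bounds {w : ℕ} {𝒮 : Finset (Finset ℕ)} (h : WordLengthOK 8 w 𝒮) :
    1 ≤ w ∧ 32 * ((totalSize 𝒮 + 𝒮.card + 2) * (totalSize 𝒮 + 𝒮.card + 2)) ≤ 2 ^ (w - 1) := by
  set X := totalSize 𝒮 + 𝒮.card + 2 with hX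
  have h6 : 2 ^ 6 ≤ X ^ 6 := Nat.pow_le_pow_left (by omega) 6
  have h8 : 64 * (X * X) ≤ 2 ^ w := by
    refine le_trans ?_ h
    rw [← hX, show X ^ 8 = X ^ 6 * (X * X) by ring]
    exact Nat.mul_le_mul_right _ h6
  have hXX : 0 < X * X := Nat.mul_pos (by omega) (by omega)
  cases w with
  | zero => simp at h8; omega
  | succ w => rw [pow_succ] at h8; exact ⟨by omega, by simp only [Nat.add_sub_cancel]; omega⟩

/-- A minimum-weight symdiff graph yields at most `Δ(𝒮)` records, and `s ≤ Δ(𝒮) + 2` pointers. -/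
lemma space_bound : ∃ (D : WordRAM.Program) (c C : ℕ), ∀ L : List (Finset ℕ), L.Nodup →
      ∃ R : List ℕ, R.length ≤ C * (compressibility L.toFinset + 1) ∧
        ∀ w : ℕ, WordLengthOK c w L.toFinset →
          (∀ x ∈ R, x < 2 ^ w) ∧
          ∃ (F : List (List ℕ)) (t : ℕ),
            Lists F (L.map (fun S => S.image (rankIn (ground L.toFinset)))) ∧
            D.Computes w R (encodeFamily F) t := by
  refine ⟨.seq startup decoder, 8, 6, fun L hL => ?_⟩
  set 𝒮 := L.toFinset with h𝒮
  set U := ground 𝒮 with hU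
  obtain ⟨p, hp, hw⟩ := exists_isMinSymdiffGraph 𝒮
  obtain ⟨rec, ptr, hrec, hlen, hptr⟩ :=
    hp.exists_records (injOn_rankIn U) (image_rankIn U)
  have hs : 𝒮.card = L.length := List.toFinset_card_of_nodup hL
  have hcard := hp.card_le
  have hn := compressibility_le_totalSize 𝒮
  have hu : U.card ≤ totalSize 𝒮 := card_ground_le 𝒮
  refine ⟨compressed L.length U.card (L.map ptr) rec, ?_, fun w hwl => ?_⟩
  · rw [length_compressed, List.length_map]
    omega
  obtain ⟨hw1, hX⟩ := hwl.bounds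
  have htwo := (rawLayout w hw1).two_pow
  dsimp only at htwo
  set X := totalSize 𝒮 + 𝒮.card + 2 with hXdef
  have hXX : 2 * X ≤ X * X := Nat.mul_le_mul_right _ (by omega)
  have hsu : L.length * (U.card + 1) ≤ X * X := Nat.mul_le_mul (by omega) (by omega)
  have hR : ∀ x ∈ compressed L.length U.card (L.map ptr) rec, x < 2 ^ w := by
    intro x hx
    simp only [compressed, List.mem_append, List.mem_cons, List.mem_map, List.mem_flatMap,
      List.not_mem_nil, or_false, List.length_map] at hx
    rcases hx with ((rfl | rfl | rfl | rfl) | ⟨S, hS, rfl⟩) | ⟨r, hr, hx⟩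
    · omega
    · omega
    · omega
    · omega
    · have := (hptr S (List.mem_toFinset.2 hS)).lt
      omega
    · have := hrec r hr
      have h1 := Finset.mem_Icc.1 this.1
      rcases hx with rfl | rfl <;> omega
  refine ⟨hR, (List.range L.length).map
    (fun i => listUpTo ((L.getD i ∅).image (rankIn U)) U.card), ?_⟩
  have hsub : ∀ S ∈ L, S.image (rankIn U) ⊆ Finset.Icc 1 U.card := fun S hS => by
    rw [← image_rankIn]
    exact Finset.image_subset_image (subset_ground (List.mem_toFinset.2 hS))
  have hlists : Lists ((List.range L.length).map
      (fun i => listUpTo ((L.getD i ∅).image (rankIn U)) U.card))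
      (L.map fun S => S.image (rankIn U)) := by
    constructor
    · intro l hl
      obtain ⟨i, -, rfl⟩ := List.mem_map.1 hl
      exact nodup_listUpTo _ _
    · refine List.ext_getElem (by simp) fun i h1 h2 => ?_
      have hi : i < L.length := by simpa using h2
      have := toFinset_listUpTo (hsub _ (List.getElem_mem hi))
      simpa [hi] using this
  have henc : encodeFamily ((List.range L.length).map
      (fun i => listUpTo ((L.getD i ∅).image (rankIn U)) U.card)) =
      written L.length U.card (fun i => (L.getD i ∅).image (rankIn U)) L.length := by
    simp [encodeFamily, written, List.flatMap_map]
  have hdec := decoder_spec (c := rawLayout w hw1) (s := L.length) (u := U.card)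
    (A := initSt (compressed L.length U.card (L.map ptr) rec))
    (heads := L.map ptr) (rec := rec) (S := fun i => (L.getD i ∅).image (rankIn U)) (by simp)
    (fun i h => by
      have hi : i < L.length := by simpa using h
      simpa [hi] using hptr L[i] (List.mem_toFinset.2 (List.getElem_mem hi)))
    (by rw [List.length_map]; dsimp only; omega)
    (fun j hj => by simp [St.raw, initSt, hj])
  obtain ⟨t, ht⟩ :=
    computes_of_wp hw1 hR (by rw [length_compressed, List.length_map]; omega) hdec
  exact ⟨t, hlists, henc ▸ ht⟩

end Symdiff

/-! ### Distance rows -/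

namespace Symdiff

/-- Toggling one element in `X` changes the distance to each set `Y` by one. -/
lemma card_symmDiff_toggle {α : Type*} [DecidableEq α] (X Y : Finset α) (e : α) :
    ((e ∈ Y ↔ e ∈ X) → (symmDiff (symmDiff X {e}) Y).card = (symmDiff X Y).card + 1) ∧
    (¬ (e ∈ Y ↔ e ∈ X) → (symmDiff (symmDiff X {e}) Y).card + 1 = (symmDiff X Y).card) := by
  have hcomm : symmDiff (symmDiff X {e}) Y = symmDiff (symmDiff X Y) {e} := by
    rw [symmDiff_right_comm]
  rw [hcomm]
  constructor
  · intro h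
    have he : e ∉ symmDiff X Y := by rw [Finset.mem_symmDiff]; tauto
    have : symmDiff (symmDiff X Y) {e} = insert e (symmDiff X Y) := by
      ext z
      simp only [Finset.mem_symmDiff (a := z) (t := {e}), Finset.mem_insert, Finset.mem_singleton]
      by_cases hz : z = e
      · subst hz; tauto
      · tauto
    rw [this, Finset.card_insert_of_notMem he]
  · intro h
    have he : e ∈ symmDiff X Y := by rw [Finset.mem_symmDiff]; tauto
    have : symmDiff (symmDiff X Y) {e} = (symmDiff X Y).erase e := by
      ext z
      simp only [Finset.mem_symmDiff (a := z) (t := {e}), Finset.mem_erase, Finset.mem_singleton]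
      by_cases hz : z = e
      · subst hz; tauto
      · tauto
    rw [this, Finset.card_erase_add_one he]

end Symdiff

namespace WordRAM

open Symdiff

/-- Row `j` of the tables describes the set with the elements `l`: array `3` holds its size, array
`1` its elements, and array `0` its characteristic function. -/
def RowOK (m : ℕ → ℕ → ℕ → ℕ) (j : ℕ) (l : List ℕ) : Prop :=
  m 3 j 0 = l.length ∧ (∀ (i : ℕ) (h : i < l.length), m 1 j i = l[i]) ∧
    ∀ e, m 0 j e = if e ∈ l then 1 else 0

/-- The tables describe the nodes `0, …, s + 1`. -/
def Tables (s : ℕ) (lst : ℕ → List ℕ) (m : ℕ → ℕ → ℕ → ℕ) : Prop :=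
  ∀ j < s + 2, RowOK m j (lst j)

lemma Tables.congr {s : ℕ} {lst : ℕ → List ℕ} {m m' : ℕ → ℕ → ℕ → ℕ} (h : Tables s lst m)
    (h0 : m' 0 = m 0) (h1 : m' 1 = m 1) (h3 : m' 3 = m 3) : Tables s lst m' := by
  intro j hj
  rw [RowOK, h0, h1, h3]
  exact h j hj

/-- The nodes of the symdiff graphs on `s` sets of integers between `1` and `u`: the sets have the
numbers below `s`, and `s` and `s + 1` are the roots. All indices fit into the arrays. -/
structure Nodes (c : Layout) (s u : ℕ) (lst : ℕ → List ℕ) : Prop where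
  s_lt : s + 1 < c.K
  u_lt : u < c.K
  nodup : ∀ j < s + 2, (lst j).Nodup
  sub : ∀ j < s + 2, (lst j).toFinset ⊆ Finset.Icc 1 u
  empty : lst s = []
  full : (lst (s + 1)).toFinset = Finset.Icc 1 u

/-- Toggles the element in register `10` in the set whose distances are in the row of register `5`.
The bit `t` tells whether this set contains the element. -/
def toggleRow (t : ℕ) : Program :=
  forTo 12 1 <|
    cond (.eq (.ld 0 (.var 12) (.var 10)) (.lit t))
      (sto 2 (.var 5) (.var 12) (.bin .add (.ld 2 (.var 5) (.var 12)) (.lit 1)))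
      (sto 2 (.var 5) (.var 12) (.bin .sub (.ld 2 (.var 5) (.var 12)) (.lit 1)))

/-- Toggles all elements that the node in register `a` has and the node in register `b` has not. -/
def toggle (a b t : ℕ) : Program :=
  .seq (asg 9 (.ld 3 (.var a) (.lit 0))) <|
  forTo 8 9 <|
    .seq (asg 10 (.ld 1 (.var a) (.var 8))) <|
    cond (.eq (.ld 0 (.var b) (.var 10)) (.lit 0)) (toggleRow t) .skip

variable {c : Layout} {A : St} {s u : ℕ} {lst : ℕ → List ℕ}

/-- The program changed registers from `m` on, and of the memory only row `v` of array `2`. -/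
structure OnlyRow (m v : ℕ) (A B : St) : Prop where
  reg : ∀ r < m, B.reg r = A.reg r
  mem : ∀ k, k ≠ 2 → B.mem k = A.mem k
  row : ∀ i, i ≠ v → B.mem 2 i = A.mem 2 i

lemma toggleRow_spec (hN : Nodes c s u lst) (hT : Tables s lst A.mem) {v e t : ℕ}
    {X : Finset ℕ} (ht : t ≤ 1) (h1 : A.reg 1 = s) (h5 : A.reg 5 = v) (h10 : A.reg 10 = e)
    (hv : v < s) (he : e ≤ u) (hX : X ⊆ Finset.Icc 1 u) (heX : e ∈ X ↔ t = 1)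
    (hd : ∀ y < s, A.mem 2 v y = (symmDiff X (lst y).toFinset).card) :
    wp c (toggleRow t) A fun B => OnlyRow 12 v A B ∧ B.clk ≤ A.clk + 60 * s + 10 ∧
      ∀ y < s, B.mem 2 v y = (symmDiff (symmDiff X {e}) (lst y).toFinset).card := by
  have hfit := c.fits
  have htwo := c.two_pow
  have hone := c.one_lt_two_pow
  have hK := Nat.le_mul_self c.K
  have hs := hN.s_lt
  have hu := hN.u_lt
  refine wp_forTo s (fun k B => OnlyRow 12 v A B ∧ B.clk ≤ A.clk + 60 * k + 2 ∧
    (∀ y < k, B.mem 2 v y = (symmDiff (symmDiff X {e}) (lst y).toFinset).card) ∧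
    ∀ y < s, k ≤ y → B.mem 2 v y = (symmDiff X (lst y).toFinset).card)
    (by norm_num) (by norm_num) (by norm_num) h1 ?_ ?_ ?_
  · refine ⟨⟨fun r hr => ?_, fun _ _ => rfl, fun _ _ => rfl⟩, by simp, by simp,
      fun y hy _ => hd y hy⟩
    simp [(show r ≠ 12 by omega)]
  · rintro k hk B ⟨hB, hclk, hlo, hhi⟩ h12 h1'
    have b5 : B.reg 5 = v := by rw [hB.reg 5 (by norm_num), h5]
    have b10 : B.reg 10 = e := by rw [hB.reg 10 (by norm_num), h10]
    have hrow := (hT k (by omega)).2.2 e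
    have hmem : B.mem 0 k e = if e ∈ lst k then 1 else 0 := by rw [hB.mem 0 (by norm_num), hrow]
    have hdk := hhi k hk le_rfl
    have hle : (symmDiff X (lst k).toFinset).card ≤ u := by
      have : symmDiff X (lst k).toFinset ⊆ Finset.Icc 1 u := by
        intro z hz
        rcases Finset.mem_symmDiff.1 hz with hz | hz
        · exact hX hz.1
        · exact hN.sub k (by omega) hz.1
      simpa using Finset.card_le_card this
    have htog := card_symmDiff_toggle X (lst k).toFinset e
    rw [List.mem_toFinset] at htog
    -- both branches store the new distance
    have fin : ∀ (x : Ex) (B₁ : St), B₁.reg = B.reg → B₁.mem = B.mem → B₁.clk ≤ B.clk + 20 →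
        x.Safe c B₁ → x.cost ≤ 12 →
        x.ev B₁ = (symmDiff (symmDiff X {e}) (lst k).toFinset).card →
        wp c (sto 2 (.var 5) (.var 12) x) B₁ fun B' => B'.reg 12 = k ∧ B'.reg 1 = s ∧
          OnlyRow 12 v A ((B'.setReg 12 (k + 1)).tick 4) ∧
          ((B'.setReg 12 (k + 1)).tick 4).clk ≤ A.clk + 60 * (k + 1) + 2 ∧
          (∀ y < k + 1, ((B'.setReg 12 (k + 1)).tick 4).mem 2 v y =
            (symmDiff (symmDiff X {e}) (lst y).toFinset).card) ∧
          ∀ y < s, k + 1 ≤ y → ((B'.setReg 12 (k + 1)).tick 4).mem 2 v y =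
            (symmDiff X (lst y).toFinset).card := by
      intro x B₁ hr₁ hm₁ hc₁ hx hcost hev
      refine wp_sto (by simp) (by simp) hx ?_ ?_
      · rw [c.valid_array (by norm_num)]; simp [hr₁, b5, h12]; omega
      refine ⟨by simp [hr₁, h12], by simp [hr₁, h1'],
        ⟨fun r hr => ?_, fun i hi => ?_, fun i hi => ?_⟩, ?_, ?_, ?_⟩
      · simp [(show r ≠ 12 by omega), hr₁, hB.reg r hr]
      · simp [hi, hm₁, hB.mem i hi]
      · simp [hi, b5, hr₁, hm₁, hB.row i hi]
      · simp; omega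
      · intro y hy
        by_cases hyk : y = k
        · subst hyk; simp [hr₁, b5, h12, hev]
        · simp [hr₁, hm₁, b5, h12, hyk, hlo y (by omega)]
      · intro y hy hky
        simp [hr₁, hm₁, b5, h12, (show y ≠ k by omega), hhi y hy (by omega)]
    refine wp_cond ?_ ?_ ?_
    · simp [b10, h12, c.valid_array]; omega
    · intro hh
      simp [b10, h12, hmem] at hh
      have : e ∈ lst k ↔ e ∈ X := by
        rw [heX]; by_cases hk : e ∈ lst k <;> simp [hk] at hh ⊢ <;> omega
      refine fin _ _ rfl rfl (by simp) ?_ (by simp) ?_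
      · simp [b5, h12, c.valid_array, hdk]; omega
      · simp [b5, h12, hdk, htog.1 this]
    · intro hh
      simp [b10, h12, hmem] at hh
      have : ¬ (e ∈ lst k ↔ e ∈ X) := by
        rw [heX]; by_cases hk : e ∈ lst k <;> simp [hk] at hh ⊢ <;> omega
      have := htog.2 this
      refine fin _ _ rfl rfl (by simp) ?_ (by simp) ?_
      · simp [b5, h12, c.valid_array]; omega
      · simp only [Ex.ev, BinOp.nat, St.tick_reg, St.tick_mem, b5, h12, hdk]
        exact Nat.sub_eq_of_eq_add this.symm
  · rintro B ⟨hB, hclk, hlo, -⟩ - -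
    exact ⟨⟨hB.reg, hB.mem, hB.row⟩, by simp; omega, hlo⟩

/-- Testing an element of `a` costs constant time, and only those outside `b` cost a pass over all
`s` distances. -/
lemma toggle_spec (hN : Nodes c s u lst) (hT : Tables s lst A.mem) {ra rb v a b t : ℕ}
    {X : Finset ℕ} (hra : ra < 8) (hrb : rb < 8) (ht : t ≤ 1) (h1 : A.reg 1 = s)
    (h5 : A.reg 5 = v) (hv : v < s) (ha : A.reg ra = a) (hb : A.reg rb = b) (has : a < s + 2)
    (hbs : b < s + 2) (hX : X ⊆ Finset.Icc 1 u)
    (htX : ∀ e ∈ (lst a).toFinset \ (lst b).toFinset, (e ∈ X ↔ t = 1))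
    (hd : ∀ y < s, A.mem 2 v y = (symmDiff X (lst y).toFinset).card) :
    wp c (toggle ra rb t) A fun B => OnlyRow 8 v A B ∧
      B.clk ≤ A.clk + 100 + 100 * (lst a).length +
        ((lst a).toFinset \ (lst b).toFinset).card * (100 * (s + 1)) ∧
      ∀ y < s, B.mem 2 v y =
        (symmDiff (symmDiff X ((lst a).toFinset \ (lst b).toFinset)) (lst y).toFinset).card := by
  have hfit := c.fits
  have htwo := c.two_pow
  have hone := c.one_lt_two_pow
  have hK := Nat.le_mul_self c.K
  have hs := hN.s_lt
  have hu := hN.u_lt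
  obtain ⟨hsize, helem, -⟩ := hT a has
  have hmemb := (hT b hbs).2.2
  have hlen : (lst a).length ≤ u := by
    rw [← List.toFinset_card_of_nodup (hN.nodup a has)]
    simpa using Finset.card_le_card (hN.sub a has)
  have hsuba := hN.sub a has
  refine wp_seq (wp_asg ?_ (by norm_num) ?_)
  · simp [ha, c.valid_array]; omega
  -- the elements toggled in the first `k` rounds
  set Z : ℕ → Finset ℕ := fun k => ((lst a).take k).toFinset \ (lst b).toFinset with hZ
  refine wp_forTo (lst a).length (fun k B => OnlyRow 8 v A B ∧ B.reg 9 = (lst a).length ∧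
    B.clk ≤ A.clk + 50 + 100 * k + (Z k).card * (100 * (s + 1)) ∧
    ∀ y < s, B.mem 2 v y = (symmDiff (symmDiff X (Z k)) (lst y).toFinset).card)
    (by norm_num) (by norm_num) (by norm_num) ?_ ?_ ?_ ?_
  · simp [ha, hsize]
  · refine ⟨⟨fun r hr => ?_, fun _ _ => rfl, fun _ _ => rfl⟩, ?_, by simp; omega, fun y hy => ?_⟩
    · simp [(show r ≠ 8 by omega), (show r ≠ 9 by omega)]
    · simp [ha, hsize]
    · simp only [hZ, List.take_zero, List.toFinset_nil, Finset.empty_sdiff]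
      rw [← Finset.bot_eq_empty, symmDiff_bot]
      exact hd y hy
  · rintro k hk B ⟨hB, h9, hclk, hrow⟩ h8 -
    have bra : B.reg ra = a := by rw [hB.reg ra hra, ha]
    have brb : B.reg rb = b := by rw [hB.reg rb hrb, hb]
    have b5 : B.reg 5 = v := by rw [hB.reg 5 (by norm_num), h5]
    have b1 : B.reg 1 = s := by rw [hB.reg 1 (by norm_num), h1]
    have b10 : ra ≠ 10 := by omega
    have b10' : rb ≠ 10 := by omega
    obtain ⟨e, he⟩ : ∃ e, e = (lst a)[k] := ⟨_, rfl⟩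
    have hea : e ∈ lst a := he ▸ List.getElem_mem hk
    have heu := Finset.mem_Icc.1 (hsuba (List.mem_toFinset.2 hea))
    have hBe : B.mem 1 a k = e := by rw [hB.mem 1 (by norm_num), helem k hk, he]
    have htake : ((lst a).take (k + 1)).toFinset = insert e ((lst a).take k).toFinset := by
      rw [List.take_succ_eq_append_getElem hk, List.toFinset_append, ← he]
      ext z
      simp only [Finset.mem_union, Finset.mem_insert, List.mem_toFinset, List.mem_singleton]
      tauto
    have hek : e ∉ (lst a).take k := by
      have := hN.nodup a has
      rw [← List.take_append_drop (k + 1) (lst a), List.nodup_append] at this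
      have h2 := this.1
      rw [List.take_succ_eq_append_getElem hk] at h2
      intro hmem
      exact (List.nodup_append.1 h2).2.2 _ hmem _ (by simp) he
    refine wp_seq (wp_asg ?_ (by norm_num) ?_)
    · simp [bra, h8, c.valid_array]; omega
    refine wp_cond ?_ ?_ ?_
    · simp [bra, brb, b10', h8, hBe, c.valid_array]; omega
    · intro hh
      have heb : e ∉ lst b := by
        simpa [bra, brb, b10', h8, hBe, hB.mem 0, hmemb] using hh
      have hZs : Z (k + 1) = insert e (Z k) := by
        simp only [hZ, htake]
        rw [Finset.insert_sdiff_of_notMem _ (by simpa using heb)]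
      have heZ : e ∉ Z k := by simp [hZ, hek]
      have hsym : symmDiff X (Z (k + 1)) = symmDiff (symmDiff X (Z k)) {e} := by
        rw [hZs, symmDiff_assoc]
        congr 1
        ext z
        simp only [Finset.mem_insert, Finset.mem_symmDiff, Finset.mem_singleton]
        by_cases hz : z = e
        · subst hz; tauto
        · tauto
      have hXe := htX e (by simp [hea, heb])
      refine wp_mono (toggleRow_spec hN (v := v) (e := e) (X := symmDiff X (Z k))
        ?_ ht ?_ ?_ ?_ hv heu.2 ?_ ?_ ?_) ?_
      · exact hT.congr (by simp [hB.mem 0]) (by simp [hB.mem 1]) (by simp [hB.mem 3])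
      · simp [b1]
      · simp [b5]
      · simp [bra, h8, hBe]
      · intro z hz
        rcases Finset.mem_symmDiff.1 hz with hz | hz
        · exact hX hz.1
        · refine hsuba ?_
          simp only [hZ, Finset.mem_sdiff, List.mem_toFinset] at hz ⊢
          exact List.mem_of_mem_take hz.1.1
      · rw [Finset.mem_symmDiff]; tauto
      · intro y hy; simp [hrow y hy]
      · rintro B' ⟨hB', hclk', hrow'⟩
        refine ⟨?_, ?_, ⟨fun r hr => ?_, fun i hi => ?_, fun i hi => ?_⟩, ?_, ?_, ?_⟩
        · rw [hB'.reg 8 (by norm_num)]; simp [h8]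
        · rw [hB'.reg 9 (by norm_num)]; simp [h9]
        · simp [(show r ≠ 8 by omega), (show r ≠ 10 by omega), hB'.reg r (by omega), hB.reg r hr]
        · simp [hB'.mem i hi, hB.mem i hi]
        · simp [hB'.row i hi, hB.row i hi]
        · simp [hB'.reg 9, h9]
        · rw [hZs, Finset.card_insert_of_notMem heZ, add_mul _ 1 (100 * (s + 1)), one_mul]
          simp at hclk' ⊢
          omega
        · intro y hy
          rw [hsym]
          exact hrow' y hy
    · intro hh
      have heb : e ∈ lst b := by
        simpa [bra, brb, b10', h8, hBe, hB.mem 0, hmemb] using hh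
      have hZs : Z (k + 1) = Z k := by
        simp only [hZ, htake]
        rw [Finset.insert_sdiff_of_mem _ (by simpa using heb)]
      refine wp_skip ?_
      refine ⟨by simp [h8], by simp [h9],
        ⟨fun r hr => ?_, fun i hi => ?_, fun i hi => ?_⟩, ?_, ?_, ?_⟩
      · simp [(show r ≠ 8 by omega), (show r ≠ 10 by omega), hB.reg r hr]
      · simp [hB.mem i hi]
      · simp [hB.row i hi]
      · simp [h9]
      · rw [hZs]; simp; omega
      · rw [hZs]; exact hrow
  · rintro B ⟨hB, h9, hclk, hrow⟩ - -
    simp only [hZ, List.take_length] at hclk hrow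
    exact ⟨⟨hB.reg, hB.mem, hB.row⟩, by simp; omega, hrow⟩

end WordRAM

/-! ### Prim's algorithm -/

namespace WordRAM

open Symdiff

/-- The distance between the nodes `i` and `j`. -/
def nodeDist (lst : ℕ → List ℕ) (i j : ℕ) : ℕ :=
  (symmDiff (lst i).toFinset (lst j).toFinset).card

/-- `Reached s T t`: the node `t` is a root or one of the sets in `T`. -/
def Reached (s : ℕ) (T : List ℕ) (t : ℕ) : Prop := t ∈ T ∨ t = s ∨ t = s + 1

/-- The list `T`, read from its end, is the order in which Prim's algorithm reaches the sets; the
node `v` is attached to `par v` by an edge of weight `key v`. -/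
def PrimHist (s : ℕ) (lst : ℕ → List ℕ) (par key : ℕ → ℕ) : List ℕ → Prop
  | [] => True
  | v :: T => PrimHist s lst par key T ∧ v < s ∧ v ∉ T ∧ Reached s T (par v) ∧
      key v = nodeDist lst (par v) v ∧
      ∀ y < s, y ∉ T → ∀ t, Reached s T t → key v ≤ nodeDist lst t y

section

variable {s : ℕ} {lst : ℕ → List ℕ} {par key : ℕ → ℕ} {T : List ℕ}

lemma PrimHist.congr {par' key' : ℕ → ℕ} (h : PrimHist s lst par key T)
    (hp : ∀ v ∈ T, par' v = par v) (hk : ∀ v ∈ T, key' v = key v) :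
    PrimHist s lst par' key' T := by
  induction T with
  | nil => trivial
  | cons v T ih =>
    obtain ⟨h1, h2, h3, h4, h5, h6⟩ := h
    refine ⟨ih h1 (fun w hw => hp w (List.mem_cons_of_mem _ hw))
      (fun w hw => hk w (List.mem_cons_of_mem _ hw)), h2, h3, ?_, ?_, ?_⟩
    · rwa [hp v List.mem_cons_self]
    · rwa [hp v List.mem_cons_self, hk v List.mem_cons_self]
    · rwa [hk v List.mem_cons_self]

lemma PrimHist.lt (h : PrimHist s lst par key T) {v : ℕ} (hv : v ∈ T) : v < s := by
  induction T with
  | nil => simp at hv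
  | cons w T ih =>
    rcases List.mem_cons.1 hv with rfl | hv
    · exact h.2.1
    · exact ih h.1 hv

lemma PrimHist.nodup (h : PrimHist s lst par key T) : T.Nodup := by
  induction T with
  | nil => simp
  | cons w T ih => exact List.nodup_cons.2 ⟨h.2.2.1, ih h.1⟩

lemma PrimHist.reached (h : PrimHist s lst par key T) {v : ℕ} (hv : v ∈ T) :
    Reached s T (par v) := by
  induction T with
  | nil => simp at hv
  | cons w T ih =>
    rcases List.mem_cons.1 hv with rfl | hv
    · exact h.2.2.2.1.imp_left (List.mem_cons_of_mem _)
    · exact (ih h.1 hv).imp_left (List.mem_cons_of_mem _)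

lemma PrimHist.key_eq (h : PrimHist s lst par key T) {v : ℕ} (hv : v ∈ T) :
    key v = nodeDist lst (par v) v := by
  induction T with
  | nil => simp at hv
  | cons w T ih =>
    rcases List.mem_cons.1 hv with rfl | hv
    · exact h.2.2.2.2.1
    · exact ih h.1 hv

/-- Not all sets are reached in fewer than `s` steps. -/
lemma exists_not_mem_of_length_lt (hT : T.length < s) :
    ∃ y < s, y ∉ T := by
  by_contra! hall
  have := (List.nodup_range.subperm fun y hy => hall y (List.mem_range.1 hy)).length_le
  rw [List.length_range] at this
  omega

/-- When the order is complete, it contains all sets. -/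
lemma PrimHist.mem_of_length_eq (h : PrimHist s lst par key T) (hT : T.length = s) {y : ℕ}
    (hy : y < s) : y ∈ T := by
  have hsub : T ⊆ List.range s := fun v hv => List.mem_range.2 (h.lt hv)
  have := (h.nodup.subperm hsub).perm_of_length_le (by rw [List.length_range]; omega)
  exact this.mem_iff.2 (List.mem_range.2 hy)

end

/-- The state of the memory when the sets in `T` are reached: array `2` has the distance rows of the
nodes reached, and arrays `4` and `5` have the distances from the sets to the nodes reached and
the nodes where they are attained. The entry `s` of array `4` exceeds all distances. -/
structure PrimState (c : Layout) (s : ℕ) (lst : ℕ → List ℕ) (T : List ℕ) (m : ℕ → ℕ → ℕ → ℕ) :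
    Prop where
  tables : Tables s lst m
  hist : PrimHist s lst (m 5 · 0) (m 4 · 0) T
  flag : ∀ y < s, m 6 y 0 = if y ∈ T then 1 else 0
  dist : ∀ t, Reached s T t → ∀ y < s, m 2 t y = nodeDist lst t y
  key_eq : ∀ y < s, y ∉ T → m 4 y 0 = nodeDist lst (m 5 y 0) y
  par_reached : ∀ y < s, y ∉ T → Reached s T (m 5 y 0)
  key_le : ∀ y < s, y ∉ T → ∀ t, Reached s T t → m 4 y 0 ≤ nodeDist lst t y
  sentinel : m 4 s 0 = c.K

variable {c : Layout} {A : St} {s u : ℕ} {lst : ℕ → List ℕ} {T : List ℕ}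

lemma Nodes.card_le (hN : Nodes c s u lst) {j : ℕ} (hj : j < s + 2) : (lst j).length ≤ u := by
  rw [← List.toFinset_card_of_nodup (hN.nodup j hj)]
  simpa using Finset.card_le_card (hN.sub j hj)

lemma Nodes.dist_le (hN : Nodes c s u lst) {i j : ℕ} (hi : i < s + 2) (hj : j < s + 2) :
    nodeDist lst i j ≤ u := by
  have : symmDiff (lst i).toFinset (lst j).toFinset ⊆ Finset.Icc 1 u := by
    intro z hz
    rcases Finset.mem_symmDiff.1 hz with hz | hz
    · exact hN.sub i hi hz.1
    · exact hN.sub j hj hz.1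
  rw [nodeDist]
  simpa using Finset.card_le_card this

lemma Reached.lt {par key : ℕ → ℕ} (hT : PrimHist s lst par key T) {t : ℕ} (h : Reached s T t) :
    t < s + 2 := by
  rcases h with h | h | h
  · have := hT.lt h; omega
  · omega
  · omega

/-- The roots are reached at the beginning, with the rows `|S|` and `u - |S|`. -/
def primInit : Program :=
  .seq (asg 11 (.bin .add (.var 1) (.lit 1))) <|
  .seq
    (forTo 4 1 <|
      .seq (asg 5 (.ld 3 (.var 4) (.lit 0))) <|
      .seq (asg 6 (.bin .sub (.var 2) (.var 5))) <|
      .seq (sto 2 (.var 1) (.var 4) (.var 5)) <|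
      .seq (sto 2 (.var 11) (.var 4) (.var 6)) <|
      cond (.lt (.var 6) (.var 5))
        (.seq (sto 4 (.var 4) (.lit 0) (.var 6)) (sto 5 (.var 4) (.lit 0) (.var 11)))
        (.seq (sto 4 (.var 4) (.lit 0) (.var 5)) (sto 5 (.var 4) (.lit 0) (.var 1))))
    (sto 4 (.var 1) (.lit 0) (.var 29))

/-- A set not yet reached with the least key, in register `5`. The search starts at the entry `s`,
whose key exceeds all distances. -/
def scan : Program :=
  .seq (asg 5 (.var 1)) <|
  forTo 6 1 <|
    cond (.eq (.ld 6 (.var 6) (.lit 0)) (.lit 0))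
      (cond (.lt (.ld 4 (.var 6) (.lit 0)) (.ld 4 (.var 5) (.lit 0))) (asg 5 (.var 6)) .skip)
      .skip

/-- The distance row of the set in register `5`: a copy of the row of the node to which it is
attached, in which the elements of the symmetric difference are toggled: those missing there first,
then those to be removed. -/
def newRow : Program :=
  .seq (asg 7 (.ld 5 (.var 5) (.lit 0))) <|
  .seq (forTo 6 1 (sto 2 (.var 5) (.var 6) (.ld 2 (.var 7) (.var 6)))) <|
  .seq (toggle 5 7 0) (toggle 7 5 1)

/-- New keys, after the set in register `5` is reached. -/
def relax : Program :=
  forTo 6 1 <|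
    cond (.eq (.ld 6 (.var 6) (.lit 0)) (.lit 0))
      (cond (.lt (.ld 2 (.var 5) (.var 6)) (.ld 4 (.var 6) (.lit 0)))
        (.seq (sto 4 (.var 6) (.lit 0) (.ld 2 (.var 5) (.var 6)))
          (sto 5 (.var 6) (.lit 0) (.var 5))) .skip)
      .skip

/-- Prim's algorithm; the result is in the arrays `4` and `5`. -/
def prim : Program :=
  .seq primInit <| forTo 4 1 <|
    .seq scan <| .seq (sto 6 (.var 5) (.lit 0) (.lit 1)) <| .seq newRow relax

lemma primInit_spec (hN : Nodes c s u lst) (hT : Tables s lst A.mem) (h1 : A.reg 1 = s)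
    (h2 : A.reg 2 = u) (h29 : A.reg 29 = c.K) (h6 : ∀ y < s, A.mem 6 y 0 = 0) :
    wp c primInit A fun B => PrimState c s lst [] B.mem ∧ B.reg 0 = A.reg 0 ∧ B.reg 1 = s ∧
      B.clk ≤ A.clk + 100 * s + 50 := by
  have hfit := c.fits
  have htwo := c.two_pow
  have hone := c.one_lt_two_pow
  have hK := Nat.le_mul_self c.K
  have hs := hN.s_lt
  have hu := hN.u_lt
  have d0 : ∀ y < s, nodeDist lst s y = (lst y).length := fun y hy => by
    rw [nodeDist, hN.empty, List.toFinset_nil, ← Finset.bot_eq_empty, bot_symmDiff,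
      List.toFinset_card_of_nodup (hN.nodup y (by omega))]
  have d1 : ∀ y < s, nodeDist lst (s + 1) y = u - (lst y).length := fun y hy => by
    have hsub := hN.sub y (by omega)
    rw [nodeDist, hN.full, symmDiff_of_ge hsub, Finset.card_sdiff_of_subset hsub,
      List.toFinset_card_of_nodup (hN.nodup y (by omega))]
    simp
  refine wp_seq (wp_asg ?_ (by norm_num) ?_)
  · simp [h1]; omega
  refine wp_seq (wp_forTo s (fun k B => B.reg 0 = A.reg 0 ∧ B.reg 2 = u ∧ B.reg 11 = s + 1 ∧
    B.reg 29 = c.K ∧ B.mem 0 = A.mem 0 ∧ B.mem 1 = A.mem 1 ∧ B.mem 3 = A.mem 3 ∧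
    B.mem 6 = A.mem 6 ∧ B.clk ≤ A.clk + 100 * k + 20 ∧
    ∀ y < k, B.mem 2 s y = nodeDist lst s y ∧ B.mem 2 (s + 1) y = nodeDist lst (s + 1) y ∧
      ((B.mem 4 y 0 = nodeDist lst s y ∧ B.mem 5 y 0 = s ∧
          nodeDist lst s y ≤ nodeDist lst (s + 1) y) ∨
        (B.mem 4 y 0 = nodeDist lst (s + 1) y ∧ B.mem 5 y 0 = s + 1 ∧
          nodeDist lst (s + 1) y ≤ nodeDist lst s y)))
    (by norm_num) (by norm_num) (by norm_num) ?_ ?_ ?_ ?_)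
  · simp [h1]
  · simp [h1, h2, h29]
  · rintro k hk B ⟨b0, b2, b11, b29, m0, m1, m3, m6, hclk, hrow⟩ b4 b1
    have hsz : B.mem 3 k 0 = (lst k).length := by rw [m3]; exact (hT k (by omega)).1
    have hle := hN.card_le (show k < s + 2 by omega)
    have e0 := d0 k hk
    have e1 := d1 k hk
    refine wp_seq (wp_asg ?_ (by norm_num) ?_)
    · simp [b4, c.valid_array]; omega
    refine wp_seq (wp_asg ?_ (by norm_num) ?_)
    · simp [b4, b2, hsz, hle]
    refine wp_seq (wp_sto (by simp) (by simp) (by simp) ?_ ?_)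
    · rw [c.valid_array (by norm_num)]; simp [b1, b4]; omega
    refine wp_seq (wp_sto (by simp) (by simp) (by simp) ?_ ?_)
    · rw [c.valid_array (by norm_num)]; simp [b11, b4]; omega
    refine wp_cond (by simp) ?_ ?_
    · intro hlt
      simp [b2, b4, hsz] at hlt
      refine wp_seq (wp_sto (by simp) (by simp) (by simp) ?_ ?_)
      · rw [c.valid_array (by norm_num)]; simp [b4]; omega
      refine wp_sto (by simp) (by simp) (by simp) ?_ ?_
      · rw [c.valid_array (by norm_num)]; simp [b4]; omega
      simp [b0, b1, b2, b4, b11, b29, m0, m1, m3, m6, hsz]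
      refine ⟨by omega, fun y hy => ?_⟩
      by_cases hyk : y = k
      · subst hyk
        simp
        refine ⟨by omega, by omega, by omega⟩
      · have := hrow y (by omega)
        simpa [hyk] using this
    · intro hlt
      simp [b2, b4, hsz] at hlt
      refine wp_seq (wp_sto (by simp) (by simp) (by simp) ?_ ?_)
      · rw [c.valid_array (by norm_num)]; simp [b4]; omega
      refine wp_sto (by simp) (by simp) (by simp) ?_ ?_
      · rw [c.valid_array (by norm_num)]; simp [b4]; omega
      simp [b0, b1, b2, b4, b11, b29, m0, m1, m3, m6, hsz]
      refine ⟨by omega, fun y hy => ?_⟩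
      by_cases hyk : y = k
      · subst hyk
        simp
        refine ⟨by omega, by omega, by omega⟩
      · have := hrow y (by omega)
        simpa [hyk] using this
  · rintro B ⟨b0, b2, b11, b29, m0, m1, m3, m6, hclk, hrow⟩ b4 b1
    refine wp_sto (by simp) (by simp) (by simp) ?_ ?_
    · rw [c.valid_array (by norm_num)]; simp [b1]; omega
    refine ⟨⟨?_, trivial, ?_, ?_, ?_, ?_, ?_, ?_⟩, by simp [b0], by simp [b1], by simp; omega⟩
    · exact hT.congr (by simp [m0]) (by simp [m1]) (by simp [m3])
    · intro y hy; simp [m6, h6 y hy]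
    · rintro t (h | rfl | rfl) y hy
      · simp at h
      · simp [(hrow y hy).1]
      · simp [(hrow y hy).2.1]
    · intro y hy _
      have hys : y ≠ s := by omega
      obtain ⟨-, -, ⟨g1, g2, -⟩ | ⟨g1, g2, -⟩⟩ := hrow y hy <;> simp [b1, hys, g1, g2]
    · intro y hy _
      have hys : y ≠ s := by omega
      obtain ⟨-, -, ⟨g1, g2, -⟩ | ⟨g1, g2, -⟩⟩ := hrow y hy <;> simp [Reached, g2]
    · rintro y hy - t ht
      have hys : y ≠ s := by omega
      obtain ⟨-, -, ⟨g1, g2, g3⟩ | ⟨g1, g2, g3⟩⟩ := hrow y hy <;>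
        rcases ht with h | rfl | rfl <;>
        first | exact absurd h List.not_mem_nil | simp [b1, hys, g1, g3]
    · simp [b1, b29]

lemma scan_spec (hN : Nodes c s u lst) (hP : PrimState c s lst T A.mem) (hT : T.length < s)
    (h1 : A.reg 1 = s) :
    wp c scan A fun B => B.mem = A.mem ∧ (∀ r < 5, B.reg r = A.reg r) ∧
      B.clk ≤ A.clk + 60 * s + 10 ∧ ∃ v, B.reg 5 = v ∧ v < s ∧ v ∉ T ∧
        ∀ y < s, y ∉ T → A.mem 4 v 0 ≤ A.mem 4 y 0 := by
  have hfit := c.fits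
  have htwo := c.two_pow
  have hone := c.one_lt_two_pow
  have hK := Nat.le_mul_self c.K
  have hs := hN.s_lt
  have hu := hN.u_lt
  refine wp_seq (wp_asg (by simp) (by norm_num) ?_)
  refine wp_forTo s (fun k B => B.mem = A.mem ∧ (∀ r < 5, B.reg r = A.reg r) ∧
    B.clk ≤ A.clk + 60 * k + 4 ∧ (B.reg 5 = s ∨ B.reg 5 < s ∧ B.reg 5 ∉ T) ∧
    ∀ y < k, y ∉ T → A.mem 4 (B.reg 5) 0 ≤ A.mem 4 y 0)
    (by norm_num) (by norm_num) (by norm_num) ?_ ?_ ?_ ?_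
  · simp [h1]
  · refine ⟨rfl, fun r hr => ?_, by simp, by simp [h1], by simp⟩
    simp [(show r ≠ 5 by omega), (show r ≠ 6 by omega)]
  · rintro k hk B ⟨hm, hr, hclk, h5, hmin⟩ h6 b1
    have hflag := hP.flag k hk
    refine wp_cond ?_ ?_ ?_
    · simp [h6, c.valid_array]; omega
    · intro hh
      have hkT : k ∉ T := by simpa [h6, hm, hflag] using hh
      refine wp_cond ?_ ?_ ?_
      · simp [h6, c.valid_array]; omega
      · intro hlt
        simp [h6, hm] at hlt
        refine wp_asg (by simp) (by norm_num) ?_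
        refine ⟨by simp [h6], by simp [b1], by simp [hm], fun r hr' => ?_, ?_, ?_, ?_⟩
        · simp [(show r ≠ 5 by omega), (show r ≠ 6 by omega), hr r hr']
        · simp; omega
        · simp [h6, hk, hkT]
        · intro y hy hyT
          simp [h6]
          by_cases hyk : y = k
          · rw [hyk]
          · have := hmin y (by omega) hyT; omega
      · intro hlt
        simp [h6, hm] at hlt
        refine wp_skip ?_
        refine ⟨by simp [h6], by simp [b1], by simp [hm], fun r hr' => ?_, ?_,
          by simpa using h5, ?_⟩
        · simp [(show r ≠ 6 by omega), hr r hr']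
        · simp; omega
        · intro y hy hyT
          simp
          by_cases hyk : y = k
          · rw [hyk]; exact hlt
          · exact hmin y (by omega) hyT
    · intro hh
      have hkT : k ∈ T := by simpa [h6, hm, hflag] using hh
      refine wp_skip ?_
      refine ⟨by simp [h6], by simp [b1], by simp [hm], fun r hr' => ?_, ?_, by simpa using h5, ?_⟩
      · simp [(show r ≠ 6 by omega), hr r hr']
      · simp; omega
      · intro y hy hyT
        have hyk : y ≠ k := fun h => hyT (h ▸ hkT)
        simpa using hmin y (by omega) hyT
  · rintro B ⟨hm, hr, hclk, h5, hmin⟩ - b1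
    refine ⟨by simp [hm], by simpa using hr, by simp; omega, B.reg 5, rfl, ?_⟩
    -- the sentinel is not chosen, since some set is not reached
    obtain ⟨y, hy, hyT⟩ := exists_not_mem_of_length_lt hT
    rcases h5 with h5 | h5
    · have h3 := hmin y hy hyT
      rw [h5, hP.sentinel, hP.key_eq y hy hyT] at h3
      have := hN.dist_le ((hP.par_reached y hy hyT).lt hP.hist) (show y < s + 2 by omega)
      omega
    · exact ⟨h5.1, h5.2, hmin⟩

/-- A new distance row costs, besides copying and testing elements, `s` steps for each element of
the symmetric difference, that is, `s` times the weight of the new edge. -/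
lemma newRow_spec (hN : Nodes c s u lst) (hT : Tables s lst A.mem) {v p : ℕ} (h1 : A.reg 1 = s)
    (h5 : A.reg 5 = v) (hv : v < s) (hp : A.mem 5 v 0 = p) (hps : p < s + 2) (hpv : p ≠ v)
    (hd : ∀ y < s, A.mem 2 p y = nodeDist lst p y) :
    wp c newRow A fun B => OnlyRow 6 v A B ∧
      B.clk ≤ A.clk + 300 + 60 * s + 100 * ((lst v).length + (lst p).length) +
        nodeDist lst p v * (100 * (s + 1)) ∧
      ∀ y < s, B.mem 2 v y = nodeDist lst v y := by
  have hfit := c.fits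
  have htwo := c.two_pow
  have hone := c.one_lt_two_pow
  have hK := Nat.le_mul_self c.K
  have hs := hN.s_lt
  have hu := hN.u_lt
  set Nv := (lst v).toFinset with hNv
  set Np := (lst p).toFinset with hNp
  have hcard : nodeDist lst p v = (Np \ Nv).card + (Nv \ Np).card := by
    rw [nodeDist, symmDiff_def, Finset.sup_eq_union,
      Finset.card_union_of_disjoint disjoint_sdiff_sdiff]
  refine wp_seq (wp_asg ?_ (by norm_num) ?_)
  · simp [h5, c.valid_array]; omega
  refine wp_seq (wp_forTo s (fun k B => OnlyRow 6 v A B ∧ B.reg 7 = p ∧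
    B.clk ≤ A.clk + 60 * k + 20 ∧ ∀ y < k, B.mem 2 v y = nodeDist lst p y)
    (by norm_num) (by norm_num) (by norm_num) ?_ ?_ ?_ ?_)
  · simp [h1]
  · refine ⟨⟨fun r hr => ?_, fun _ _ => rfl, fun _ _ => rfl⟩, by simp [h5, hp], by simp, by simp⟩
    simp [(show r ≠ 6 by omega), (show r ≠ 7 by omega)]
  · rintro k hk B ⟨hB, h7, hclk, hrow⟩ h6 b1
    have b5 : B.reg 5 = v := by rw [hB.reg 5 (by norm_num), h5]
    refine wp_sto (by simp) (by simp) ?_ ?_ ?_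
    · simp [h7, h6, c.valid_array]; omega
    · rw [c.valid_array (by norm_num)]; simp [b5, h6]; omega
    refine ⟨by simp [h6], by simp [b1], ⟨fun r hr => ?_, fun i hi => ?_, fun i hi => ?_⟩,
      by simp [h7], ?_, ?_⟩
    · simp [(show r ≠ 6 by omega), hB.reg r hr]
    · simp [hi, hB.mem i hi]
    · simp [b5, hi, hB.row i hi]
    · simp; omega
    · intro y hy
      by_cases hyk : y = k
      · subst hyk; simp [b5, h6, h7, hB.row p hpv, hd y hk]
      · simp [b5, h6, hyk, hrow y (by omega)]
  · rintro B ⟨hB, h7, hclk, hrow⟩ - b1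
    have b5 : B.reg 5 = v := by rw [hB.reg 5 (by norm_num), h5]
    have hTB : Tables s lst B.mem := hT.congr (hB.mem 0 (by norm_num)) (hB.mem 1 (by norm_num))
      (hB.mem 3 (by norm_num))
    refine wp_seq (wp_mono (toggle_spec hN (A := B.tick 3) (ra := 5) (rb := 7) (t := 0) (v := v)
      (a := v) (b := p) (X := Np) hTB (by norm_num)
      (by norm_num) (by norm_num) (by simpa using b1) (by simpa using b5) hv (by simpa using b5)
      (by simpa using h7) (by omega) hps (hN.sub p hps) ?_ ?_) ?_)
    · intro e he
      exact iff_of_false (Finset.mem_sdiff.1 he).2 (by norm_num)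
    · intro y hy; simpa [nodeDist] using hrow y hy
    · rintro C ⟨hC, hCclk, hCrow⟩
      refine wp_mono (toggle_spec hN (ra := 7) (rb := 5) (t := 1) (v := v) (a := p) (b := v)
        (X := symmDiff Np (Nv \ Np)) ?_ (by norm_num)
        (by norm_num) (by norm_num) ?_ ?_ hv ?_ ?_ hps (by omega) ?_ ?_ hCrow) ?_
      · exact hTB.congr (hC.mem 0 (by norm_num)) (hC.mem 1 (by norm_num)) (hC.mem 3 (by norm_num))
      · rw [hC.reg 1 (by norm_num)]; simpa using b1
      · rw [hC.reg 5 (by norm_num)]; simpa using b5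
      · rw [hC.reg 7 (by norm_num)]; simpa using h7
      · rw [hC.reg 5 (by norm_num)]; simpa using b5
      · intro z hz
        rcases Finset.mem_symmDiff.1 hz with hz | hz
        · exact hN.sub p hps hz.1
        · exact hN.sub v (by omega) (Finset.mem_sdiff.1 hz.1).1
      · intro e he
        rw [Finset.mem_sdiff] at he
        simp only [Finset.mem_symmDiff, Finset.mem_sdiff, iff_true]
        left
        exact ⟨he.1, fun h => h.2 he.1⟩
      · rintro D ⟨hD, hDclk, hDrow⟩
        have hX : symmDiff (symmDiff Np (Nv \ Np)) (Np \ Nv) = Nv := by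
          ext z
          simp only [Finset.mem_symmDiff, Finset.mem_sdiff]
          tauto
        refine ⟨⟨fun r hr => ?_, fun i hi => ?_, fun i hi => ?_⟩, ?_, ?_⟩
        · rw [hD.reg r (by omega), hC.reg r (by omega)]; simpa using hB.reg r hr
        · rw [hD.mem i hi, hC.mem i hi]; simpa using hB.mem i hi
        · rw [hD.row i hi, hC.row i hi]; simpa using hB.row i hi
        · rw [hcard, add_mul]
          simp only [St.tick_clk] at hCclk
          rw [← hNv, ← hNp] at hCclk hDclk
          omega
        · intro y hy
          rw [hDrow y hy, hX, nodeDist]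

lemma relax_spec (hN : Nodes c s u lst) {v : ℕ} (hv : v < s) (h1 : A.reg 1 = s)
    (h5 : A.reg 5 = v) (hflag : ∀ y < s, A.mem 6 y 0 = if y ∈ v :: T then 1 else 0)
    (hd : ∀ y < s, A.mem 2 v y = nodeDist lst v y) :
    wp c relax A fun B => (∀ k, k ≠ 4 → k ≠ 5 → B.mem k = A.mem k) ∧
      (∀ r < 6, B.reg r = A.reg r) ∧ B.clk ≤ A.clk + 10 + 120 * s ∧
      (∀ y, B.mem 4 y 0 = if y < s ∧ y ∉ v :: T ∧ nodeDist lst v y < A.mem 4 y 0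
        then nodeDist lst v y else A.mem 4 y 0) ∧
      (∀ y, B.mem 5 y 0 = if y < s ∧ y ∉ v :: T ∧ nodeDist lst v y < A.mem 4 y 0
        then v else A.mem 5 y 0) := by
  have hfit := c.fits
  have htwo := c.two_pow
  have hone := c.one_lt_two_pow
  have hK := Nat.le_mul_self c.K
  have hs := hN.s_lt
  refine wp_forTo s (fun n B => (∀ k, k ≠ 4 → k ≠ 5 → B.mem k = A.mem k) ∧
      (∀ r < 6, B.reg r = A.reg r) ∧ B.clk ≤ A.clk + 2 + 120 * n ∧
      (∀ y, B.mem 4 y 0 = if y < n ∧ y ∉ v :: T ∧ nodeDist lst v y < A.mem 4 y 0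
        then nodeDist lst v y else A.mem 4 y 0) ∧
      (∀ y, B.mem 5 y 0 = if y < n ∧ y ∉ v :: T ∧ nodeDist lst v y < A.mem 4 y 0
        then v else A.mem 5 y 0)) (by norm_num) (by norm_num) (by norm_num) h1 ?_ ?_ ?_
  · refine ⟨fun _ _ _ => rfl, fun r hr => ?_, by simp, by simp, by simp⟩
    simp [(show r ≠ 6 by omega)]
  · rintro n hn B ⟨hm, hr, hclk, hkey, hpar⟩ h6 b1
    have b5 : B.reg 5 = v := by rw [hr 5 (by norm_num), h5]
    have hf := hflag n hn
    have hkn : B.mem 4 n 0 = A.mem 4 n 0 := by simp [hkey n]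
    -- if the key of `n` does not change, the statement for `n + 1` is the one for `n`
    have skip : ¬ (n ∉ v :: T ∧ nodeDist lst v n < A.mem 4 n 0) → ∀ y,
        (y < n + 1 ∧ y ∉ v :: T ∧ nodeDist lst v y < A.mem 4 y 0 ↔
          y < n ∧ y ∉ v :: T ∧ nodeDist lst v y < A.mem 4 y 0) := by
      intro h y
      by_cases hyn : y = n
      · subst hyn; exact ⟨fun g => absurd g.2 h, fun g => absurd g.1 (lt_irrefl _)⟩
      · have : y < n + 1 ↔ y < n := by omega
        rw [this]
    refine wp_cond ?_ ?_ ?_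
    · simp [h6, c.valid_array]; omega
    · intro hh
      have hnT : n ∉ v :: T := by
        intro hc
        simp [h6, hm 6, hf] at hh
        exact (hh.1 <| (List.mem_cons.1 hc).resolve_right hh.2)
      refine wp_cond ?_ ?_ ?_
      · simp [h6, b5, c.valid_array]; omega
      · intro hlt
        simp [h6, b5, hm 2, hd n hn, hkn] at hlt
        refine wp_seq (wp_sto (by simp) (by simp) ?_ ?_ ?_)
        · simp [h6, b5, c.valid_array]; omega
        · rw [c.valid_array (by norm_num)]; simp [h6]; omega
        refine wp_sto (by simp) (by simp) (by simp) ?_ ?_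
        · rw [c.valid_array (by norm_num)]; simp [h6]; omega
        have hiff : ∀ y, y ≠ n → (y < n + 1 ↔ y < n) := fun y hy => by omega
        refine ⟨by simp [h6], by simp [b1], fun k hk4 hk5 => ?_, fun r hr' => ?_, ?_, fun y => ?_,
          fun y => ?_⟩
        · simp [hk4, hk5, hm k hk4 hk5]
        · simp [(show r ≠ 6 by omega), hr r hr']
        · simp; omega
        · by_cases hyn : y = n
          · subst hyn
            rw [if_pos ⟨by omega, hnT, hlt⟩]
            simp [h6, b5, hm 2, hd y hn]
          · simp only [hiff y hyn]
            simpa [h6, hyn] using hkey y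
        · by_cases hyn : y = n
          · subst hyn
            rw [if_pos ⟨by omega, hnT, hlt⟩]
            simp [h6, b5]
          · simp only [hiff y hyn]
            simpa [h6, hyn] using hpar y
      · intro hlt
        simp [h6, b5, hm 2, hd n hn, hkn] at hlt
        have hsk := skip (by omega)
        refine wp_skip ⟨by simp [h6], by simp [b1], by simpa using hm, fun r hr' => ?_, ?_, ?_, ?_⟩
        · simp [(show r ≠ 6 by omega), hr r hr']
        · simp; omega
        · simp only [hsk]; exact hkey
        · simp only [hsk]; exact hpar
    · intro hh
      have hnT : n ∈ v :: T := by
        by_contra hc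
        simp only [Cnd.Holds, Ex.ev, St.tick_mem, St.tick_reg, h6, hm 6 (by norm_num) (by norm_num),
          hf, if_neg hc, not_true_eq_false] at hh
      have hsk := skip (fun h => h.1 hnT)
      refine wp_skip ⟨by simp [h6], by simp [b1], by simpa using hm, fun r hr' => ?_, ?_, ?_, ?_⟩
      · simp [(show r ≠ 6 by omega), hr r hr']
      · simp; omega
      · simp only [hsk]; exact hkey
      · simp only [hsk]; exact hpar
  · rintro B ⟨hm, hr, hclk, hkey, hpar⟩ - -
    exact ⟨hm, hr, by simp; omega, hkey, hpar⟩

end WordRAM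

/-! ### The running time of Prim's algorithm -/

namespace WordRAM

open Symdiff

variable {c : Layout} {A : St} {s u : ℕ} {lst : ℕ → List ℕ} {T : List ℕ}

/-- One more set is reached: the state after a round of Prim's algorithm. -/
lemma PrimState.step {m m₁ : ℕ → ℕ → ℕ → ℕ} {v : ℕ} (hP : PrimState c s lst T m) (hv : v < s)
    (hvT : v ∉ T) (hmin : ∀ y < s, y ∉ T → m 4 v 0 ≤ m 4 y 0)
    (h0 : m₁ 0 = m 0) (h1 : m₁ 1 = m 1) (h3 : m₁ 3 = m 3)
    (h6 : ∀ y < s, m₁ 6 y 0 = if y ∈ v :: T then 1 else 0)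
    (h2 : ∀ i, i ≠ v → m₁ 2 i = m 2 i) (h2v : ∀ y < s, m₁ 2 v y = nodeDist lst v y)
    (h4 : ∀ y, m₁ 4 y 0 = if y < s ∧ y ∉ v :: T ∧ nodeDist lst v y < m 4 y 0
      then nodeDist lst v y else m 4 y 0)
    (h5 : ∀ y, m₁ 5 y 0 = if y < s ∧ y ∉ v :: T ∧ nodeDist lst v y < m 4 y 0
      then v else m 5 y 0) :
    PrimState c s lst (v :: T) m₁ := by
  have old : ∀ w ∈ v :: T, m₁ 4 w 0 = m 4 w 0 ∧ m₁ 5 w 0 = m 5 w 0 := fun w hw => by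
    rw [h4, h5, if_neg fun h => h.2.1 hw, if_neg fun h => h.2.1 hw]
    exact ⟨rfl, rfl⟩
  have hreach : ∀ t, Reached s (v :: T) t ↔ t = v ∨ Reached s T t := fun t => by
    simp only [Reached, List.mem_cons, or_assoc]
  refine ⟨hP.tables.congr h0 h1 h3, ?_, h6, ?_, ?_, ?_, ?_, ?_⟩
  · refine ⟨hP.hist.congr (fun w hw => (old w (List.mem_cons_of_mem _ hw)).2)
      (fun w hw => (old w (List.mem_cons_of_mem _ hw)).1), hv, hvT, ?_, ?_, ?_⟩
    · beta_reduce; rw [(old v List.mem_cons_self).2]; exact hP.par_reached v hv hvT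
    · beta_reduce
      rw [(old v List.mem_cons_self).1, (old v List.mem_cons_self).2]; exact hP.key_eq v hv hvT
    · intro y hy hyT t ht
      beta_reduce
      rw [(old v List.mem_cons_self).1]
      exact (hmin y hy hyT).trans (hP.key_le y hy hyT t ht)
  · intro t ht y hy
    by_cases htv : t = v
    · rw [htv]; exact h2v y hy
    · rw [h2 t htv]
      exact hP.dist t (((hreach t).1 ht).resolve_left htv) y hy
  · intro y hy hyT
    rw [h4, h5]
    split_ifs
    · rfl
    · exact hP.key_eq y hy fun h => hyT (List.mem_cons_of_mem _ h)
  · intro y hy hyT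
    rw [h5, hreach]
    split_ifs
    · exact Or.inl rfl
    · exact Or.inr (hP.par_reached y hy fun h => hyT (List.mem_cons_of_mem _ h))
  · intro y hy hyT t ht
    have hle := hP.key_le y hy fun h => hyT (List.mem_cons_of_mem _ h)
    rw [h4]
    rcases (hreach t).1 ht with rfl | ht
    · split_ifs with hc
      · exact le_rfl
      · have : ¬ nodeDist lst t y < m 4 y 0 := fun h => hc ⟨hy, hyT, h⟩
        omega
    · have := hle t ht
      split_ifs with hc <;> omega
  · rw [h4, if_neg fun h => absurd h.1 (lt_irrefl s)]
    exact hP.sentinel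

/-- A bound for the time spent on the set `v`. -/
def roundCost (s : ℕ) (lst : ℕ → List ℕ) (m : ℕ → ℕ → ℕ → ℕ) (v : ℕ) : ℕ :=
  (lst v).length + (lst (m 5 v 0)).length + (s + 1) * (m 4 v 0 + 1)

lemma prim_spec (hN : Nodes c s u lst) (hT : Tables s lst A.mem) (h1 : A.reg 1 = s)
    (h2 : A.reg 2 = u) (h29 : A.reg 29 = c.K) (h6 : ∀ y < s, A.mem 6 y 0 = 0) :
    wp c prim A fun B => B.reg 0 = A.reg 0 ∧ B.reg 1 = s ∧ ∃ T, T.length = s ∧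
      PrimState c s lst T B.mem ∧
      B.clk ≤ A.clk + 100 * (s + 1) + (T.map fun v => 1000 * roundCost s lst B.mem v).sum := by
  have hs := hN.s_lt
  refine wp_seq (wp_mono (primInit_spec hN hT h1 h2 h29 h6) ?_)
  rintro A₁ ⟨hP, a0, a1, aclk⟩
  refine wp_forTo s (fun i B => B.reg 0 = A.reg 0 ∧ ∃ T, T.length = i ∧
    PrimState c s lst T B.mem ∧
    B.clk ≤ A₁.clk + 2 + (T.map fun v => 1000 * roundCost s lst B.mem v).sum)
    (by norm_num) (by norm_num) (by norm_num) a1 ?_ ?_ ?_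
  · exact ⟨by simpa using a0, [], rfl, by simpa using hP, by simp⟩
  · rintro i hi B ⟨b0, T, hTi, hP, hclk⟩ b4 b1
    refine wp_seq (wp_mono (scan_spec (A := B.tick 3) hN hP (by omega) b1) ?_)
    rintro C ⟨cm, cr, cclk, v, c5, hv, hvT, hmin⟩
    simp only [St.tick_mem, St.tick_reg, St.tick_clk] at cm cr cclk hmin
    refine wp_seq (wp_sto (by simp) (by simp) (by simp) ?_ ?_)
    · rw [c.valid_array (by norm_num)]; simp [c5]; omega
    have hp := hP.par_reached v hv hvT
    have hplt := hp.lt hP.hist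
    have hpv : B.mem 5 v 0 ≠ v := by
      rcases hp with h | h | h
      · exact fun he => hvT (he ▸ h)
      · omega
      · omega
    refine wp_seq (wp_mono (newRow_spec hN (v := v) (p := B.mem 5 v 0) ?_ ?_ ?_ hv ?_ hplt hpv ?_)
      ?_)
    · exact hP.tables.congr (by simp [cm]) (by simp [cm]) (by simp [cm])
    · simp [cr, b1]
    · simp [c5]
    · simp [cm]
    · intro y hy
      simpa [cm] using hP.dist _ hp y hy
    rintro D ⟨hD, dclk, drow⟩
    have d6 : D.mem 6 = Function.update (B.mem 6) v (Function.update (B.mem 6 v) 0 1) := by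
      rw [hD.mem 6 (by norm_num)]; simp [cm, c5]
    have dm : ∀ k, k ≠ 2 → k ≠ 6 → D.mem k = B.mem k := fun k hk hk' => by
      rw [hD.mem k hk]; simp [cm, hk']
    have dflag : ∀ y < s, D.mem 6 y 0 = if y ∈ v :: T then 1 else 0 := by
      intro y hy
      rw [d6]
      by_cases hyv : y = v
      · subst hyv; simp
      · simp [hyv, hP.flag y hy]
    have dr : ∀ r < 5, D.reg r = B.reg r := fun r hr => by
      rw [hD.reg r (by omega)]; simp [cr r hr]
    refine wp_mono (relax_spec (T := T) hN hv ?_ ?_ dflag drow) ?_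
    · rw [dr 1 (by norm_num), b1]
    · rw [hD.reg 5 (by norm_num)]; simp [c5]
    rintro E ⟨em, er, eclk, e4, e5⟩
    rw [dm 4 (by norm_num) (by norm_num)] at e4 e5
    rw [dm 5 (by norm_num) (by norm_num)] at e5
    have hP' : PrimState c s lst (v :: T) E.mem := by
      refine hP.step hv hvT hmin ?_ ?_ ?_ ?_ ?_ ?_ e4 e5
      · rw [em 0 (by norm_num) (by norm_num), dm 0 (by norm_num) (by norm_num)]
      · rw [em 1 (by norm_num) (by norm_num), dm 1 (by norm_num) (by norm_num)]
      · rw [em 3 (by norm_num) (by norm_num), dm 3 (by norm_num) (by norm_num)]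
      · intro y hy; rw [em 6 (by norm_num) (by norm_num), dflag y hy]
      · intro i hi; rw [em 2 (by norm_num) (by norm_num), hD.row i hi]; simp [cm]
      · intro y hy; rw [em 2 (by norm_num) (by norm_num), drow y hy]
    have old : ∀ w ∈ v :: T, roundCost s lst E.mem w = roundCost s lst B.mem w := fun w hw => by
      rw [roundCost, roundCost, e4, e5, if_neg fun h => h.2.1 hw, if_neg fun h => h.2.1 hw]
    refine ⟨?_, ?_, ?_, v :: T, by simp [hTi], hP', ?_⟩
    · rw [er 4 (by norm_num), dr 4 (by norm_num), b4]
    · rw [er 1 (by norm_num), dr 1 (by norm_num), b1]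
    · simp only [St.tick_reg, St.setReg_reg]
      rw [Function.update_of_ne (by norm_num), er 0 (by norm_num), dr 0 (by norm_num), b0]
    · simp only [St.tick_clk, St.setReg_clk, St.tick_mem, St.setReg_mem, List.map_cons,
        List.sum_cons]
      rw [old v List.mem_cons_self, List.map_congr_left (fun w hw => by
        rw [old w (List.mem_cons_of_mem _ hw)] :
        ∀ w ∈ T, 1000 * roundCost s lst E.mem w = 1000 * roundCost s lst B.mem w)]
      have hkey := hP.key_eq v hv hvT
      rw [roundCost, hkey, mul_add (s + 1), mul_one]
      simp at dclk
      have h3 : nodeDist lst (B.mem 5 v 0) v * (100 * (s + 1)) =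
        100 * ((s + 1) * nodeDist lst (B.mem 5 v 0) v) := by ring
      rw [h3] at dclk
      omega
  · rintro B ⟨b0, T, hTi, hP, hclk⟩ - b1
    exact ⟨b0, b1, T, hTi, hP, by simp; omega⟩

end WordRAM

/-! ### Reading the input and renaming the elements -/

/-! In the construction, register `1` holds the number `s` of sets, register `2` the number `u`
of elements found so far, register `3` the index of the next word of the input, and the registers
`28` and `29` the parameters of the layout. -/

namespace WordRAM

open Symdiff

/-- The index in the input at which the list number `i` starts. -/
def startOf (F : List (List ℕ)) (i : ℕ) : ℕ := (encodeFamily (F.take i)).length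

lemma startOf_zero (F : List (List ℕ)) : startOf F 0 = 1 := by simp [startOf, encodeFamily]

lemma startOf_succ {F : List (List ℕ)} {i : ℕ} (hi : i < F.length) :
    startOf F (i + 1) = startOf F i + 1 + F[i].length := by
  rw [startOf, startOf, List.take_succ_eq_append_getElem hi]
  simp only [encodeFamily, List.length_cons, List.flatMap_append, List.length_append,
    List.flatMap_cons, List.flatMap_nil, List.append_nil]
  omega

lemma startOf_length (F : List (List ℕ)) : startOf F F.length = (encodeFamily F).length := by
  rw [startOf, List.take_length]

lemma length_encodeFamily (F : List (List ℕ)) :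
    (encodeFamily F).length = 1 + F.length + F.flatten.length := by
  induction F with
  | nil => simp [encodeFamily]
  | cons l F ih =>
    simp only [encodeFamily, List.length_cons, List.flatMap_cons, List.length_append,
      List.flatten_cons] at ih ⊢
    omega

lemma startOf_add_lt {F : List (List ℕ)} {i : ℕ} (hi : i < F.length) :
    startOf F i + F[i].length < (encodeFamily F).length := by
  have h := startOf_succ hi
  have : startOf F (i + 1) ≤ (encodeFamily F).length := by
    conv_rhs => rw [← List.take_append_drop (i + 1) F]
    simp only [startOf, encodeFamily, List.length_cons, List.flatMap_append, List.length_append]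
    omega
  omega

lemma Has.family {m : ℕ → ℕ} {F : List (List ℕ)} (h : Has m 0 (encodeFamily F)) {i : ℕ}
    (hi : i < F.length) : m (startOf F i) = F[i].length ∧ Has m (startOf F i + 1) F[i] := by
  have hsplit : encodeFamily F = F.length :: ((F.take i).flatMap fun l => l.length :: l) ++
      ((F[i].length :: F[i]) ++ (F.drop (i + 1)).flatMap fun l => l.length :: l) := by
    rw [encodeFamily, List.cons_append]
    congr 1
    conv_lhs => rw [← List.take_append_drop i F, List.drop_eq_getElem_cons hi]
    rw [List.flatMap_append, List.flatMap_cons]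
  rw [hsplit, has_append, has_append] at h
  have := has_cons.1 h.2.1
  simpa [startOf, encodeFamily] using this

/-- Computes the parameters of the layout: the length of the input, and the side of the arrays. -/
def prelim : Program :=
  .seq (asg 1 (.ld 8 (.lit 0) (.lit 0))) <|
  .seq (asg 28 (.lit 1)) <|
  .seq
    (forTo 4 1 <|
      asg 28 (.bin .add (.bin .add (.var 28) (.lit 1)) (.ld 8 (.var 28) (.lit 0))))
    (asg 29 (.bin .add (.var 28) (.lit 1)))

variable {c : Layout} {A : St} {F : List (List ℕ)}

lemma prelim_spec (hA : Has A.raw 0 (encodeFamily F)) (hfit : (encodeFamily F).length < c.L) :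
    wp c prelim A fun B => B.reg 0 = A.reg 0 ∧ B.reg 1 = F.length ∧
      B.reg 28 = (encodeFamily F).length ∧ B.reg 29 = (encodeFamily F).length + 1 ∧
      B.mem = A.mem ∧ B.clk ≤ A.clk + 60 * (F.length + 1) := by
  have hfits := c.fits
  have htwo := c.two_pow
  have hone := c.one_lt_two_pow
  have h0 : A.mem 8 0 0 = F.length := by
    have := hA 0 (by simp [encodeFamily])
    simpa [St.raw, encodeFamily] using this
  refine wp_seq (wp_asg (by simp; omega) (by norm_num) ?_)
  refine wp_seq (wp_asg (by simp) (by norm_num) ?_)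
  refine wp_seq (wp_forTo F.length (fun i B => B.reg 0 = A.reg 0 ∧ B.reg 28 = startOf F i ∧
    B.mem = A.mem ∧ B.clk ≤ A.clk + 30 + 40 * i) (by norm_num) (by norm_num) (by norm_num)
    (by simp [h0]) ?_ ?_ ?_)
  · simp [startOf_zero]
  · rintro i hi B ⟨b0, b28, bm, hclk⟩ b4 b1
    have hlt := startOf_add_lt hi
    have hlen : B.mem 8 (startOf F i) 0 = F[i].length := by rw [bm]; exact (hA.family hi).1
    refine wp_asg ?_ (by norm_num) ?_
    · simp [b28, hlen]; omega
    refine ⟨by simp [b4], by simp [b1], by simp [b0], ?_, by simp [bm], by simp; omega⟩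
    simp [b28, hlen, startOf_succ hi]
  · rintro B ⟨b0, b28, bm, hclk⟩ - b1
    rw [startOf_length] at b28
    refine wp_asg ?_ (by norm_num) ?_
    · simp [b28]; omega
    exact ⟨by simp [b0], by simp [b1], by simp [b28], by simp [b28], by simp [bm], by simp; omega⟩

/-- `ν` numbers the elements of `V` by `1, …, u`. -/
structure Naming (V : Finset ℕ) (u : ℕ) (ν : ℕ → ℕ) : Prop where
  zero : ∀ x ∉ V, ν x = 0
  inj : Set.InjOn ν V
  image : V.image ν = Finset.Icc 1 u

lemma Naming.card {V : Finset ℕ} {u : ℕ} {ν : ℕ → ℕ} (h : Naming V u ν) : V.card = u := by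
  rw [← Finset.card_image_of_injOn h.inj, h.image, Nat.card_Icc, Nat.add_sub_cancel]

lemma Naming.mem {V : Finset ℕ} {u : ℕ} {ν : ℕ → ℕ} (h : Naming V u ν) {x : ℕ} (hx : x ∈ V) :
    1 ≤ ν x ∧ ν x ≤ u := by
  rw [← Finset.mem_Icc, ← h.image]
  exact Finset.mem_image_of_mem _ hx

lemma Naming.le {V : Finset ℕ} {u : ℕ} {ν : ℕ → ℕ} (h : Naming V u ν) (x : ℕ) : ν x ≤ u := by
  by_cases hx : x ∈ V
  · exact (h.mem hx).2
  · rw [h.zero x hx]; exact Nat.zero_le _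

lemma Naming.insert {V : Finset ℕ} {u : ℕ} {ν : ℕ → ℕ} (h : Naming V u ν) {x : ℕ} (hx : x ∉ V) :
    Naming (insert x V) (u + 1) (Function.update ν x (u + 1)) := by
  have hold : ∀ y ∈ V, Function.update ν x (u + 1) y = ν y := fun y hy =>
    Function.update_of_ne (fun he => hx (by rwa [← he])) _ _
  refine ⟨fun y hy => ?_, fun y hy z hz hyz => ?_, ?_⟩
  · rw [Finset.mem_insert, not_or] at hy
    rw [Function.update_of_ne hy.1, h.zero y hy.2]
  · rw [Finset.mem_coe, Finset.mem_insert] at hy hz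
    rcases hy with rfl | hy <;> rcases hz with rfl | hz
    · rfl
    · rw [hold z hz, Function.update_self] at hyz
      have := h.mem hz; omega
    · rw [hold y hy, Function.update_self] at hyz
      have := h.mem hy; omega
    · rw [hold y hy, hold z hz] at hyz
      exact h.inj hy hz hyz
  · rw [Finset.image_insert, Function.update_self, Finset.image_congr (g := ν) hold, h.image]
    ext y
    simp only [Finset.mem_insert, Finset.mem_Icc]
    omega

/-- The state of the memory when the first `i` lists and the beginning `l` of the next one are read.
The high array holds the numbers of the elements, two in a word. -/
structure Parsed (c : Layout) (F : List (List ℕ)) (i : ℕ) (l : List ℕ) (u : ℕ) (ν : ℕ → ℕ)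
    (m : ℕ → ℕ → ℕ → ℕ) : Prop where
  naming : Naming ((F.take i).flatten ++ l).toFinset u ν
  high : ∀ h < 2 ^ (c.w - 1), m 9 h 0 = ν (2 * h) + c.K * ν (2 * h + 1)
  rows : ∀ (j : ℕ) (h : j < F.length), j < i → RowOK m j (F[j].map ν)
  elem : ∀ (k : ℕ) (h : k < l.length), m 1 i k = ν l[k]
  char : ∀ e, m 0 i e = if e ∈ l.map ν then 1 else 0
  size : ∀ j, i ≤ j → m 3 j 0 = 0
  blank : ∀ j, i < j → ∀ e, m 0 j e = 0
  flag : ∀ y, m 6 y 0 = 0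

/-- The list number `i` is complete. -/
lemma Parsed.next {i u : ℕ} {ν : ℕ → ℕ} {m m' : ℕ → ℕ → ℕ → ℕ} (hi : i < F.length)
    (h : Parsed c F i F[i] u ν m) (hm : ∀ k, k ≠ 3 → m' k = m k)
    (h3 : m' 3 = Function.update (m 3) i (Function.update (m 3 i) 0 F[i].length)) :
    Parsed c F (i + 1) [] u ν m' := by
  refine ⟨?_, ?_, ?_, by simp, ?_, ?_, ?_, ?_⟩
  · have := h.naming
    rwa [List.take_succ_eq_append_getElem hi, List.flatten_append, List.flatten_singleton,
      List.append_nil]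
  · rw [hm 9 (by norm_num)]; exact h.high
  · intro j hj hji
    rw [RowOK, hm 0 (by norm_num), hm 1 (by norm_num), h3]
    by_cases he : j = i
    · subst he
      refine ⟨by simp, fun k hk => ?_, h.char⟩
      rw [h.elem k (by simpa using hk)]; simp
    · have := h.rows j hj (by omega)
      rw [RowOK] at this
      simpa [he] using this
  · intro e; rw [hm 0 (by norm_num), h.blank _ (by omega)]; simp
  · intro j hj
    rw [h3]
    simp [(show j ≠ i by omega), h.size j (by omega)]
  · intro j hj; rw [hm 0 (by norm_num)]; exact h.blank j (by omega)
  · rw [hm 6 (by norm_num)]; exact h.flag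

/-- One more element is read, and `ν'` numbers it as well. -/
lemma Parsed.push {i u u' x : ℕ} {l : List ℕ} {ν ν' : ℕ → ℕ} {m m' : ℕ → ℕ → ℕ → ℕ}
    (h : Parsed c F i l u ν m)
    (hν : Naming (insert x ((F.take i).flatten ++ l).toFinset) u' ν')
    (hold : ∀ y ∈ ((F.take i).flatten ++ l).toFinset, ν' y = ν y)
    (h9 : ∀ h < 2 ^ (c.w - 1), m' 9 h 0 = ν' (2 * h) + c.K * ν' (2 * h + 1))
    (h1 : m' 1 = Function.update (m 1) i (Function.update (m 1 i) l.length (ν' x)))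
    (h0 : m' 0 = Function.update (m 0) i (Function.update (m 0 i) (ν' x) 1))
    (h3 : m' 3 = m 3) (h6 : m' 6 = m 6) :
    Parsed c F i (l ++ [x]) u' ν' m' := by
  have hl : l.map ν' = l.map ν := List.map_congr_left fun y hy => hold y (by simp [hy])
  refine ⟨?_, h9, ?_, ?_, ?_, ?_, ?_, ?_⟩
  · have : ((F.take i).flatten ++ (l ++ [x])).toFinset =
        insert x ((F.take i).flatten ++ l).toFinset := by
      ext y
      simp only [List.mem_toFinset, List.mem_append, Finset.mem_insert, List.mem_singleton]
      tauto
    rwa [this]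
  · intro j hj hji
    have hmap : F[j].map ν' = F[j].map ν := List.map_congr_left fun y hy => hold y (by
      rw [List.mem_toFinset, List.mem_append, List.mem_flatten]
      exact Or.inl ⟨F[j], List.mem_take_iff_getElem.2 ⟨j, by omega, rfl⟩, hy⟩)
    have := h.rows j hj hji
    rw [RowOK] at this ⊢
    rw [hmap, h0, h1, h3]
    simpa [(show j ≠ i by omega)] using this
  · intro k hk
    rw [h1]
    by_cases hkl : k = l.length
    · subst hkl; simp
    · rw [List.length_append, List.length_singleton] at hk
      have hk' : k < l.length := by omega
      rw [List.getElem_append_left hk', hold l[k] (by simp)]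
      simpa [hkl] using h.elem k hk'
  · intro e
    rw [h0, List.map_append, hl]
    by_cases he : e = ν' x
    · subst he; simp
    · simpa [he] using h.char e
  · rw [h3]; exact h.size
  · intro j hj e
    rw [h0]
    simpa [(show j ≠ i by omega)] using h.blank j hj e
  · rw [h6]; exact h.flag

/-- Reads one element of the set number `R[4]`, as its element number `R[6]`. The number of an
element `x` is found by direct addressing, in the entry `x / 2` of the high array: as the digit to
the base `K` with index `x % 2`. If it is zero, `x` is new. The elements are arbitrary words, and
the high array, half as long as the memory, has a digit for each of them. -/
def readElem : Program :=
  .seq (asg 7 (.ld 8 (.var 3) (.lit 0))) <|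
  .seq (asg 3 (.bin .add (.var 3) (.lit 1))) <|
  .seq (asg 8 (.bin .add (.lit 1)
    (.bin .mul (.bin .mod (.var 7) (.lit 2)) (.bin .sub (.var 29) (.lit 1))))) <|
  .seq (asg 7 (.bin .div (.var 7) (.lit 2))) <|
  .seq (asg 10 (.bin .mod (.bin .div (.ld 9 (.var 7) (.lit 0)) (.var 8)) (.var 29))) <|
  .seq
    (cond (.eq (.var 10) (.lit 0))
      (.seq (asg 2 (.bin .add (.var 2) (.lit 1))) <|
        .seq (asg 10 (.var 2)) <|
        sto 9 (.var 7) (.lit 0)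
          (.bin .add (.ld 9 (.var 7) (.lit 0)) (.bin .mul (.var 10) (.var 8))))
      .skip) <|
  .seq (sto 1 (.var 4) (.var 6) (.var 10)) (sto 0 (.var 4) (.var 10) (.lit 1))

/-- Reads the sets and renames their elements by `1, …, u`, in the order in which they occur. -/
def parse : Program :=
  .seq (asg 2 (.lit 0)) <|
  .seq (asg 3 (.lit 1)) <|
  forTo 4 1 <|
    .seq (asg 5 (.ld 8 (.var 3) (.lit 0))) <|
    .seq (asg 3 (.bin .add (.var 3) (.lit 1))) <|
    .seq (forTo 6 5 readElem) (sto 3 (.var 4) (.lit 0) (.var 5))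

/-- Two numbers below `K` in one word. -/
lemma unpack {K a b r : ℕ} (ha : a < K) (hb : b < K) (hr : r < 2) :
    (a + K * b) / (1 + r * (K - 1)) % K = if r = 0 then a else b := by
  interval_cases r
  · simp [Nat.mod_eq_of_lt ha]
  · rw [one_mul, Nat.add_sub_cancel' (by omega), Nat.add_mul_div_left _ _ (by omega),
      Nat.div_eq_of_lt ha, zero_add, Nat.mod_eq_of_lt hb]
    simp

/-- What the parser keeps: the input, the registers with the parameters, and the memory state. -/
structure ParseInv (c : Layout) (F : List (List ℕ)) (A : St) (i : ℕ) (l : List ℕ) (B : St) :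
    Prop where
  reg0 : B.reg 0 = A.reg 0
  reg3 : B.reg 3 = startOf F i + 1 + l.length
  reg29 : B.reg 29 = c.K
  raw : B.raw = A.raw
  parsed : ∃ ν, Parsed c F i l (B.reg 2) ν B.mem

lemma readElem_spec {B : St} {i k : ℕ} (hi : i < F.length) (hk : k < F[i].length)
    (hL : (encodeFamily F).length = c.L) (hK : c.K = c.L + 1) (hA : Has A.raw 0 (encodeFamily F))
    (hx : ∀ x ∈ F.flatten, x < 2 ^ c.w) (hB : ParseInv c F A i (F[i].take k) B)
    (h4 : B.reg 4 = i) (h6 : B.reg 6 = k) :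
    wp c readElem B fun B' => ParseInv c F A i (F[i].take (k + 1)) B' ∧ B'.reg 1 = B.reg 1 ∧
      B'.reg 4 = i ∧ B'.reg 5 = B.reg 5 ∧ B'.reg 6 = k ∧ B'.clk ≤ B.clk + 150 := by
  have hfit := c.fits
  have htwo := c.two_pow
  have hone := c.one_lt_two_pow
  have hKK := Nat.le_mul_self c.K
  have hlen := length_encodeFamily F
  have hlt := startOf_add_lt hi
  obtain ⟨b0, b3, b29, braw, ν, hp⟩ := hB
  obtain ⟨x, hxe⟩ : ∃ x, x = F[i][k] := ⟨_, rfl⟩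
  obtain ⟨u, hu⟩ : ∃ u, u = B.reg 2 := ⟨_, rfl⟩
  rw [← hu] at hp
  have hlk : (F[i].take k).length = k := by rw [List.length_take]; omega
  have hil : F[i].length ≤ F.flatten.length := by
    rw [List.length_flatten]
    exact List.le_sum_of_mem (List.mem_map_of_mem (List.getElem_mem hi))
  rw [hlk] at b3
  have hmx : B.mem 8 (startOf F i + 1 + k) 0 = x := by
    have := (hA.family hi).2 k hk
    rw [← braw] at this
    rw [hxe]; exact this
  have hmemx : x ∈ F.flatten := List.mem_flatten.2 ⟨F[i], List.getElem_mem hi, by simp [hxe]⟩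
  have hxw := hx x hmemx
  have hsub : ((F.take i).flatten ++ F[i].take k).toFinset ⊆ F.flatten.toFinset := by
    intro y hy
    rw [List.mem_toFinset, List.mem_append] at hy
    rw [List.mem_toFinset, List.mem_flatten]
    rcases hy with hy | hy
    · obtain ⟨l, hl, hy⟩ := List.mem_flatten.1 hy
      exact ⟨l, List.mem_of_mem_take hl, hy⟩
    · exact ⟨F[i], List.getElem_mem hi, List.mem_of_mem_take hy⟩
  have hnu := hp.naming.card ▸ (Finset.card_le_card hsub).trans (List.toFinset_card_le _)
  have hle := hp.naming.le
  have hhigh := hp.high (x / 2) (by omega)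
  have hmod : x % 2 < 2 := Nat.mod_lt _ (by norm_num)
  have hr8 : x % 2 * (c.K - 1) ≤ c.K - 1 := by
    calc x % 2 * (c.K - 1) ≤ 1 * (c.K - 1) := Nat.mul_le_mul_right _ (by omega)
      _ = c.K - 1 := one_mul _
  have hname : B.mem 9 (x / 2) 0 / (1 + x % 2 * (c.K - 1)) % c.K = ν x := by
    have h1 := hle (2 * (x / 2))
    have h2 := hle (2 * (x / 2) + 1)
    rw [hhigh, unpack (by omega) (by omega) hmod]
    split_ifs with h
    · congr 1; omega
    · congr 1; omega
  -- the last two instructions, once the number of `x` is in register `10`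
  have fin : ∀ (D : St) (u' : ℕ) (ν' : ℕ → ℕ), D.reg 10 = ν' x → D.reg 2 = u' →
      (∀ r, r ≠ 2 → r ≠ 3 → r ≠ 7 → r ≠ 8 → r ≠ 10 → D.reg r = B.reg r) →
      D.reg 3 = startOf F i + 1 + k + 1 → (∀ k, k ≠ 9 → D.mem k = B.mem k) →
      D.clk ≤ B.clk + 100 → u' < c.K →
      Naming (insert x ((F.take i).flatten ++ F[i].take k).toFinset) u' ν' →
      (∀ y ∈ ((F.take i).flatten ++ F[i].take k).toFinset, ν' y = ν y) →
      (∀ h < 2 ^ (c.w - 1), D.mem 9 h 0 = ν' (2 * h) + c.K * ν' (2 * h + 1)) →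
      wp c (.seq (sto 1 (.var 4) (.var 6) (.var 10)) (sto 0 (.var 4) (.var 10) (.lit 1))) D
        fun B' => ParseInv c F A i (F[i].take (k + 1)) B' ∧ B'.reg 1 = B.reg 1 ∧
          B'.reg 4 = i ∧ B'.reg 5 = B.reg 5 ∧ B'.reg 6 = k ∧ B'.clk ≤ B.clk + 150 := by
    intro D u' ν' d10 d2 dr d3 dm dclk hu' hν' hold dhigh
    have d4 : D.reg 4 = i := by rw [dr 4 (by norm_num) (by norm_num) (by norm_num) (by norm_num)
      (by norm_num), h4]
    have d6 : D.reg 6 = k := by rw [dr 6 (by norm_num) (by norm_num) (by norm_num) (by norm_num)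
      (by norm_num), h6]
    have hν'x := hν'.le x
    refine wp_seq (wp_sto (by simp) (by simp) (by simp) ?_ ?_)
    · rw [c.valid_array (by norm_num)]; simp [d4, d6]; omega
    refine wp_sto (by simp) (by simp) (by simp) ?_ ?_
    · rw [c.valid_array (by norm_num)]; simp [d4, d10]; omega
    have htake : F[i].take (k + 1) = F[i].take k ++ [x] := by
      rw [List.take_succ_eq_append_getElem hk, hxe]
    refine ⟨⟨?_, ?_, ?_, ?_, ν', ?_⟩, ?_, ?_, ?_, ?_, ?_⟩
    · simp [dr, b0]
    · simp [d3, htake, hlk]; omega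
    · simp [dr, b29]
    · rw [← braw]; ext a; simp [St.raw, dm]
    · rw [htake]
      simp only [St.tick_reg, St.setMem_reg, d2]
      refine hp.push hν' hold ?_ ?_ ?_ ?_ ?_
      · simpa using dhigh
      · simp [dm, d4, d6, d10, hlk]
      · simp [dm, d4, d10]
      · simp [dm]
      · simp [dm]
    · simp [dr]
    · simp [d4]
    · simp [dr]
    · simp [d6]
    · simp; omega
  refine wp_seq (wp_asg ?_ (by norm_num) ?_)
  · simp [b3]; omega
  refine wp_seq (wp_asg ?_ (by norm_num) ?_)
  · simp [b3]; omega
  refine wp_seq (wp_asg ?_ (by norm_num) ?_)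
  · simp [b3, hmx, b29]; omega
  refine wp_seq (wp_asg ?_ (by norm_num) ?_)
  · simp; omega
  refine wp_seq (wp_asg ?_ (by norm_num) ?_)
  · simp [b3, hmx]; omega
  refine wp_seq (wp_cond ?_ ?_ ?_)
  · simp
  · intro hh
    simp [b3, hmx, b29, hname] at hh
    have hxV : x ∉ ((F.take i).flatten ++ F[i].take k).toFinset := fun h => by
      have := hp.naming.mem h; omega
    have hu1 : u + 1 ≤ F.flatten.length := by
      rw [← hp.naming.card, ← Finset.card_insert_of_notMem hxV]
      refine (Finset.card_le_card (Finset.insert_subset ?_ hsub)).trans (List.toFinset_card_le _)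
      exact List.mem_toFinset.2 hmemx
    have hsum : (u + 1) * (1 + x % 2 * (c.K - 1)) ≤ c.K * c.K :=
      Nat.mul_le_mul (by omega) (by omega)
    have hold9 : B.mem 9 (x / 2) 0 ≤ c.K * c.K + c.K := by
      rw [hhigh]
      have := hle (2 * (x / 2))
      have := Nat.mul_le_mul_left c.K ((hle (2 * (x / 2) + 1)).trans (show u ≤ c.K by omega))
      omega
    refine wp_seq (wp_asg ?_ (by norm_num) ?_)
    · simp [← hu]; omega
    refine wp_seq (wp_asg ?_ (by norm_num) ?_)
    · simp
    refine wp_sto ?_ (by simp) ?_ ?_ ?_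
    · simp
    · simp [b3, hmx, b29, ← hu]; omega
    · simp [b3, hmx]; omega
    refine fin _ (u + 1) (Function.update ν x (u + 1)) ?_ ?_ ?_ ?_ ?_ ?_ (by omega)
      (hp.naming.insert hxV)
      (fun y hy => Function.update_of_ne (fun he : y = x => hxV (he ▸ hy)) _ _) ?_
    · simp [← hu]
    · simp [← hu]
    · intro r hr2 hr3 hr7 hr8 hr10; simp [hr2, hr3, hr7, hr8, hr10]
    · simp [b3]
    · intro k hk; simp [hk]
    · simp
    · intro h hh'
      by_cases hhx : h = x / 2
      · subst hhx
        simp [b3, hmx, b29, ← hu, hhigh]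
        rcases Nat.mod_two_eq_zero_or_one x with h2 | h2
        · have e1 : 2 * (x / 2) = x := by omega
          have e2 : x + 1 ≠ x := by omega
          simp [h2, e1, hh]; omega
        · have e1 : 2 * (x / 2) + 1 = x := by omega
          have e2 : 2 * (x / 2) ≠ x := by omega
          have e3 : 1 + (c.K - 1) = c.K := by omega
          simp [h2, e1, hh, e2, e3]; ring
      · have e1 : 2 * h ≠ x := by omega
        have e2 : 2 * h + 1 ≠ x := by omega
        simp [b3, hmx, hhx, e1, e2, hp.high h hh']
  · intro hh
    simp [b3, hmx, b29, hname] at hh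
    have hxV : x ∈ ((F.take i).flatten ++ F[i].take k).toFinset := by
      by_contra h; exact hh (hp.naming.zero x h)
    refine wp_skip (fin _ u ν ?_ ?_ ?_ ?_ ?_ ?_ (by omega) ?_ (fun _ _ => rfl) ?_)
    · simp [b3, hmx, b29, hname]
    · simp [← hu]
    · intro r hr2 hr3 hr7 hr8 hr10; simp [hr3, hr7, hr8, hr10]
    · simp [b3]
    · intro k hk; simp
    · simp
    · rw [Finset.insert_eq_self.2 hxV]; exact hp.naming
    · simpa using hp.high

lemma parse_spec (hL : (encodeFamily F).length = c.L) (hK : c.K = c.L + 1)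
    (hA : Has A.raw 0 (encodeFamily F)) (hx : ∀ x ∈ F.flatten, x < 2 ^ c.w)
    (h1 : A.reg 1 = F.length) (h29 : A.reg 29 = c.K) (hz : ∀ k, k ≠ 8 → ∀ a b, A.mem k a b = 0) :
    wp c parse A fun B => B.reg 0 = A.reg 0 ∧ B.reg 1 = F.length ∧ B.reg 29 = c.K ∧
      (∃ ν, Parsed c F F.length [] (B.reg 2) ν B.mem) ∧
      B.clk ≤ A.clk + 300 * (encodeFamily F).length := by
  have hfit := c.fits
  have htwo := c.two_pow
  have hone := c.one_lt_two_pow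
  have hKK := Nat.le_mul_self c.K
  have hlen := length_encodeFamily F
  refine wp_seq (wp_asg (by simp) (by norm_num) ?_)
  refine wp_seq (wp_asg (by simp) (by norm_num) ?_)
  refine wp_forTo F.length (fun i B => B.reg 0 = A.reg 0 ∧ B.reg 3 = startOf F i ∧
    B.reg 29 = c.K ∧ B.raw = A.raw ∧ (∃ ν, Parsed c F i [] (B.reg 2) ν B.mem) ∧
    B.clk + 250 ≤ A.clk + 300 * startOf F i) (by norm_num) (by norm_num) (by norm_num)
    (by simp [h1]) ?_ ?_ ?_
  · refine ⟨by simp, by simp [startOf_zero], by simp [h29], by simp, ⟨fun _ => 0, ?_⟩,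
      by simp [startOf_zero]⟩
    refine ⟨⟨by simp, by simp, by simp⟩, ?_, by simp, by simp, ?_, ?_, ?_, ?_⟩ <;> simp [hz]
  · rintro i hi B ⟨b0, b3, b29, braw, ⟨ν, hp⟩, hclk⟩ b4 b1
    have hlt := startOf_add_lt hi
    have hsz : B.mem 8 (startOf F i) 0 = F[i].length := by
      have := (hA.family hi).1
      rwa [← braw] at this
    refine wp_seq (wp_asg ?_ (by norm_num) ?_)
    · simp [b3]; omega
    refine wp_seq (wp_asg ?_ (by norm_num) ?_)
    · simp [b3]; omega
    refine wp_seq (wp_forTo F[i].length (fun k B' => ParseInv c F A i (F[i].take k) B' ∧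
      B'.reg 1 = F.length ∧ B'.reg 4 = i ∧ B'.reg 5 = F[i].length ∧
      B'.clk ≤ B.clk + 50 + 160 * k) (by norm_num) (by norm_num) (by norm_num) ?_ ?_ ?_ ?_)
    · simp [b3, hsz]
    · refine ⟨⟨by simp [b0], by simp [b3], by simp [b29], by simp [braw], ν, by simpa using hp⟩,
        by simp [b1], by simp [b4], by simp [b3, hsz], by simp⟩
    · rintro k hk C ⟨hC, c1, c4, c5, cclk⟩ c6 -
      refine wp_mono (readElem_spec (A := A) (B := C.tick 3) hi hk hL hK hA hx
        ⟨hC.1, hC.2, hC.3, hC.4, hC.5⟩ c4 c6) ?_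
      rintro D ⟨hD, d1, d4, d5, d6, dclk⟩
      refine ⟨d6, d5.trans c5, ⟨?_, ?_, ?_, ?_, ?_⟩, ?_, ?_, ?_, ?_⟩
      · simp [hD.reg0]
      · simp [hD.reg3]
      · simp [hD.reg29]
      · simp [hD.raw]
      · simpa using hD.parsed
      · simp [d1, c1]
      · simp [d4]
      · simp [d5, c5]
      · simp at dclk ⊢; omega
    · rintro C ⟨hC, c1, c4, c5, cclk⟩ - -
      have hR := hC.reg3
      rw [List.take_length] at hC hR
      obtain ⟨ν', hp'⟩ := hC.parsed
      refine wp_sto (by simp) (by simp) (by simp) ?_ ?_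
      · rw [c.valid_array (by norm_num)]; simp [c4]; omega
      refine ⟨by simp [c4], by simp [c1], by simp [hC.reg0], ?_, by simp [hC.reg29], ?_,
        ⟨ν', ?_⟩, ?_⟩
      · simp [hR, startOf_succ hi]
      · rw [← hC.raw]; ext a; simp [St.raw]
      · refine hp'.next hi ?_ ?_
        · intro k hk; simp [hk]
        · simp [c4, c5]
      · rw [startOf_succ hi]; simp at hclk cclk ⊢; omega
  · rintro B ⟨b0, b3, b29, braw, hp, hclk⟩ - b1
    rw [startOf_length] at hclk
    exact ⟨b0, b1, b29, hp, by simp; omega⟩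

end WordRAM

/-! ### The program that builds a minimum-weight symdiff graph -/

namespace WordRAM

open Symdiff

/-- The table rows of the root `𝒰`, which is the node `s + 1`. -/
def fullRow : Program :=
  .seq (asg 11 (.bin .add (.var 1) (.lit 1))) <|
  .seq
    (forTo 4 2 <|
      .seq (asg 5 (.bin .add (.var 4) (.lit 1))) <|
      .seq (sto 1 (.var 11) (.var 4) (.var 5)) (sto 0 (.var 11) (.var 5) (.lit 1)))
    (sto 3 (.var 11) (.lit 0) (.var 2))

/-- Writes the targets and the weights of the edges. -/
def output : Program :=
  forTo 4 1 <|
    .seq (sto 8 (.bin .mul (.lit 2) (.var 4)) (.lit 0) (.ld 5 (.var 4) (.lit 0)))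
      (sto 8 (.bin .add (.bin .mul (.lit 2) (.var 4)) (.lit 1)) (.lit 0)
        (.ld 4 (.var 4) (.lit 0)))

/-- Builds a minimum-weight symdiff graph, once the layout is known. -/
def build : Program := .seq parse (.seq fullRow (.seq prim output))

/-- The renamed elements of the node `j`. -/
def nodeList (F : List (List ℕ)) (ν : ℕ → ℕ) (u j : ℕ) : List ℕ :=
  if j = F.length + 1 then (List.range u).map (· + 1) else (F.getD j []).map ν

variable {c : Layout} {A : St} {F : List (List ℕ)} {ν : ℕ → ℕ} {u s : ℕ}

lemma RowOK.congr {m m' : ℕ → ℕ → ℕ → ℕ} {j : ℕ} {l : List ℕ} (h : RowOK m j l)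
    (h0 : m' 0 j = m 0 j) (h1 : m' 1 j = m 1 j) (h3 : m' 3 j = m 3 j) : RowOK m' j l := by
  rw [RowOK, h0, h1, h3]
  exact h

lemma fullRow_spec (hp : Parsed c F F.length [] u ν A.mem) (h1 : A.reg 1 = F.length)
    (h2 : A.reg 2 = u) (hs : F.length + 1 < c.K) (hu : u < c.K) :
    wp c fullRow A fun B => B.reg 0 = A.reg 0 ∧ B.reg 1 = F.length ∧ B.reg 2 = u ∧
      B.reg 29 = A.reg 29 ∧ (∀ y, B.mem 6 y 0 = 0) ∧ Tables F.length (nodeList F ν u) B.mem ∧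
      B.clk ≤ A.clk + 100 * (u + 1) := by
  have hfit := c.fits
  have htwo := c.two_pow
  have hone := c.one_lt_two_pow
  have hKK := Nat.le_mul_self c.K
  refine wp_seq (wp_asg ?_ (by norm_num) ?_)
  · simp [h1]; omega
  refine wp_seq (wp_forTo u (fun k B => B.reg 0 = A.reg 0 ∧ B.reg 1 = F.length ∧
    B.reg 29 = A.reg 29 ∧ B.reg 11 = F.length + 1 ∧
    (∀ j, j ≠ F.length + 1 → B.mem 0 j = A.mem 0 j ∧ B.mem 1 j = A.mem 1 j) ∧
    B.mem 3 = A.mem 3 ∧ B.mem 6 = A.mem 6 ∧ (∀ i < k, B.mem 1 (F.length + 1) i = i + 1) ∧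
    (∀ e, B.mem 0 (F.length + 1) e = if 1 ≤ e ∧ e ≤ k then 1 else 0) ∧
    B.clk ≤ A.clk + 20 + 60 * k) (by norm_num) (by norm_num) (by norm_num) ?_ ?_ ?_ ?_)
  · simp [h2]
  · refine ⟨by simp, by simp [h1], by simp, by simp [h1], by simp, by simp, by simp, by simp, ?_,
      by simp⟩
    intro e
    rw [if_neg (by omega)]
    simpa using hp.blank (F.length + 1) (by omega) e
  · rintro k hk B ⟨b0, b1, b29, b11, hr, m3, m6, hel, hch, hclk⟩ b4 b2
    refine wp_seq (wp_asg ?_ (by norm_num) ?_)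
    · simp [b4]; omega
    refine wp_seq (wp_sto (by simp) (by simp) (by simp) ?_ ?_)
    · rw [c.valid_array (by norm_num)]; simp [b4, b11]; omega
    refine wp_sto (by simp) (by simp) (by simp) ?_ ?_
    · rw [c.valid_array (by norm_num)]; simp [b4, b11]; omega
    refine ⟨by simp [b4], by simp [b2], by simp [b0], by simp [b1], by simp [b29], by simp [b11],
      ?_, by simp [m3], by simp [m6], ?_, ?_, by simp; omega⟩
    · intro j hj; simp [b11, hj, hr j hj]
    · intro i hi
      by_cases hik : i = k
      · subst hik; simp [b11, b4]
      · simp [b11, b4, hik, hel i (by omega)]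
    · intro e
      by_cases hek : e = k + 1
      · subst hek; simp [b11, b4]
      · have : (1 ≤ e ∧ e ≤ k + 1) ↔ (1 ≤ e ∧ e ≤ k) := by omega
        simp only [this]
        simpa [b11, b4, hek] using hch e
  · rintro B ⟨b0, b1, b29, b11, hr, m3, m6, hel, hch, hclk⟩ - b2
    refine wp_sto (by simp) (by simp) (by simp) ?_ ?_
    · rw [c.valid_array (by norm_num)]; simp [b11]; omega
    refine ⟨by simp [b0], by simp [b1], by simp [b2], by simp [b29], ?_, ?_, by simp; omega⟩
    · intro y; simpa [m6] using hp.flag y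
    · intro j hj
      by_cases hjF : j = F.length + 1
      · subst hjF
        refine ⟨by simp [b11, nodeList, b2], fun i hi => ?_, fun e => ?_⟩
        · have hi' : i < u := by simpa [nodeList] using hi
          simp [hel i hi', nodeList]
        · have : e ∈ nodeList F ν u (F.length + 1) ↔ 1 ≤ e ∧ e ≤ u := by
            simp only [nodeList, if_true, List.mem_map, List.mem_range]
            exact ⟨fun ⟨a, ha, he⟩ => by omega, fun h => ⟨e - 1, by omega, by omega⟩⟩
          simpa [this] using hch e
      · refine RowOK.congr (m := A.mem) ?_ (by simp [hr j hjF]) (by simp [hr j hjF])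
          (by simp [b11, hjF, m3])
        rw [nodeList, if_neg hjF]
        by_cases hjl : j < F.length
        · rw [List.getD_eq_getElem _ _ hjl]; exact hp.rows j hjl hjl
        · have hjs : j = F.length := by omega
          subst hjs
          refine ⟨by simpa using hp.size _ le_rfl, by simp, fun e => by simpa using hp.char e⟩

lemma nodes_nodeList (hp : Naming F.flatten.toFinset u ν) (hF : ∀ l ∈ F, l.Nodup)
    (hs : F.length + 1 < c.K) (hu : u < c.K) : Nodes c F.length u (nodeList F ν u) := by
  have hsub : ∀ j < F.length, F.getD j [] ∈ F := fun j hj => by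
    rw [List.getD_eq_getElem _ _ hj]; exact List.getElem_mem hj
  have hin : ∀ j < F.length, ∀ x ∈ F.getD j [], x ∈ F.flatten.toFinset := fun j hj x hx => by
    rw [List.mem_toFinset, List.mem_flatten]; exact ⟨_, hsub j hj, hx⟩
  have hfull : ((List.range u).map (· + 1)).toFinset = Finset.Icc 1 u := by
    ext e
    simp only [List.mem_toFinset, List.mem_map, List.mem_range, Finset.mem_Icc]
    exact ⟨fun ⟨a, ha, he⟩ => by omega, fun h => ⟨e - 1, by omega, by omega⟩⟩
  refine ⟨hs, hu, fun j hj => ?_, fun j hj => ?_, by simp [nodeList], by simp [nodeList, hfull]⟩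
  · rw [nodeList]
    split_ifs with h
    · exact List.nodup_range.map fun a b hab => Nat.succ_injective hab
    · by_cases hjF : j < F.length
      · exact (hF _ (hsub j hjF)).map_on fun x hx y hy h =>
          hp.inj (hin j hjF x hx) (hin j hjF y hy) h
      · simp [List.getElem?_eq_none (not_lt.1 hjF)]
  · rw [nodeList]
    split_ifs with h
    · exact hfull.subset
    · by_cases hjF : j < F.length
      · intro e he
        obtain ⟨x, hx, rfl⟩ := List.mem_map.1 (List.mem_toFinset.1 he)
        exact Finset.mem_Icc.2 (hp.mem (hin j hjF x hx))
      · simp [List.getElem?_eq_none (not_lt.1 hjF)]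

lemma output_spec (h1 : A.reg 1 = s) (hL : 2 * s ≤ c.L) (hK : s < c.K) :
    wp c output A fun B => B.reg 0 = A.reg 0 ∧
      (∀ j < s, B.mem 8 (2 * j) 0 = A.mem 5 j 0 ∧ B.mem 8 (2 * j + 1) 0 = A.mem 4 j 0) ∧
      B.clk ≤ A.clk + 100 * (s + 1) := by
  have hfit := c.fits
  have htwo := c.two_pow
  have hone := c.one_lt_two_pow
  have hKK := Nat.le_mul_self c.K
  refine wp_forTo s (fun k B => B.reg 0 = A.reg 0 ∧ B.mem 4 = A.mem 4 ∧ B.mem 5 = A.mem 5 ∧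
    (∀ j < k, B.mem 8 (2 * j) 0 = A.mem 5 j 0 ∧ B.mem 8 (2 * j + 1) 0 = A.mem 4 j 0) ∧
    B.clk ≤ A.clk + 10 + 80 * k) (by norm_num) (by norm_num) (by norm_num) h1 ?_ ?_ ?_
  · simp
  · rintro k hk B ⟨b0, m4, m5, hm, hclk⟩ b4 b1
    refine wp_seq (wp_sto ?_ (by simp) ?_ ?_ ?_)
    · simp [b4]; omega
    · simp [b4, c.valid_array]; omega
    · simp [b4]; omega
    refine wp_sto ?_ (by simp) ?_ ?_ ?_
    · simp [b4]; omega
    · simp [b4, c.valid_array]; omega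
    · simp [b4]; omega
    refine ⟨by simp [b4], by simp [b1], by simp [b0], by simp [m4], by simp [m5], ?_,
      by simp; omega⟩
    intro j hj
    by_cases hjk : j = k
    · subst hjk; simp [b4, m4, m5]
    · have e1 : 2 * j ≠ 2 * k + 1 := by omega
      have e2 : 2 * j + 1 ≠ 2 * k := by omega
      simp [b4, hjk, e1, e2, hm j (by omega)]
  · rintro B ⟨b0, m4, m5, hm, hclk⟩ - -
    exact ⟨b0, hm, by simp; omega⟩

lemma build_spec (hL : (encodeFamily F).length = c.L) (hK : c.K = c.L + 1)
    (hA : Has A.raw 0 (encodeFamily F)) (hx : ∀ x ∈ F.flatten, x < 2 ^ c.w)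
    (hF : ∀ l ∈ F, l.Nodup) (hs : F.length ≤ F.flatten.length + 1) (h0 : A.reg 0 = 0)
    (h1 : A.reg 1 = F.length) (h29 : A.reg 29 = c.K)
    (hz : ∀ k, k ≠ 8 → ∀ a b, A.mem k a b = 0) :
    wp c build A fun B => ∃ (u : ℕ) (ν par key : ℕ → ℕ) (T : List ℕ),
      Naming F.flatten.toFinset u ν ∧ T.length = F.length ∧
      PrimHist F.length (nodeList F ν u) par key T ∧
      Delivers c B ((List.range F.length).flatMap fun j => [par j, key j]) ∧
      B.clk ≤ A.clk + 1000 * c.L + (T.map fun v => 1000 * ((nodeList F ν u v).length +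
        (nodeList F ν u (par v)).length + (F.length + 1) * (key v + 1))).sum := by
  have hlen := length_encodeFamily F
  refine wp_seq (wp_mono (parse_spec hL hK hA hx h1 h29 hz) ?_)
  rintro B ⟨b0, b1, b29, ⟨ν, hp⟩, hclk⟩
  have hν : Naming F.flatten.toFinset (B.reg 2) ν := by simpa using hp.naming
  have hu : B.reg 2 ≤ F.flatten.length := hν.card ▸ List.toFinset_card_le _
  have hN := nodes_nodeList (c := c) hν hF (by omega) (by omega)
  refine wp_seq (wp_mono (fullRow_spec hp b1 rfl (by omega) (by omega)) ?_)
  rintro C ⟨c0, c1, c2, c29, c6, hT, cclk⟩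
  refine wp_seq (wp_mono (prim_spec hN hT c1 c2 (by rw [c29, b29]) fun y _ => c6 y) ?_)
  rintro D ⟨d0, d1, T, hTl, hP, dclk⟩
  refine wp_mono (output_spec d1 (by omega) (by omega)) ?_
  rintro E ⟨e0, em, eclk⟩
  refine ⟨B.reg 2, ν, (D.mem 5 · 0), (D.mem 4 · 0), T, hν, hTl, hP.hist, ?_, ?_⟩
  · have hE : E.reg 0 = 0 := by rw [e0, d0, c0, b0, h0]
    have hraw : ∀ k ≤ F.length, Has E.raw 0
        ((List.range k).flatMap fun j => [D.mem 5 j 0, D.mem 4 j 0]) ∧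
        ((List.range k).flatMap fun j => [D.mem 5 j 0, D.mem 4 j 0]).length = 2 * k := by
      intro k hk
      induction k with
      | zero => simp
      | succ k ih =>
        obtain ⟨ih1, ih2⟩ := ih (by omega)
        rw [List.range_succ, List.flatMap_append, List.length_append, ih2]
        refine ⟨has_append.2 ⟨ih1, ?_⟩, by simp; omega⟩
        rw [ih2, zero_add]
        simp only [List.flatMap_cons, List.flatMap_nil, List.append_nil, has_cons, has_nil,
          and_true]
        exact em k (by omega)
    obtain ⟨h1, h2⟩ := hraw _ le_rfl
    intro i hi
    have := h1 i hi
    rw [hE]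
    beta_reduce at hi
    exact ⟨by omega, this⟩
  · simp only [roundCost] at dclk
    beta_reduce
    omega

end WordRAM

/-! ### From the program to symdiff graphs -/

namespace WordRAM

open Symdiff

/-- The node that the integer `j` denotes; it is `∅` for `j > s + 1` as well. -/
def nodeSet (L : List (Finset ℕ)) (j : ℕ) : Finset ℕ :=
  if j = L.length + 1 then ground L.toFinset else L.getD j ∅

lemma nodeSet_of_lt {L : List (Finset ℕ)} {j : ℕ} (hj : j < L.length) : nodeSet L j = L[j] := by
  rw [nodeSet, if_neg (by omega), List.getD_eq_getElem _ _ hj]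

lemma nodeSet_length (L : List (Finset ℕ)) : nodeSet L L.length = ∅ := by
  rw [nodeSet, if_neg (by omega), List.getD_eq_default _ _ le_rfl]

lemma nodeSet_subset (L : List (Finset ℕ)) (j : ℕ) : nodeSet L j ⊆ ground L.toFinset := by
  by_cases hj : j < L.length
  · rw [nodeSet_of_lt hj]
    exact subset_ground (List.mem_toFinset.2 (List.getElem_mem hj))
  · rw [nodeSet]
    split_ifs
    · exact subset_rfl
    · rw [List.getD_eq_default _ _ (by omega)]
      exact Finset.empty_subset _

lemma denotesNode_nodeSet {L : List (Finset ℕ)} {j : ℕ} (hj : j < L.length + 2) :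
    DenotesNode L j (nodeSet L j) := by
  by_cases h : j < L.length
  · left; rw [nodeSet_of_lt h, List.getElem?_eq_getElem h]
  · right
    rcases Nat.eq_or_lt_of_le (not_lt.1 h) with h | h
    · exact Or.inl ⟨h.symm, by rw [← h, nodeSet_length]⟩
    · have : j = L.length + 1 := by omega
      exact Or.inr ⟨this, by rw [nodeSet, if_pos this]⟩

section

variable {L : List (Finset ℕ)} {F : List (List ℕ)}

lemma Lists.length_eq (h : Lists F L) : F.length = L.length := by rw [← h.2, List.length_map]

lemma Lists.toFinset_flatten (h : Lists F L) : F.flatten.toFinset = ground L.toFinset := by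
  ext x
  rw [← h.2]
  simp [ground]

lemma Lists.length_flatten (h : Lists F L) (hL : L.Nodup) :
    F.flatten.length = totalSize L.toFinset := by
  rw [totalSize, List.sum_toFinset _ hL, ← h.2, List.length_flatten, List.map_map]
  congr 1
  exact List.map_congr_left fun l hl => (List.toFinset_card_of_nodup (h.1 l hl)).symm

lemma toFinset_nodeList (h : Lists F L) {ν : ℕ → ℕ} {u : ℕ}
    (hν : Naming (ground L.toFinset) u ν) (j : ℕ) :
    (nodeList F ν u j).toFinset = (nodeSet L j).image ν := by
  rw [nodeList, nodeSet, Lists.length_eq h]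
  split_ifs with hj
  · rw [hν.image]
    ext e
    simp only [List.mem_toFinset, List.mem_map, List.mem_range, Finset.mem_Icc]
    exact ⟨fun ⟨a, ha, he⟩ => by omega, fun h => ⟨e - 1, by omega, by omega⟩⟩
  · rw [← h.2]
    ext e
    by_cases hj : j < F.length <;> simp [hj]

/-- The renaming preserves distances, since it is injective on the ground set. -/
lemma nodeDist_nodeList (h : Lists F L) {ν : ℕ → ℕ} {u : ℕ}
    (hν : Naming (ground L.toFinset) u ν) (i j : ℕ) :
    nodeDist (nodeList F ν u) i j = (symmDiff (nodeSet L i) (nodeSet L j)).card := by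
  have hi := nodeSet_subset L i
  have hj := nodeSet_subset L j
  rw [nodeDist, toFinset_nodeList h hν, toFinset_nodeList h hν,
    ← image_symmDiff_of_injOn hν.inj hi hj, Finset.card_image_of_injOn]
  refine hν.inj.mono fun x hx => ?_
  rcases Finset.mem_symmDiff.1 hx with hx | hx
  · exact hi hx.1
  · exact hj hx.1

variable {lst : ℕ → List ℕ} {par key : ℕ → ℕ} {T : List ℕ}

/-- The graph that the targets `par` describe, as a map on sets. -/
def parentMap (L : List (Finset ℕ)) (par : ℕ → ℕ) (S : Finset ℕ) : Finset ℕ :=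
  nodeSet L (par (L.idxOf S))

lemma parentMap_nodeSet (hL : L.Nodup) {v : ℕ} (hv : v < L.length) :
    parentMap L par (nodeSet L v) = nodeSet L (par v) := by
  rw [parentMap, nodeSet_of_lt hv, hL.idxOf_getElem]

lemma PrimHist.edgeWeight (hL : L.Nodup)
    (hd : ∀ i j, nodeDist lst i j = (symmDiff (nodeSet L i) (nodeSet L j)).card)
    (h : PrimHist L.length lst par key T) {v : ℕ} (hv : v ∈ T) :
    edgeWeight (parentMap L par) (nodeSet L v) = key v := by
  rw [h.key_eq hv, Symdiff.edgeWeight, parentMap_nodeSet hL (h.lt hv), hd, symmDiff_comm]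

lemma PrimHist.isPrimOrder (hL : L.Nodup)
    (hd : ∀ i j, nodeDist lst i j = (symmDiff (nodeSet L i) (nodeSet L j)).card)
    (h : PrimHist L.length lst par key T) :
    IsPrimOrder L.toFinset (parentMap L par) (T.map (nodeSet L)) := by
  have hmem : ∀ v < L.length, nodeSet L v ∈ L.toFinset := fun v hv => by
    rw [nodeSet_of_lt hv]; exact List.mem_toFinset.2 (List.getElem_mem hv)
  have hinj : ∀ v < L.length, ∀ w < L.length, nodeSet L v = nodeSet L w → v = w :=
    fun v hv w hw hvw => by
      rw [nodeSet_of_lt hv, nodeSet_of_lt hw] at hvw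
      exact (hL.getElem_inj_iff).1 hvw
  induction T with
  | nil => trivial
  | cons v T ih =>
    have hvw := h.edgeWeight hL hd (List.mem_cons_self)
    obtain ⟨hT, hv, hvT, hreach, -, hmin⟩ := h
    refine ⟨ih hT, hmem v hv, ?_, ?_, ?_⟩
    · intro hc
      obtain ⟨w, hw, hwv⟩ := List.mem_map.1 hc
      exact hvT (hinj w (hT.lt hw) v hv hwv ▸ hw)
    · rw [parentMap_nodeSet hL hv]
      rcases hreach with hr | hr | hr
      · exact Or.inl (List.mem_map_of_mem hr)
      · right; rw [hr, nodeSet_length]; exact mem_roots.2 (Or.inl rfl)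
      · right; rw [hr, nodeSet, if_pos rfl]; exact mem_roots.2 (Or.inr rfl)
    · intro Y hY hYT t ht
      obtain ⟨y, hy, rfl⟩ := List.getElem_of_mem (List.mem_toFinset.1 hY)
      rw [← nodeSet_of_lt hy] at hYT ⊢
      have hyT : y ∉ T := fun hc => hYT (List.mem_map_of_mem hc)
      rw [hvw]
      rcases ht with ht | ht
      · obtain ⟨i, hi, rfl⟩ := List.mem_map.1 ht
        rw [← hd]; exact hmin y hy hyT i (Or.inl hi)
      · rcases mem_roots.1 ht with rfl | rfl
        · have := hmin y hy hyT L.length (Or.inr (Or.inl rfl))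
          rwa [hd, nodeSet_length] at this
        · have := hmin y hy hyT (L.length + 1) (Or.inr (Or.inr rfl))
          rwa [hd, nodeSet, if_pos rfl] at this

lemma PrimHist.encodesGraph (hL : L.Nodup)
    (hd : ∀ i j, nodeDist lst i j = (symmDiff (nodeSet L i) (nodeSet L j)).card)
    (h : PrimHist L.length lst par key T) (hT : T.length = L.length) :
    EncodesGraph L (parentMap L par) ((List.range L.length).flatMap fun j => [par j, key j]) := by
  refine ⟨(List.range L.length).map par, ?_, ?_⟩
  · rw [List.forall₂_iff_get]
    refine ⟨by simp, fun i h1 h2 => ?_⟩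
    simp only [List.get_eq_getElem, List.getElem_map, List.getElem_range]
    rw [← nodeSet_of_lt h1, parentMap_nodeSet hL h1]
    exact denotesNode_nodeSet ((h.reached (h.mem_of_length_eq hT h1)).lt h)
  · rw [List.flatMap_def]
    congr 1
    refine List.ext_getElem (by simp) fun i h1 h2 => ?_
    have hi : i < L.length := by simpa using h1
    simp only [List.getElem_map, List.getElem_range, List.getElem_zipWith]
    rw [← nodeSet_of_lt hi, h.edgeWeight hL hd (h.mem_of_length_eq hT hi)]

lemma PrimHist.forall_mem (h : PrimHist L.length lst par key T) (hT : T.length = L.length) :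
    ∀ S ∈ L.toFinset, S ∈ T.map (nodeSet L) := by
  intro S hS
  obtain ⟨y, hy, rfl⟩ := List.getElem_of_mem (List.mem_toFinset.1 hS)
  rw [← nodeSet_of_lt hy]
  exact List.mem_map_of_mem (h.mem_of_length_eq hT hy)

/-- Each set costs time proportional to its size, to the size of its target, and to the length of
its edge times the number of sets. -/
lemma PrimHist.cost_le (hL : L.Nodup)
    (hd : ∀ i j, nodeDist lst i j = (symmDiff (nodeSet L i) (nodeSet L j)).card)
    (hl : ∀ j < L.length + 2, (lst j).length = (nodeSet L j).card)
    (h : PrimHist L.length lst par key T) (hT : T.length = L.length) :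
    (T.map fun v => 1000 * ((lst v).length + (lst (par v)).length +
      (L.length + 1) * (key v + 1))).sum ≤
    1000 * (2 * totalSize L.toFinset + (L.length + 2) * weight L.toFinset (parentMap L par) +
      L.length * (L.length + 1)) := by
  have hord := h.isPrimOrder hL hd
  have hfin : (T.map (nodeSet L)).toFinset = L.toFinset := by
    ext S
    rw [List.mem_toFinset]
    exact ⟨hord.mem_of_mem, h.forall_mem hT S⟩
  set p := parentMap L par with hp
  let g : Finset ℕ → ℕ := fun S =>
    1000 * (2 * S.card + (L.length + 2) * Symdiff.edgeWeight p S + (L.length + 1))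
  have hterm : ∀ v ∈ T, 1000 * ((lst v).length + (lst (par v)).length +
      (L.length + 1) * (key v + 1)) ≤ g (nodeSet L v) := by
    intro v hv
    have hvL := h.lt hv
    have h1 := hl v (by omega)
    have h2 := hl (par v) ((h.reached hv).lt h)
    have h3 : (nodeSet L (par v)).card ≤ (nodeSet L v).card + key v := by
      rw [h.key_eq hv, hd]
      refine le_trans (Finset.card_le_card fun x hx => ?_) (Finset.card_union_le _ _)
      rw [Finset.mem_union, Finset.mem_symmDiff]
      tauto
    have h4 := h.edgeWeight hL hd hv
    rw [← hp] at h4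
    simp only [g, h4, h1, add_mul, mul_add, mul_one, one_mul]
    omega
  calc _ ≤ (T.map fun v => g (nodeSet L v)).sum := List.sum_le_sum hterm
    _ = ∑ S ∈ L.toFinset, g S := by
      rw [← hfin, List.sum_toFinset _ hord.nodup, List.map_map]; rfl
    _ = _ := by
      simp only [g]
      rw [← Finset.mul_sum, Finset.sum_add_distrib, Finset.sum_add_distrib, ← Finset.mul_sum,
        ← Finset.mul_sum, Finset.sum_const, List.toFinset_card_of_nodup hL, smul_eq_mul]
      rfl

end

end WordRAM

namespace Symdiff

open WordRAM

/-- Prim's algorithm takes time `O(n + s² + s · Δ(𝒮))`. Here `s · Δ(𝒮)` is at most the capped sum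
plus `n`, and `s² ≤ s · Δ(𝒮) + 2 s`, `s ≤ n + 1` take care of `s²`. -/
lemma construction_bound : ∃ (P : WordRAM.Program) (c : ℕ) (C : ℝ),
    ∀ (w : ℕ) (L : List (Finset ℕ)) (F : List (List ℕ)),
      L.Nodup → Lists F L → WordLengthOK c w L.toFinset → (∀ x ∈ ground L.toFinset, x < 2 ^ w) →
        ∃ (p : Finset ℕ → Finset ℕ) (ws : List ℕ) (t : ℕ),
          IsMinSymdiffGraph L.toFinset p ∧ EncodesGraph L p ws ∧
          P.Computes w (encodeFamily F) ws t ∧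
          ∀ q, IsMinSymdiffGraph L.toFinset q →
            (t : ℝ) ≤ C * (totalSize L.toFinset * Real.log (ground L.toFinset).card +
                cappedSum L.toFinset (maxWeight L.toFinset q) + 1) := by
  refine ⟨.seq startup (.seq prelim (.seq (relayout 28 29) build)), 8, 24000,
    fun w L F hL hF hwl hx => ?_⟩
  obtain ⟨hw, hX⟩ := hwl.bounds
  have hsF := Lists.length_eq hF
  have hfl := Lists.length_flatten hF hL
  have hgr := Lists.toFinset_flatten hF
  have hlen := length_encodeFamily F
  have hcard : L.toFinset.card = L.length := List.toFinset_card_of_nodup hL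
  have hsn := card_le_totalSize_add_one L.toFinset
  have hKK : (encodeFamily F).length + 1 = totalSize L.toFinset + L.toFinset.card + 2 := by omega
  have hsq := Nat.le_mul_self ((encodeFamily F).length + 1)
  have htwo := (rawLayout w hw).two_pow
  dsimp only at htwo
  rw [← hKK] at hX
  let c : Layout := ⟨w, (encodeFamily F).length, (encodeFamily F).length + 1, hw, by omega⟩
  have hin : ∀ x ∈ encodeFamily F, x < 2 ^ w := by
    intro x hxF
    rw [encodeFamily, List.mem_cons, List.mem_flatMap] at hxF
    rcases hxF with rfl | ⟨l, hl, hxl⟩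
    · omega
    · rcases List.mem_cons.1 hxl with rfl | hxl
      · have : l.length ≤ F.flatten.length := by
          rw [List.length_flatten]
          exact List.le_sum_of_mem (List.mem_map_of_mem hl)
        omega
      · exact hx x (hgr ▸ List.mem_toFinset.2 (List.mem_flatten.2 ⟨l, hl, hxl⟩))
  have hraw : Has (initSt (encodeFamily F)).raw 0 (encodeFamily F) := fun j hj => by
    simp [St.raw, initSt, hj]
  obtain ⟨ws, t, N, htN, ⟨u, ν, par, key, T, hν, hTl, hT, rfl, hN⟩, hcomp⟩ :=
    computes_of_wp_relayout (P := prelim) (P' := build) (a := 28) (b := 29) (c := c)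
      (G := fun out N => ∃ (u : ℕ) (ν par key : ℕ → ℕ) (T : List ℕ),
        Naming F.flatten.toFinset u ν ∧ T.length = F.length ∧
        PrimHist F.length (nodeList F ν u) par key T ∧
        out = (List.range F.length).flatMap (fun j => [par j, key j]) ∧
        N ≤ 6 + 60 * (F.length + 1) + 1000 * (encodeFamily F).length +
          (T.map fun v => 1000 * ((nodeList F ν u v).length +
            (nodeList F ν u (par v)).length + (F.length + 1) * (key v + 1))).sum)
      hw hin (by omega) (by norm_num) (by norm_num) rfl (by dsimp only [c]; omega) <| by
        refine wp_mono (prelim_spec hraw (by dsimp only; omega)) ?_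
        rintro B ⟨b0, b1, b28, b29, bm, bclk⟩
        refine ⟨b28, b29, fun i hi => ?_, ?_⟩
        · rw [bm]
          have hi' : (encodeFamily F).length ≤ i := hi
          simp [initSt, List.getElem?_eq_none hi']
        refine wp_mono (build_spec (F := F) rfl rfl ?_ ?_ hF.1 (by omega) b0 b1 b29 ?_) ?_
        · intro j hj
          have := hraw j hj
          simpa [St.raw, St.blank, bm] using this
        · intro x hxF
          exact hx x (hgr ▸ List.mem_toFinset.2 hxF)
        · intro k hk a b
          simp [St.blank, bm, initSt, hk]
        · rintro D ⟨u, ν, par, key, T, h1, h2, h3, h4, h5⟩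
          refine ⟨_, h4, u, ν, par, key, T, h1, h2, h3, rfl, ?_⟩
          simp only [St.blank, initSt, c] at h5 bclk
          omega
  have hnodes := nodes_nodeList (c := c) hν hF.1 (by dsimp only [c]; omega)
    (by have := hν.card ▸ List.toFinset_card_le F.flatten; dsimp only [c]; omega)
  rw [hgr] at hν
  rw [hsF] at hnodes
  rw [hsF] at hT hTl hN hcomp
  have hd := nodeDist_nodeList hF hν
  have hord := hT.isPrimOrder hL hd
  have hall := hT.forall_mem hTl
  have hmin := hord.isMinSymdiffGraph hall
  refine ⟨parentMap L par, _, t, hmin, hT.encodesGraph hL hd hTl, hcomp, fun q hq => ?_⟩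
  have hcost := hT.cost_le hL hd (fun j hj => by
    rw [← List.toFinset_card_of_nodup (hnodes.nodup j hj), toFinset_nodeList hF hν,
      Finset.card_image_of_injOn (hν.inj.mono (nodeSet_subset L j))]) hTl
  have h1 := hord.card_mul_weight_le hall hq.1
  have h2 := hmin.1.card_le
  have h3 := compressibility_le_totalSize L.toFinset
  rw [← hmin.2] at h3
  rw [hcard] at h1 h2 hsn
  have h4 := totalSize_le_log L.toFinset
  -- `s ≤ Δ + 2`, multiplied by `s`
  have h5 : L.length * L.length ≤
      L.length * weight L.toFinset (parentMap L par) + 2 * L.length := by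
    calc L.length * L.length ≤ L.length * (weight L.toFinset (parentMap L par) + 2) :=
          Nat.mul_le_mul_left _ h2
      _ = _ := by ring
  rw [add_mul L.length, mul_add L.length L.length, mul_one] at hcost
  have h6 : t ≤ 2000 * cappedSum L.toFinset (maxWeight L.toFinset q) +
      12000 * totalSize L.toFinset + 6000 := by omega
  -- the constant `24000` is `2 * 12000`, as `n ≤ 2 n log u + 1`
  have h7 : (t : ℝ) ≤ 2000 * cappedSum L.toFinset (maxWeight L.toFinset q) +
      12000 * totalSize L.toFinset + 6000 := by exact_mod_cast h6
  have h8 : (0 : ℝ) ≤ cappedSum L.toFinset (maxWeight L.toFinset q) := by positivity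
  linarith

lemma cappedSum_bound : ∃ C : ℝ, ∀ (𝒮 : Finset (Finset ℕ)) (q : Finset ℕ → Finset ℕ),
    IsMinSymdiffGraph 𝒮 q →
      (totalSize 𝒮 * Real.log (ground 𝒮).card + cappedSum 𝒮 (maxWeight 𝒮 q) : ℝ) ≤
        C * (totalSize 𝒮 * Real.log (ground 𝒮).card +
          (min (𝒮.card ^ 2 * maxWeight 𝒮 q) (𝒮.card * totalSize 𝒮) : ℕ)) := by
  refine ⟨2, fun 𝒮 q _ => ?_⟩
  have h1 : (cappedSum 𝒮 (maxWeight 𝒮 q) : ℝ) ≤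
      2 * (min (𝒮.card ^ 2 * maxWeight 𝒮 q) (𝒮.card * totalSize 𝒮) : ℕ) := by
    exact_mod_cast cappedSum_le 𝒮 (maxWeight 𝒮 q)
  have h2 : (0 : ℝ) ≤ totalSize 𝒮 * Real.log (ground 𝒮).card :=
    mul_nonneg (Nat.cast_nonneg _) (Real.log_natCast_nonneg _)
  linarith

end Symdiff

theorem mainTheorem2 :
    -- space `O(Δ(𝒮))`: the elements being renamed to `1, …, u`, the sets can be recovered, in the
    -- order of `L`, from a sequence of `O(Δ(𝒮))` words
    (∃ (D : WordRAM.Program) (c C : ℕ), ∀ L : List (Finset ℕ), L.Nodup →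
      ∃ R : List ℕ, R.length ≤ C * (Symdiff.compressibility L.toFinset + 1) ∧
        ∀ w : ℕ, Symdiff.WordLengthOK c w L.toFinset →
          (∀ x ∈ R, x < 2 ^ w) ∧
          ∃ (F : List (List ℕ)) (t : ℕ),
            Symdiff.Lists F
              (L.map (fun S => S.image (Symdiff.rankIn (Symdiff.ground L.toFinset)))) ∧
            D.Computes w R (Symdiff.encodeFamily F) t) ∧
    -- construction of a minimum-weight symdiff graph
    (∃ (P : WordRAM.Program) (c : ℕ) (C : ℝ), ∀ (w : ℕ) (L : List (Finset ℕ)) (F : List (List ℕ)),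
      L.Nodup → Symdiff.Lists F L → Symdiff.WordLengthOK c w L.toFinset →
      (∀ x ∈ Symdiff.ground L.toFinset, x < 2 ^ w) →
        ∃ (p : Finset ℕ → Finset ℕ) (ws : List ℕ) (t : ℕ),
          Symdiff.IsMinSymdiffGraph L.toFinset p ∧
          Symdiff.EncodesGraph L p ws ∧
          P.Computes w (Symdiff.encodeFamily F) ws t ∧
          ∀ q, Symdiff.IsMinSymdiffGraph L.toFinset q →
            (t : ℝ) ≤ C * (Symdiff.totalSize L.toFinset *
                  Real.log (Symdiff.ground L.toFinset).card +
                Symdiff.cappedSum L.toFinset (Symdiff.maxWeight L.toFinset q) + 1)) ∧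
    -- the second form of the time bound
    (∃ C : ℝ, ∀ (𝒮 : Finset (Finset ℕ)) (q : Finset ℕ → Finset ℕ),
      Symdiff.IsMinSymdiffGraph 𝒮 q →
        (Symdiff.totalSize 𝒮 * Real.log (Symdiff.ground 𝒮).card +
            Symdiff.cappedSum 𝒮 (Symdiff.maxWeight 𝒮 q) : ℝ) ≤
          C * (Symdiff.totalSize 𝒮 * Real.log (Symdiff.ground 𝒮).card +
            (min (𝒮.card ^ 2 * Symdiff.maxWeight 𝒮 q) (𝒮.card * Symdiff.totalSize 𝒮) : ℕ))) := by
  exact ⟨Symdiff.space_bound, Symdiff.construction_bound, Symdiff.cappedSum_bound⟩
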